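/- Let $Q=[-\tfrac12,\tfrac12]^d$ and let $(\Omega,\mathcal F,\mathbb P)$ be a probability space on which $(\mathbb Z^d,+)$ acts by measurable, measure-preserving maps $\tau_k$, the action being ergodic. A field $F(x,\omega)$ on $\mathbb R^d\times\Omega$ is called stationary if, for all $k\in\mathbb Z^d$, $F(x+k,\omega)=F(x,\tau_k\omega)$ for almost all $(x,\omega)$. Let $A_{per},C_{per}:\mathbb R^d\to\mathbb R^{d\times d}$ be measurable and $\mathbb Z^d$-periodic, let $b_\eta$ ($\eta>0$) be stationary scalar fields, and let $M>0$ be such that $\|b_\eta\|_{L^\infty(Q\times\Omega)}\le M$ for all $\eta>0$. Assume that $m_\eta:=\|b_\eta\|_{L^\infty(Q;L^2(\Omega))}\to0$ as $\eta\to0^+$, and that for some $0<\alpha\le\beta$, all $\xi\in\mathbb R^d$, almost all $x$ and all $s\in[-M,M]$, $$\alpha|\xi|^2\le A_{per}(x)\xi\cdot\xi,\quad \alpha|\xi|^2\le (A_{per}+sC_{per})(x)\xi\cdot\xi,\quad |A_{per}(x)\xi|\le\beta|\xi|,\quad |(A_{per}+sC_{per})(x)\xi|\le\beta|\xi|.$$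 Put $A_\eta=A_{per}+b_\eta C_{per}$. For $1\le i\le d$ let $w_i^\eta$ be a corrector, that is, a solution of $$-\operatorname{div}(A_\eta(\nabla w_i^\eta+e_i))=0\ \text{ in }\mathbb R^d\text{ almost surely},\qquad \nabla w_i^\eta\in L^2(Q\times\Omega)\text{ stationary},\qquad \mathbb E\int_Q\nabla w_i^\eta=0,$$ and let $w_i^0$ be a $\mathbb Z^d$-periodic solution of $-\operatorname{div}(A_{per}(\nabla w_i^0+e_i))=0$ with $\nabla w_i^0\in L^2(Q)$. Define the matrices $A_\eta^*$ and $A_{per}^*$ by $$A_\eta^*e_i=\mathbb E\int_Q A_\eta(\nabla w_i^\eta+e_i),\qquad A_{per}^*e_i=\int_Q A_{per}(\nabla w_i^0+e_i).$$ (a) Every sequence of parameters $\eta\to0^+$ has a subsequence along which $b_\eta/m_\eta$ converges weakly-$*$ in $L^\infty(Q;L^2(\Omega))$ to (the restriction to $Q$ of) a stationary field $\bar b_0$. (b) Along any sequence $\eta\to0^+$ with this property the following holds. For each $i$ the problem $$-\operatorname{div}(A_{per}\nabla v_i^0)=\operatorname{div}(\bar b_0C_{per}(\nabla w_i^0+e_i))\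 \text{ in }\mathbb R^d\text{ almost surely},\qquad \nabla v_i^0\in L^2(Q\times\Omega)\text{ stationary},\qquad \mathbb E\int_Q\nabla v_i^0=0$$ has a solution, which can be chosen such that $\mathbb E(v_i^0)$ exists and $\nabla\mathbb E(v_i^0)=\mathbb E(\nabla v_i^0)$. For every choice of solutions $v_i^0$, $$\nabla w_i^\eta=\nabla w_i^0+m_\eta\nabla v_i^0+o(m_\eta)\quad\text{weakly in }L^2(Q\times\Omega)\text{ for all }i,$$ that is, for every $\psi\in L^2(Q\times\Omega;\mathbb R^d)$ one has $\mathbb E\int_Q(\nabla w_i^\eta-\nabla w_i^0-m_\eta\nabla v_i^0)\cdot\psi=o(m_\eta)$, and $$A_\eta^*=A_{per}^*+m_\eta\tilde A_1^*+o(m_\eta),\qquad \tilde A_1^*e_i=\int_Q\mathbb E(\bar b_0)\,C_{per}(\nabla w_i^0+e_i)+\int_Q A_{per}\,\mathbb E(\nabla v_i^0).$$ All equations are understood in the sense of distributions. (If $m_\eta=0$, then $b_\eta/m_\eta$ is read as $0$.) -/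

import Mathlib

open MeasureTheory Filter Topology Asymptotics
open scoped ENNReal RealInnerProductSpace

noncomputable section

namespace RandomHom

/-- The Euclidean space `ℝ^d`. -/
abbrev Space (d : ℕ) := EuclideanSpace ℝ (Fin d)

/-- Tensors are real `d × d` matrices. -/
abbrev Tensor (d : ℕ) := Matrix (Fin d) (Fin d) ℝ

/-- The matrix-vector product `M ξ`, as a vector of the Euclidean space. -/
abbrev app {d : ℕ} (M : Tensor d) (ξ : Space d) : Space d := Matrix.toEuclideanLin M ξ

/-- The `i`-th vector of the canonical basis. -/
abbrev basisVec {d : ℕ} (i : Fin d) : Space d := EuclideanSpace.single i (1 : ℝ)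

/-- The point of `ℝ^d` with integer coordinates `k`. -/
def latticePoint {d : ℕ} (k : Fin d → ℤ) : Space d := WithLp.toLp 2 fun i => (k i : ℝ)

/-- The unit cell `Q = [-1/2, 1/2]^d`. -/
def unitCell (d : ℕ) : Set (Space d) := {x | ∀ i, x i ∈ Set.Icc (-(1 / 2) : ℝ) (1 / 2)}

/-- Lebesgue measure on the unit cell. -/
def cellMeasure (d : ℕ) : Measure (Space d) := volume.restrict (unitCell d)

/-- `ℤ^d`-periodicity, almost everywhere. -/
def Periodic {d : ℕ} {β : Type*} (f : Space d → β) : Prop :=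
  ∀ k : Fin d → ℤ, ∀ᵐ x : Space d, f (x + latticePoint k) = f x

/-- Stationarity: `F (x + k, ω) = F (x, τ_k ω)` almost everywhere in `(x, ω)`, for all `k ∈ ℤ^d`.
The action of `ℤ^d` on `Ω` is written additively, `τ_k ω = k +ᵥ ω`. -/
def Stationary {d : ℕ} {Ω β : Type*} [MeasurableSpace Ω] [AddAction (Fin d → ℤ) Ω]
    (P : Measure Ω) (F : Space d → Ω → β) : Prop :=
  ∀ k : Fin d → ℤ, ∀ᵐ p : Space d × Ω ∂(volume.prod P),
    F (p.1 + latticePoint k) p.2 = F p.1 (k +ᵥ p.2)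

/-- `g` is the weak (distributional) gradient of `u` on `ℝ^d`. -/
structure HasWeakGradient {d : ℕ} (u : Space d → ℝ) (g : Space d → Space d) : Prop where
  locallyIntegrable : LocallyIntegrable u
  locallyIntegrable_grad : LocallyIntegrable g
  integral_eq : ∀ φ : Space d → ℝ, ContDiff ℝ (⊤ : ℕ∞) φ → HasCompactSupport φ → ∀ j : Fin d,
    ∫ x, u x * fderiv ℝ φ x (basisVec j) = -∫ x, g x j * φ x

/-- `div σ = 0` in the sense of distributions on `ℝ^d`: `∫ σ · ∇φ = 0` for every test
function `φ`. Here `fderiv ℝ φ x (σ x)` is `∇φ(x) · σ(x)`. -/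
structure IsDivFree {d : ℕ} (σ : Space d → Space d) : Prop where
  locallyIntegrable : LocallyIntegrable σ
  integral_eq_zero : ∀ φ : Space d → ℝ, ContDiff ℝ (⊤ : ℕ∞) φ → HasCompactSupport φ →
    ∫ x, fderiv ℝ φ x (σ x) = 0

/-- The norm of `L^∞(Q; L²(Ω))`, i.e. `ess sup_{x ∈ Q} ‖f (x, ·)‖_{L²(Ω)}`. -/
def mixedNorm {d : ℕ} {Ω : Type*} [MeasurableSpace Ω] (P : Measure Ω)
    (f : Space d → Ω → ℝ) : ℝ≥0∞ :=
  essSup (fun x => eLpNorm (f x) 2 P) (cellMeasure d)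

/-- Weak-`*` convergence in `L^∞(Q; L²(Ω))`, the dual of `L¹(Q; L²(Ω))`: convergence of the
integrals against every `ψ` with `∫_Q ‖ψ (x, ·)‖_{L²(Ω)} dx < ∞`. -/
def TendstoWeakStar {d : ℕ} {Ω : Type*} [MeasurableSpace Ω] (P : Measure Ω)
    (f : ℕ → Space d → Ω → ℝ) (f₀ : Space d → Ω → ℝ) : Prop :=
  ∀ ψ : Space d → Ω → ℝ,
    AEStronglyMeasurable (Function.uncurry ψ) ((cellMeasure d).prod P) →
    ∫⁻ x, eLpNorm (ψ x) 2 P ∂(cellMeasure d) < ∞ →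
    Tendsto (fun n => ∫ p : Space d × Ω, f n p.1 p.2 * ψ p.1 p.2 ∂((cellMeasure d).prod P)) atTop
      (𝓝 (∫ p : Space d × Ω, f₀ p.1 p.2 * ψ p.1 p.2 ∂((cellMeasure d).prod P)))

/-- A stationary random field that belongs to `L^∞(Q; L²(Ω))`. -/
structure IsStationaryField {d : ℕ} {Ω : Type*} [MeasurableSpace Ω] [AddAction (Fin d → ℤ) Ω]
    (P : Measure Ω) (f : Space d → Ω → ℝ) : Prop where
  measurable : AEStronglyMeasurable (Function.uncurry f) ((volume : Measure (Space d)).prod P)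
  stationary : Stationary P f
  mixedNorm_lt_top : mixedNorm P f < ∞

/-- `g = ∇u` (almost surely, weakly on `ℝ^d`) is stationary, square integrable on `Q × Ω`, and
`𝔼 (∫_Q ∇u) = 0`. -/
structure IsStationaryGradient {d : ℕ} {Ω : Type*} [MeasurableSpace Ω] [AddAction (Fin d → ℤ) Ω]
    (P : Measure Ω) (u : Space d → Ω → ℝ) (g : Space d → Ω → Space d) : Prop where
  measurable : AEStronglyMeasurable (Function.uncurry u) ((volume : Measure (Space d)).prod P)
  measurable_grad : AEStronglyMeasurable (Function.uncurry g) ((volume : Measure (Space d)).prod P)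
  hasWeakGradient : ∀ᵐ ω ∂P, HasWeakGradient (fun x => u x ω) (fun x => g x ω)
  stationary : Stationary P g
  memLp : MemLp (Function.uncurry g) 2 ((cellMeasure d).prod P)
  mean_eq_zero : ∫ ω, ∫ x, g x ω ∂(cellMeasure d) ∂P = 0

/-- The perturbed tensor `A_per(x) + b(x, ω) C_per(x)`. -/
def perturbed {d : ℕ} {Ω : Type*} (A C : Space d → Tensor d) (b : Space d → Ω → ℝ) :
    Space d → Ω → Tensor d :=
  fun x ω => A x + b x ω • C x

/-- `w`, with gradient `g`, is an `i`-th corrector of the random tensor `A`: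
`-div (A (∇w + e_i)) = 0` in `ℝ^d` almost surely, `∇w` stationary, `𝔼 (∫_Q ∇w) = 0`. -/
structure IsCorrector {d : ℕ} {Ω : Type*} [MeasurableSpace Ω] [AddAction (Fin d → ℤ) Ω]
    (P : Measure Ω) (A : Space d → Ω → Tensor d) (i : Fin d)
    (w : Space d → Ω → ℝ) (g : Space d → Ω → Space d) : Prop where
  isStationaryGradient : IsStationaryGradient P w g
  equation : ∀ᵐ ω ∂P, IsDivFree fun x => app (A x ω) (g x ω + basisVec i)

/-- `w`, with gradient `g`, is an `i`-th periodic corrector of the tensor `A`: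
`-div (A (∇w + e_i)) = 0`, `w` is `ℤ^d`-periodic and `∇w ∈ L²(Q)`. -/
structure IsPeriodicCorrector {d : ℕ} (A : Space d → Tensor d) (i : Fin d)
    (w : Space d → ℝ) (g : Space d → Space d) : Prop where
  periodic : Periodic w
  hasWeakGradient : HasWeakGradient w g
  memLp : MemLp g 2 (cellMeasure d)
  equation : IsDivFree fun x => app (A x) (g x + basisVec i)

/-- `v`, with gradient `g`, solves `-div (A ∇v) = div (b C (G + e_i))` in `ℝ^d` almost surely,
with `∇v` stationary and `𝔼 (∫_Q ∇v) = 0`. (`G` will be the gradient of the periodic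
corrector.) -/
structure IsFirstOrderCorrector {d : ℕ} {Ω : Type*} [MeasurableSpace Ω]
    [AddAction (Fin d → ℤ) Ω] (P : Measure Ω) (A C : Space d → Tensor d)
    (b : Space d → Ω → ℝ) (G : Space d → Space d) (i : Fin d)
    (v : Space d → Ω → ℝ) (g : Space d → Ω → Space d) : Prop where
  isStationaryGradient : IsStationaryGradient P v g
  equation : ∀ᵐ ω ∂P, IsDivFree fun x =>
    app (A x) (g x ω) + b x ω • app (C x) (G x + basisVec i)

/-- The homogenized tensor of the random tensor `A` whose correctors have gradients `g i`:
its `i`-th column is `𝔼 (∫_Q A (∇w_i + e_i))`. -/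
def homogenized {d : ℕ} {Ω : Type*} [MeasurableSpace Ω] (P : Measure Ω)
    (A : Space d → Ω → Tensor d) (g : Fin d → Space d → Ω → Space d) : Tensor d :=
  Matrix.of fun j i =>
    (∫ ω, ∫ x, app (A x ω) (g i x ω + basisVec i) ∂(cellMeasure d) ∂P) j

/-- The homogenized tensor of the periodic tensor `A` whose correctors have gradients `g i`:
its `i`-th column is `∫_Q A (∇w_i + e_i)`. -/
def periodicHomogenized {d : ℕ} (A : Space d → Tensor d) (g : Fin d → Space d → Space d) :
    Tensor d :=
  Matrix.of fun j i => (∫ x, app (A x) (g i x + basisVec i) ∂(cellMeasure d)) j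

/-- The first-order correction of the homogenized tensor: its `i`-th column is
`∫_Q 𝔼(b) C (G_i + e_i) + ∫_Q A 𝔼(∇v_i)`. -/
def firstOrderTensor {d : ℕ} {Ω : Type*} [MeasurableSpace Ω] (P : Measure Ω)
    (A C : Space d → Tensor d) (b : Space d → Ω → ℝ) (G : Fin d → Space d → Space d)
    (g : Fin d → Space d → Ω → Space d) : Tensor d :=
  Matrix.of fun j i =>
    ((∫ x, (∫ ω, b x ω ∂P) • app (C x) (G i x + basisVec i) ∂(cellMeasure d)) +
      ∫ x, app (A x) (∫ ω, g i x ω ∂P) ∂(cellMeasure d)) j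

end RandomHom

end

open RandomHom

set_option linter.unusedSectionVars false

/-! Everything takes place in the Hilbert space `FieldSpace` of square integrable vector fields on Q
× Ω. Let V be its closed subspace `gradientSpace`, generated by the gradients of mollified
stationary functions. Two facts turn each equation of the statement into a variational equation on
V. A stationary square integrable field is almost surely divergence free exactly when it is
orthogonal to V (`inner_gradientSpace_eq_zero`, `ae_isDivFree_of_inner_eq_zero`). The elements of V
are exactly the stationary gradients with zero mean (`exists_potential`,
`IsStationaryGradient.mem_gradientSpace`); that every such gradient lies in V is where ergodicity
enters.

Let T be multiplication by A_per and S_n multiplication by b_n C_per. The difference z_n of the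
random and the periodic corrector gradients lies in V, and T z_n + S_n z_n + F_n is orthogonal to V,
where F_n = b_n C_per (∇w⁰ + e_i). Since ∇w⁰ does not depend on ω, the norm of L^∞(Q; L²(Ω))
suffices to get ‖F_n‖ ≤ c m_n, and F_n / m_n converges weakly by the choice of the subsequence.
Coercivity of T + S_n gives ‖z_n‖ ≤ (c/α) m_n. The term S_n z_n / m_n tends weakly to zero: the
factor b_n can be moved onto the fixed test field, where it is bounded and tends to zero in L².
Hence z_n / m_n satisfies the equation of ∇v⁰ in the limit, tested on V. Solving the adjoint problem
in V replaces an arbitrary test field by one of V, so the whole sequence converges weakly without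
extracting subsequences. Testing the fluxes with constant fields gives the expansion of the
homogenized tensor (`perturbation_expansion`, `corrector_expansion`, `homogenized_expansion`).

The facts about V rest on three tools. Mass transport (`integral_transport`) makes convolution with
a reflected kernel the adjoint of convolution on the cell, which is integration by parts without
boundary terms. A Poincaré inequality in the weighted space of `refMeasure`
(`IsSmoothPotential.lintegral_centered_le`) makes centered potentials converge along with their
gradients. A countable family of test functions (`exists_countable_tests`) turns statements valid
almost surely for each test function into statements valid almost surely for all of them.

For the compactness claim, the quotients b_η / m_η lie in the unit ball of L^∞(Q; L²(Ω)). Weak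
limits in L²(Q × Ω) stay in this ball, and L²(Q × Ω) is dense in the predual L¹(Q; L²(Ω)), so weak
compactness in a Hilbert space suffices (`exists_subseq_tendstoWeakStar`). -/

noncomputable section

namespace RandomHom

/-! ### Lattice cells and periodic functions -/

section

variable {d : ℕ} {Ω : Type*} [MeasurableSpace Ω]

/-- The index `k` of the half-open lattice cell `k + [-1/2, 1/2)^d` that contains `x`. -/
def cellIndex (x : Space d) : Fin d → ℤ := fun i => ⌊x i + 1 / 2⌋

/-- The half-open unit cell `[-1/2, 1/2)^d`. -/
def halfOpenCell (d : ℕ) : Set (Space d) := {x | cellIndex x = 0}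

lemma measurable_cellIndex : Measurable (cellIndex : Space d → Fin d → ℤ) := by
  refine measurable_pi_lambda _ fun i => ?_
  exact Int.measurable_floor.comp (by fun_prop)

lemma measurableSet_halfOpenCell : MeasurableSet (halfOpenCell d) :=
  measurable_cellIndex (measurableSet_singleton 0)

@[simp]
lemma latticePoint_apply (k : Fin d → ℤ) (i : Fin d) : latticePoint k i = k i := rfl

@[simp]
lemma latticePoint_zero : (latticePoint 0 : Space d) = 0 := by
  ext i; simp

lemma latticePoint_add (k l : Fin d → ℤ) :
    latticePoint (k + l) = latticePoint k + latticePoint l := by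
  ext i; simp

lemma cellIndex_add_latticePoint (x : Space d) (k : Fin d → ℤ) :
    cellIndex (x + latticePoint k) = cellIndex x + k := by
  ext i
  simp only [cellIndex, PiLp.add_apply, latticePoint_apply, Pi.add_apply]
  rw [show x i + (k i : ℝ) + 1 / 2 = (x i + 1 / 2) + (k i : ℝ) by ring, Int.floor_add_intCast]

lemma mem_halfOpenCell_iff {x : Space d} :
    x ∈ halfOpenCell d ↔ ∀ i, x i ∈ Set.Ico (-(1 / 2) : ℝ) (1 / 2) := by
  simp only [halfOpenCell, Set.mem_ofPred_eq, funext_iff, cellIndex, Pi.zero_apply,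
    Int.floor_eq_zero_iff, Set.mem_Ico]
  refine forall_congr' fun i => ?_
  constructor <;> rintro ⟨h1, h2⟩ <;> constructor <;> linarith

lemma add_latticePoint_mem_halfOpenCell_iff {x : Space d} {k : Fin d → ℤ} :
    x + latticePoint k ∈ halfOpenCell d ↔ k = -cellIndex x := by
  rw [halfOpenCell, Set.mem_ofPred_eq, cellIndex_add_latticePoint, eq_neg_iff_add_eq_zero, add_comm]

/-- Half-open cells tile the space exactly, while closed cells overlap on their faces. The faces are
null, so integrals over the cell may use either version. -/
lemma halfOpenCell_ae_eq : halfOpenCell d =ᵐ[volume] unitCell d := by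
  have h := (Measure.univ_pi_Ico_ae_eq_Icc (μ := fun _ : Fin d => (volume : Measure ℝ))
    (f := fun _ => -(1 / 2)) (g := fun _ => 1 / 2))
  have h2 := (EuclideanSpace.volume_preserving_symm_measurableEquiv_toLp
    (Fin d)).quasiMeasurePreserving.preimage_ae_eq h
  have e1 : halfOpenCell d = (MeasurableEquiv.toLp 2 (Fin d → ℝ)).symm ⁻¹'
      Set.univ.pi fun _ => Set.Ico (-(1 / 2)) (1 / 2) := by
    ext x; simp [mem_halfOpenCell_iff]
  have e2 : unitCell d = (MeasurableEquiv.toLp 2 (Fin d → ℝ)).symm ⁻¹'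
      Set.Icc (fun _ => -(1 / 2)) fun _ => 1 / 2 := by
    ext x; simp [unitCell, Set.mem_preimage, Pi.le_def, forall_and]
  rw [e1, e2]
  exact h2

lemma cellMeasure_eq : cellMeasure d = volume.restrict (halfOpenCell d) :=
  (Measure.restrict_congr_set halfOpenCell_ae_eq).symm

instance : IsProbabilityMeasure (cellMeasure d) := by
  constructor
  rw [cellMeasure, Measure.restrict_apply_univ]
  have h2 := (EuclideanSpace.volume_preserving_symm_measurableEquiv_toLp
    (Fin d)).measure_preimage
      (s := Set.Icc (fun _ : Fin d => (-(1 / 2) : ℝ)) (fun _ => 1 / 2))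
      measurableSet_Icc.nullMeasurableSet
  rw [Real.volume_Icc_pi] at h2
  convert h2 using 1
  · congr 1
    ext x; simp [unitCell, Set.mem_preimage, Pi.le_def, forall_and]
  · norm_num

lemma cellMeasure_absolutelyContinuous : cellMeasure d ≪ volume :=
  Measure.restrict_le_self.absolutelyContinuous

lemma lintegral_eq_tsum_cell (f : Space d → ℝ≥0∞) :
    ∫⁻ x, f x = ∑' k : Fin d → ℤ, ∫⁻ x, f (x + latticePoint k) ∂(cellMeasure d) := by
  have hcov : (Set.univ : Set (Space d)) = ⋃ k : Fin d → ℤ, cellIndex ⁻¹' {k} := by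
    ext x; simp
  rw [← setLIntegral_univ f, hcov, lintegral_iUnion
    (fun k => measurable_cellIndex (measurableSet_singleton k))]
  · refine tsum_congr fun k => ?_
    rw [cellMeasure_eq, ← lintegral_indicator (measurable_cellIndex (measurableSet_singleton k)),
      ← lintegral_indicator measurableSet_halfOpenCell,
      ← lintegral_add_right_eq_self _ (latticePoint k)]
    refine lintegral_congr fun x => ?_
    classical
    simp only [Set.indicator_apply, Set.mem_preimage, Set.mem_singleton_iff,
      cellIndex_add_latticePoint, halfOpenCell, Set.mem_ofPred_eq, add_eq_right]
  · intro k l hkl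
    rw [Function.onFun, Set.disjoint_left]
    rintro x rfl h
    exact hkl h

/-- The integral of a periodic function over a translated cell does not depend on the
translation. -/
lemma Periodic.lintegral_cell_add {f : Space d → ℝ≥0∞} (hf : Periodic f)
    (hm : AEMeasurable f) (z : Space d) :
    ∫⁻ x, f (x + z) ∂(cellMeasure d) = ∫⁻ x, f x ∂(cellMeasure d) := by
  classical
  have hmq : Measurable ((halfOpenCell d).indicator (1 : Space d → ℝ≥0∞)) :=
    measurable_one.indicator measurableSet_halfOpenCell
  calc ∫⁻ x, f (x + z) ∂(cellMeasure d)
      = ∫⁻ x, (halfOpenCell d).indicator 1 (x - z) * f x := by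
        rw [cellMeasure_eq, ← lintegral_indicator measurableSet_halfOpenCell,
          ← lintegral_sub_right_eq_self _ z]
        refine lintegral_congr fun x => ?_
        simp [Set.indicator_apply]
    _ = ∑' k, ∫⁻ x, (halfOpenCell d).indicator 1 (x + latticePoint k - z) * f x
          ∂(cellMeasure d) := by
        rw [lintegral_eq_tsum_cell]
        refine tsum_congr fun k => lintegral_congr_ae ?_
        filter_upwards [cellMeasure_absolutelyContinuous.ae_le (hf k)] with x hx
        rw [hx]
    _ = ∫⁻ x, ∑' k, (halfOpenCell d).indicator 1 (x + latticePoint k - z) * f x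
          ∂(cellMeasure d) := by
        rw [lintegral_tsum]
        intro k
        refine AEMeasurable.mul ?_ (hm.mono_ac cellMeasure_absolutelyContinuous)
        exact (hmq.comp (by fun_prop)).aemeasurable
    _ = ∫⁻ x, f x ∂(cellMeasure d) := by
        refine lintegral_congr fun x => ?_
        -- Exactly one lattice translate of x - z lies in the half-open cell, so the periodized
        -- indicator is identically one.
        rw [tsum_eq_single (-cellIndex (x - z))]
        · rw [add_sub_right_comm, Set.indicator_of_mem
            (add_latticePoint_mem_halfOpenCell_iff.2 rfl)]
          simp
        · intro k hk
          rw [add_sub_right_comm, Set.indicator_of_notMem, zero_mul]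
          rwa [add_latticePoint_mem_halfOpenCell_iff]

end

/-! ### Stationary fields -/

section

section StationaryFields

variable {d : ℕ} {Ω : Type*} [MeasurableSpace Ω] {P : Measure Ω} {E E' : Type*}

lemma measurePreserving_shift (P : Measure Ω) [IsProbabilityMeasure P] (z : Space d) :
    MeasurePreserving (fun p : Space d × Ω => (p.1 + z, p.2)) ((volume : Measure (Space d)).prod P)
      ((volume : Measure (Space d)).prod P) :=
  (measurePreserving_add_right volume z).prod (MeasurePreserving.id P)

lemma cell_prod_absolutelyContinuous (P : Measure Ω) [IsProbabilityMeasure P] :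
    (cellMeasure d).prod P ≪ (volume : Measure (Space d)).prod P :=
  cellMeasure_absolutelyContinuous.prod Measure.AbsolutelyContinuous.rfl

variable [AddAction (Fin d → ℤ) Ω]

lemma Stationary.comp {F : Space d → Ω → E} (hF : Stationary P F) (φ : E → E') :
    Stationary P fun x ω => φ (F x ω) := fun k => by
  filter_upwards [hF k] with p hp
  rw [hp]

lemma Stationary.comp₂ {E'' : Type*} {F : Space d → Ω → E} {G : Space d → Ω → E'}
    (hF : Stationary P F) (hG : Stationary P G) (φ : E → E' → E'') :
    Stationary P fun x ω => φ (F x ω) (G x ω) := fun k => by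
  filter_upwards [hF k, hG k] with p hp hq
  rw [hp, hq]

lemma Periodic.stationary {f : Space d → E} (hf : Periodic f) :
    Stationary P fun x (_ : Ω) => f x := fun k =>
  Measure.quasiMeasurePreserving_fst.ae (hf k)

lemma stationary_const (c : E) : Stationary P fun (_ : Space d) (_ : Ω) => c :=
  fun _ => ae_of_all _ fun _ => rfl

variable [IsProbabilityMeasure P]

lemma Stationary.shift {F : Space d → Ω → E} (hF : Stationary P F) (z : Space d) :
    Stationary P fun x ω => F (x + z) ω := fun k => by
  filter_upwards [(measurePreserving_shift P z).quasiMeasurePreserving.ae (hF k)] with p hp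
  rw [add_right_comm]
  exact hp

variable [MeasurableConstVAdd (Fin d → ℤ) Ω] [VAddInvariantMeasure (Fin d → ℤ) Ω P]

lemma measurePreserving_act (μ : Measure (Space d)) [SFinite μ] (P : Measure Ω)
    [IsProbabilityMeasure P] [VAddInvariantMeasure (Fin d → ℤ) Ω P] (k : Fin d → ℤ) :
    MeasurePreserving (fun p : Space d × Ω => (p.1, k +ᵥ p.2)) (μ.prod P) (μ.prod P) :=
  (MeasurePreserving.id μ).prod (measurePreserving_vadd k P)

lemma Stationary.congr {F G : Space d → Ω → E} (hF : Stationary P F)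
    (h : Function.uncurry F =ᵐ[(volume : Measure (Space d)).prod P] Function.uncurry G) :
    Stationary P G := fun k => by
  filter_upwards [hF k, (measurePreserving_shift P (latticePoint k)).quasiMeasurePreserving.ae h,
    (measurePreserving_act volume P k).quasiMeasurePreserving.ae h] with p h1 h2 h3
  simp only [Function.uncurry] at h2 h3
  rw [← h2, ← h3, h1]

/-- Since the action preserves P, taking expectations turns stationarity into periodicity. Shift
invariance of stationary fields is thereby reduced to that of periodic functions. -/
lemma Stationary.periodic_lintegral {F : Space d → Ω → ℝ≥0∞} (hF : Stationary P F) :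
    Periodic fun x => ∫⁻ ω, F x ω ∂P := fun k => by
  filter_upwards [Measure.ae_ae_of_ae_prod (hF k)] with x hx
  rw [lintegral_congr_ae hx]
  exact (measurePreserving_vadd k P).lintegral_comp_emb (measurableEmbedding_const_vadd k) _

lemma Stationary.lintegral_shift {F : Space d → Ω → ℝ≥0∞} (hF : Stationary P F)
    (hm : AEMeasurable (Function.uncurry F) ((volume : Measure (Space d)).prod P)) (z : Space d) :
    ∫⁻ p : Space d × Ω, F (p.1 + z) p.2 ∂((cellMeasure d).prod P) =
      ∫⁻ p : Space d × Ω, F p.1 p.2 ∂((cellMeasure d).prod P) := by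
  have hm' : AEMeasurable (fun p : Space d × Ω => F (p.1 + z) p.2)
      ((volume : Measure (Space d)).prod P) :=
    hm.comp_quasiMeasurePreserving (measurePreserving_shift P z).quasiMeasurePreserving
  rw [lintegral_prod _ (hm'.mono_ac (cell_prod_absolutelyContinuous P)),
    lintegral_prod (fun p : Space d × Ω => F p.1 p.2) (hm.mono_ac (cell_prod_absolutelyContinuous P))]
  exact hF.periodic_lintegral.lintegral_cell_add hm.lintegral_prod_right' z

/-- The law of a stationary field on a translated cell does not depend on the translation. -/
lemma Stationary.identDistrib_shift [MeasurableSpace E] {F : Space d → Ω → E}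
    (hF : Stationary P F)
    (hm : AEMeasurable (Function.uncurry F) ((volume : Measure (Space d)).prod P)) (z : Space d) :
    ProbabilityTheory.IdentDistrib (fun p : Space d × Ω => F (p.1 + z) p.2)
      (fun p : Space d × Ω => F p.1 p.2) ((cellMeasure d).prod P) ((cellMeasure d).prod P) := by
  have h1 : AEMeasurable (fun p : Space d × Ω => F (p.1 + z) p.2) ((cellMeasure d).prod P) :=
    (hm.comp_quasiMeasurePreserving
      (measurePreserving_shift P z).quasiMeasurePreserving).mono_ac (cell_prod_absolutelyContinuous P)
  have h2 : AEMeasurable (fun p : Space d × Ω => F p.1 p.2) ((cellMeasure d).prod P) :=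
    hm.mono_ac (cell_prod_absolutelyContinuous P)
  refine ⟨h1, h2, Measure.ext fun s hs => ?_⟩
  rw [← lintegral_indicator_one hs, ← lintegral_indicator_one hs,
    lintegral_map' (measurable_one.indicator hs).aemeasurable h1,
    lintegral_map' (measurable_one.indicator hs).aemeasurable h2]
  -- The composition of a stationary field with an indicator is stationary, so shift invariance of
  -- integrals yields that of the law.
  exact (hF.comp (s.indicator (1 : E → ℝ≥0∞))).lintegral_shift
    ((measurable_one.indicator hs).comp_aemeasurable hm) z

end StationaryFields

/-! ### A finite reference measure on the whole space -/

section ReferenceMeasure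

variable {d : ℕ}

/-- A positive continuous density with finite second moment. -/
def refDensity (x : Space d) : ℝ := ((1 + ‖x‖) ^ (d + 3))⁻¹

/-- A finite measure on `ℝ^d`, equivalent to Lebesgue measure, with finite second moment. -/
def refMeasure (d : ℕ) : Measure (Space d) :=
  volume.withDensity fun x => ENNReal.ofReal (refDensity x)

lemma refDensity_pos (x : Space d) : 0 < refDensity x := by
  unfold refDensity; positivity

lemma continuous_refDensity : Continuous (refDensity : Space d → ℝ) := by
  unfold refDensity
  refine Continuous.inv₀ (by fun_prop) fun x => by positivity

lemma measurable_refDensity : Measurable fun x : Space d => ENNReal.ofReal (refDensity x) :=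
  continuous_refDensity.measurable.ennreal_ofReal

/-- The exponent d + 3 of the density is chosen for this bound: two powers absorb ‖x‖², and the
remaining d + 1 still exceed the dimension. -/
lemma lintegral_sq_mul_refDensity_lt_top :
    ∫⁻ x : Space d, ‖x‖ₑ ^ 2 * ENNReal.ofReal (refDensity x) < ∞ := by
  have h := (integrable_one_add_norm (E := Space d) (μ := volume) (r := d + 1)
    (by simp)).lintegral_lt_top
  refine lt_of_le_of_lt (lintegral_mono fun x => ?_) h
  rw [← ofReal_norm, ← ENNReal.ofReal_pow (norm_nonneg _),
    ← ENNReal.ofReal_mul (by positivity)]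
  refine ENNReal.ofReal_le_ofReal ?_
  rw [Real.rpow_neg (by positivity), refDensity, ← div_eq_mul_inv, ← Nat.cast_succ,
    Real.rpow_natCast, ← one_div, div_le_div_iff₀ (by positivity) (by positivity), one_mul,
    show d + 3 = 2 + d.succ by omega, pow_add]
  gcongr
  linarith [norm_nonneg x]

instance : IsFiniteMeasure (refMeasure d) := by
  constructor
  rw [refMeasure, withDensity_apply _ MeasurableSet.univ, setLIntegral_univ]
  have h := (integrable_one_add_norm (E := Space d) (μ := volume) (r := d + 3)
    (by simp)).lintegral_lt_top
  refine lt_of_le_of_lt (lintegral_mono fun x => ?_) h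
  refine ENNReal.ofReal_le_ofReal (le_of_eq ?_)
  rw [Real.rpow_neg (by positivity), refDensity]
  norm_cast

lemma refMeasure_absolutelyContinuous : refMeasure d ≪ volume :=
  withDensity_absolutelyContinuous _ _

lemma absolutelyContinuous_refMeasure : volume ≪ refMeasure d :=
  withDensity_absolutelyContinuous' measurable_refDensity.aemeasurable
    (ae_of_all _ fun x => by simpa using refDensity_pos x)

lemma norm_le_of_mem_unitCell {y : Space d} (hy : y ∈ unitCell d) : ‖y‖ ≤ d := by
  have h : ‖y‖ ^ 2 ≤ (d : ℝ) ^ 2 := by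
    rw [EuclideanSpace.norm_sq_eq]
    calc ∑ i, ‖y i‖ ^ 2 ≤ ∑ _i : Fin d, (1 : ℝ) := by
          refine Finset.sum_le_sum fun i _ => ?_
          have := hy i
          rw [Real.norm_eq_abs, sq_abs]
          nlinarith [this.1, this.2]
      _ = d := by simp
      _ ≤ (d : ℝ) ^ 2 := by exact_mod_cast Nat.le_self_pow two_ne_zero d
  exact (sq_le_sq₀ (norm_nonneg _) (by positivity)).1 h

lemma ae_mem_unitCell : ∀ᵐ y ∂(cellMeasure d), y ∈ unitCell d := by
  refine ae_restrict_mem ?_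
  have : unitCell d = ⋂ i, {x : Space d | x i ∈ Set.Icc (-(1 / 2) : ℝ) (1 / 2)} := by
    ext x; simp [unitCell]
  rw [this]
  refine MeasurableSet.iInter fun i => ?_
  have hi : Measurable fun x : Space d => x i := by fun_prop
  exact hi measurableSet_Icc

/-- The factor by which `refDensity` can change across a unit cell. -/
def refConst (d : ℕ) : ℝ := (1 + d) ^ (d + 3)

/-- As ‖y‖ ≤ d on the cell, 1 + ‖x‖ ≤ (1 + d)(1 + ‖x + y‖); the power d + 3 of this inequality gives
the constant. -/
lemma refDensity_add_le (x : Space d) {y : Space d} (hy : y ∈ unitCell d) :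
    refDensity (x + y) ≤ refConst d * refDensity x := by
  unfold refDensity refConst
  rw [← inv_inv ((1 + (d : ℝ)) ^ (d + 3)), ← mul_inv]
  refine inv_anti₀ (by positivity) ?_
  rw [inv_mul_le_iff₀ (by positivity), ← mul_pow]
  gcongr
  have h1 : ‖x‖ ≤ ‖x + y‖ + ‖y‖ := by simpa using norm_sub_le (x + y) y
  have h2 := norm_le_of_mem_unitCell hy
  nlinarith [norm_nonneg (x + y), Nat.cast_nonneg (α := ℝ) d]

lemma lintegral_refMeasure (f : Space d → ℝ≥0∞) :
    ∫⁻ x, f x ∂(refMeasure d) = ∫⁻ x, ENNReal.ofReal (refDensity x) * f x :=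
  lintegral_withDensity_eq_lintegral_mul_non_measurable _ measurable_refDensity
    (by simp) f

/-- The density is continuous and positive, so it can be divided out on compact sets. -/
lemma LocallyIntegrable.of_refMeasure {E : Type*} [NormedAddCommGroup E] [NormedSpace ℝ E]
    {f : Space d → E} (hf : Integrable f (refMeasure d)) : LocallyIntegrable f := by
  have h1 : Integrable fun x => refDensity x • f x := by
    rw [refMeasure, integrable_withDensity_iff_integrable_smul₀' measurable_refDensity.aemeasurable
      (by simp)] at hf
    refine hf.congr (ae_of_all _ fun x => ?_)
    simp [(refDensity_pos x).le]
  have h2 : LocallyIntegrable fun x => (refDensity x)⁻¹ • refDensity x • f x := by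
    rw [locallyIntegrable_iff]
    intro K hK
    exact (h1.locallyIntegrable.integrableOn_isCompact hK).continuousOn_smul
      (continuous_refDensity.inv₀ fun x => (refDensity_pos x).ne').continuousOn hK
  refine h2.congr (ae_of_all _ fun x => ?_)
  simp [smul_smul, (refDensity_pos x).ne']

/-- The constant in the comparison of the cell with the reference measure. -/
def refBound (d : ℕ) : ℝ≥0∞ := ENNReal.ofReal (refConst d) * refMeasure d Set.univ

lemma refBound_ne_top : refBound d ≠ ∞ :=
  ENNReal.mul_ne_top ENNReal.ofReal_ne_top (measure_ne_top _ _)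

/-- Averaging over translations t in the cell replaces f(x) by f(x + t) at the cost of the factor
`refConst`. After exchanging the integrals, the inner one is a translated cell integral, independent
of x. Bounds on the cell therefore control a stationary field on the whole space. -/
lemma Periodic.lintegral_refMeasure_le {f : Space d → ℝ≥0∞} (hf : Periodic f)
    (hm : AEMeasurable f) :
    ∫⁻ x, f x ∂(refMeasure d) ≤ refBound d * ∫⁻ x, f x ∂(cellMeasure d) := by
  have hm2 : AEMeasurable (fun p : Space d × Space d => f (p.2 + p.1))
      ((cellMeasure d).prod volume) := by
    refine hm.comp_quasiMeasurePreserving ?_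
    have := (Measure.quasiMeasurePreserving_snd (μ := (volume : Measure (Space d)))
      (ν := (volume : Measure (Space d)))).comp
      (measurePreserving_prod_add volume volume).quasiMeasurePreserving
    refine Measure.QuasiMeasurePreserving.mono_left ?_
      (cellMeasure_absolutelyContinuous.prod Measure.AbsolutelyContinuous.rfl)
    simpa [Function.comp_def, add_comm] using this
  calc ∫⁻ x, f x ∂(refMeasure d)
      = ∫⁻ t, ∫⁻ x, ENNReal.ofReal (refDensity (x + t)) * f (x + t) ∂volume ∂(cellMeasure d) := by
        rw [lintegral_refMeasure]
        simp_rw [lintegral_add_right_eq_self (fun x => ENNReal.ofReal (refDensity x) * f x)]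
        simp
    _ ≤ ∫⁻ t, ∫⁻ x, ENNReal.ofReal (refConst d) * (ENNReal.ofReal (refDensity x) * f (x + t))
          ∂volume ∂(cellMeasure d) := by
        refine lintegral_mono_ae ?_
        filter_upwards [ae_mem_unitCell] with t ht
        refine lintegral_mono fun x => ?_
        rw [← mul_assoc, ← ENNReal.ofReal_mul (by unfold refConst; positivity)]
        gcongr
        exact refDensity_add_le x ht
    _ = ∫⁻ x, ∫⁻ t, ENNReal.ofReal (refConst d) * (ENNReal.ofReal (refDensity x) * f (x + t))
          ∂(cellMeasure d) ∂volume := by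
        refine lintegral_lintegral_swap ?_
        refine AEMeasurable.const_mul (AEMeasurable.mul ?_ hm2) _
        exact (measurable_refDensity.comp measurable_snd).aemeasurable
    _ = ∫⁻ x, ENNReal.ofReal (refConst d) * (ENNReal.ofReal (refDensity x) *
          ∫⁻ t, f t ∂(cellMeasure d)) ∂volume := by
        refine lintegral_congr fun x => ?_
        rw [lintegral_const_mul' _ _ (by simp), lintegral_const_mul' _ _ (by simp)]
        simp_rw [add_comm x]
        rw [hf.lintegral_cell_add hm x]
    _ = refBound d * ∫⁻ x, f x ∂(cellMeasure d) := by
        rw [lintegral_const_mul' _ _ (by simp), lintegral_mul_const _ measurable_refDensity,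
          refBound, refMeasure, withDensity_apply _ MeasurableSet.univ, setLIntegral_univ, mul_assoc]

end ReferenceMeasure

end

/-! ### Square integrable stationary fields -/

section

variable {d : ℕ} {Ω : Type*} [MeasurableSpace Ω] {P : Measure Ω}

section Slices

variable [IsProbabilityMeasure P] {E : Type*}

lemma cell_prod_absolutelyContinuous_ref (P : Measure Ω) [IsProbabilityMeasure P] :
    (refMeasure d).prod P ≪ (volume : Measure (Space d)).prod P :=
  refMeasure_absolutelyContinuous.prod Measure.AbsolutelyContinuous.rfl

lemma absolutelyContinuous_ref_prod (P : Measure Ω) [IsProbabilityMeasure P] :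
    (volume : Measure (Space d)).prod P ≪ (refMeasure d).prod P :=
  absolutelyContinuous_refMeasure.prod Measure.AbsolutelyContinuous.rfl

lemma ae_ae_swap {p : Space d → Ω → Prop} {μ : Measure (Space d)} [SFinite μ]
    (h : ∀ᵐ q : Space d × Ω ∂(μ.prod P), p q.1 q.2) :
    ∀ᵐ ω ∂P, ∀ᵐ x ∂μ, p x ω := by
  have h2 : ∀ᵐ q : Ω × Space d ∂(P.prod μ), p q.2 q.1 :=
    Measure.measurePreserving_swap.quasiMeasurePreserving.ae h
  exact Measure.ae_ae_of_ae_prod h2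

lemma Integrable.ae_locallyIntegrable [NormedAddCommGroup E] [NormedSpace ℝ E] {F : Space d → Ω → E}
    (hF : Integrable (Function.uncurry F) ((refMeasure d).prod P)) :
    ∀ᵐ ω ∂P, LocallyIntegrable fun x => F x ω :=
  hF.prod_left_ae.mono fun _ h => LocallyIntegrable.of_refMeasure h

end Slices

variable [AddAction (Fin d → ℤ) Ω]

/-- A jointly measurable stationary field that is square integrable on `Q × Ω`. -/
structure IsStationaryL2 {E : Type*} [NormedAddCommGroup E] (P : Measure Ω)
    (F : Space d → Ω → E) : Prop where
  measurable : StronglyMeasurable (Function.uncurry F)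
  stationary : Stationary P F
  memLp : MemLp (Function.uncurry F) 2 ((cellMeasure d).prod P)

lemma IsStationaryL2.comp {E E' : Type*} [NormedAddCommGroup E] [NormedAddCommGroup E']
    [NormedSpace ℝ E] [NormedSpace ℝ E'] {F : Space d → Ω → E} (hF : IsStationaryL2 P F)
    (L : E →L[ℝ] E') : IsStationaryL2 P fun x ω => L (F x ω) where
  measurable := L.continuous.comp_stronglyMeasurable hF.measurable
  stationary := hF.stationary.comp L
  memLp := L.comp_memLp' hF.memLp

lemma IsStationaryL2.add {E : Type*} [NormedAddCommGroup E] {F G : Space d → Ω → E}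
    (hF : IsStationaryL2 P F) (hG : IsStationaryL2 P G) :
    IsStationaryL2 P fun x ω => F x ω + G x ω where
  measurable := hF.measurable.add hG.measurable
  stationary := hF.stationary.comp₂ hG.stationary (· + ·)
  memLp := hF.memLp.add hG.memLp

lemma IsStationaryL2.const_smul {E : Type*} [NormedAddCommGroup E] [NormedSpace ℝ E]
    {F : Space d → Ω → E} (hF : IsStationaryL2 P F) (c : ℝ) :
    IsStationaryL2 P fun x ω => c • F x ω where
  measurable := hF.measurable.const_smul c
  stationary := hF.stationary.comp (c • ·)
  memLp := hF.memLp.const_smul c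

variable [IsProbabilityMeasure P]

lemma isStationaryL2_const {E : Type*} [NormedAddCommGroup E] (c : E) :
    IsStationaryL2 P fun (_ : Space d) (_ : Ω) => c where
  measurable := stronglyMeasurable_const
  stationary := stationary_const c
  memLp := memLp_const c

lemma IsStationaryL2.sum {E ι : Type*} [NormedAddCommGroup E] (s : Finset ι)
    {F : ι → Space d → Ω → E} (hF : ∀ i ∈ s, IsStationaryL2 P (F i)) :
    IsStationaryL2 P fun x ω => ∑ i ∈ s, F i x ω := by
  classical
  induction s using Finset.induction_on with
  | empty => simpa using isStationaryL2_const (0 : E)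
  | insert i s hi ih =>
    simp_rw [Finset.sum_insert hi]
    exact (hF i (by simp)).add (ih fun j hj => hF j (by simp [hj]))

variable [MeasurableConstVAdd (Fin d → ℤ) Ω] [VAddInvariantMeasure (Fin d → ℤ) Ω P]

lemma Stationary.lintegral_ref_le {F : Space d → Ω → ℝ≥0∞} (hF : Stationary P F)
    (hm : AEMeasurable (Function.uncurry F) ((volume : Measure (Space d)).prod P)) :
    ∫⁻ p : Space d × Ω, F p.1 p.2 ∂((refMeasure d).prod P) ≤
      refBound d * ∫⁻ p : Space d × Ω, F p.1 p.2 ∂((cellMeasure d).prod P) := by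
  rw [lintegral_prod (fun p : Space d × Ω => F p.1 p.2)
      (hm.mono_ac (cell_prod_absolutelyContinuous_ref P)),
    lintegral_prod (fun p : Space d × Ω => F p.1 p.2)
      (hm.mono_ac (cell_prod_absolutelyContinuous P))]
  exact hF.periodic_lintegral.lintegral_refMeasure_le hm.lintegral_prod_right'

lemma Stationary.eLpNorm_ref_le {E : Type*} [NormedAddCommGroup E] {F : Space d → Ω → E}
    (hF : Stationary P F)
    (hm : AEStronglyMeasurable (Function.uncurry F) ((volume : Measure (Space d)).prod P)) :
    eLpNorm (Function.uncurry F) 2 ((refMeasure d).prod P) ≤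
      refBound d ^ (1 / 2 : ℝ) * eLpNorm (Function.uncurry F) 2 ((cellMeasure d).prod P) := by
  simp only [eLpNorm_eq_lintegral_rpow_enorm_toReal two_ne_zero ENNReal.ofNat_ne_top,
    ENNReal.toReal_ofNat]
  rw [← ENNReal.mul_rpow_of_nonneg _ _ (by norm_num)]
  refine ENNReal.rpow_le_rpow ?_ (by norm_num)
  exact (hF.comp fun y => ‖y‖ₑ ^ (2 : ℝ)).lintegral_ref_le (hm.enorm.pow_const _)

lemma Stationary.memLp_ref {E : Type*} [NormedAddCommGroup E] {F : Space d → Ω → E}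
    (hF : Stationary P F)
    (hm : AEStronglyMeasurable (Function.uncurry F) ((volume : Measure (Space d)).prod P))
    (h2 : MemLp (Function.uncurry F) 2 ((cellMeasure d).prod P)) :
    MemLp (Function.uncurry F) 2 ((refMeasure d).prod P) :=
  ⟨hm.mono_ac (cell_prod_absolutelyContinuous_ref P), (hF.eLpNorm_ref_le hm).trans_lt
    (ENNReal.mul_lt_top (ENNReal.rpow_lt_top_of_nonneg (by norm_num) refBound_ne_top) h2.2)⟩

/-- A stationary relation that holds on the cell holds everywhere. -/
lemma Stationary.ae_of_ae_cell {p : Space d → Ω → Prop} (hp : Stationary P p)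
    (hm : NullMeasurableSet {q : Space d × Ω | p q.1 q.2} ((volume : Measure (Space d)).prod P))
    (h : ∀ᵐ q : Space d × Ω ∂((cellMeasure d).prod P), p q.1 q.2) :
    ∀ᵐ q : Space d × Ω ∂((volume : Measure (Space d)).prod P), p q.1 q.2 := by
  classical
  have hm' : AEMeasurable (Function.uncurry fun x ω => if p x ω then (0 : ℝ≥0∞) else 1)
      ((volume : Measure (Space d)).prod P) := by
    have : (Function.uncurry fun x ω => if p x ω then (0 : ℝ≥0∞) else 1) =
        {q : Space d × Ω | p q.1 q.2}ᶜ.indicator 1 := by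
      ext q
      by_cases hq : p q.1 q.2 <;> simp [Function.uncurry, hq]
    rw [this]
    exact aemeasurable_const.indicator₀ hm.compl
  -- The indicator of the failure set is stationary; its integral for the reference measure is
  -- bounded by its integral over the cell, which vanishes.
  have h1 := (hp.comp fun a : Prop => if a then (0 : ℝ≥0∞) else 1).lintegral_ref_le hm'
  rw [lintegral_congr_ae (g := 0) (μ := (cellMeasure d).prod P) (by
    filter_upwards [h] with q hq
    simp [hq])] at h1
  simp only [Pi.zero_apply, lintegral_zero, mul_zero, nonpos_iff_eq_zero] at h1
  erw [lintegral_eq_zero_iff' (hm'.mono_ac (cell_prod_absolutelyContinuous_ref P))] at h1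
  filter_upwards [(absolutelyContinuous_ref_prod P).ae_le h1] with q hq
  by_contra hc
  change (if p q.1 q.2 then (0 : ℝ≥0∞) else 1) = 0 at hq
  rw [if_neg hc] at hq
  exact one_ne_zero hq

lemma Stationary.ae_eq_of_ae_eq_cell {E : Type*} [TopologicalSpace E]
    [TopologicalSpace.MetrizableSpace E] {F G : Space d → Ω → E}
    (hF : Stationary P F) (hG : Stationary P G)
    (hFm : AEStronglyMeasurable (Function.uncurry F) ((volume : Measure (Space d)).prod P))
    (hGm : AEStronglyMeasurable (Function.uncurry G) ((volume : Measure (Space d)).prod P))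
    (h : Function.uncurry F =ᵐ[(cellMeasure d).prod P] Function.uncurry G) :
    Function.uncurry F =ᵐ[(volume : Measure (Space d)).prod P] Function.uncurry G :=
  (hF.comp₂ hG (· = ·)).ae_of_ae_cell (hFm.nullMeasurableSet_eq_fun hGm) h

/-- The extension takes the value f(x - k, τ_k ω) on the cell with index k. It is stationary because
the cell index is additive under lattice shifts and the action is a group action. Joint
measurability holds because the group is countable. -/
lemma exists_stationary_extension
    {E : Type*} [TopologicalSpace E] [TopologicalSpace.PseudoMetrizableSpace E]
    {f : Space d × Ω → E} (hf : AEStronglyMeasurable f ((cellMeasure d).prod P)) :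
    ∃ F : Space d → Ω → E, StronglyMeasurable (Function.uncurry F) ∧ Stationary P F ∧
      Function.uncurry F =ᵐ[(cellMeasure d).prod P] f := by
  have hact : Measurable fun q : (Fin d → ℤ) × Ω => (q.1 +ᵥ q.2 : Ω) :=
    measurable_from_prod_countable_right fun k => measurable_const_vadd k
  have hlat : Measurable (latticePoint : (Fin d → ℤ) → Space d) := measurable_of_countable _
  have hΘ : Measurable fun p : Space d × Ω =>
      ((p.1 - latticePoint (cellIndex p.1), cellIndex p.1 +ᵥ p.2) : Space d × Ω) :=
    (measurable_fst.sub (hlat.comp (measurable_cellIndex.comp measurable_fst))).prodMk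
      (hact.comp ((measurable_cellIndex.comp measurable_fst).prodMk measurable_snd))
  refine ⟨fun x ω => hf.mk f (x - latticePoint (cellIndex x), cellIndex x +ᵥ ω),
    hf.stronglyMeasurable_mk.comp_measurable hΘ, fun k => ae_of_all _ fun p => ?_, ?_⟩
  · simp only [cellIndex_add_latticePoint, latticePoint_add, add_vadd, add_sub_add_right_eq_sub]
  · have h0 : ∀ᵐ p : Space d × Ω ∂((cellMeasure d).prod P), cellIndex p.1 = 0 := by
      refine (Measure.quasiMeasurePreserving_fst (μ := cellMeasure d) (ν := P)).ae
        (p := fun x => cellIndex x = 0) ?_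
      rw [cellMeasure_eq]
      exact ae_restrict_mem measurableSet_halfOpenCell
    filter_upwards [h0, hf.ae_eq_mk] with p hp hq
    simp only [Function.uncurry, hp, latticePoint_zero, sub_zero, zero_vadd]
    exact hq.symm

lemma exists_isStationaryL2 {E : Type*} [NormedAddCommGroup E] {F : Space d → Ω → E}
    (hm : AEStronglyMeasurable (Function.uncurry F) ((volume : Measure (Space d)).prod P))
    (hs : Stationary P F) (h2 : MemLp (Function.uncurry F) 2 ((cellMeasure d).prod P)) :
    ∃ G : Space d → Ω → E, IsStationaryL2 P G ∧
      Function.uncurry F =ᵐ[(volume : Measure (Space d)).prod P] Function.uncurry G := by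
  refine ⟨fun x ω => hm.mk _ (x, ω), ⟨hm.stronglyMeasurable_mk, hs.congr hm.ae_eq_mk, ?_⟩,
    hm.ae_eq_mk⟩
  exact h2.ae_eq ((cell_prod_absolutelyContinuous P).ae_le hm.ae_eq_mk)

/-- Every square integrable function on `Q × Ω` is the restriction of a stationary field. -/
lemma exists_isStationaryL2_of_memLp {E : Type*} [NormedAddCommGroup E] {f : Space d × Ω → E}
    (hf : MemLp f 2 ((cellMeasure d).prod P)) :
    ∃ F : Space d → Ω → E, IsStationaryL2 P F ∧
      Function.uncurry F =ᵐ[(cellMeasure d).prod P] f := by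
  obtain ⟨F, h1, h2, h3⟩ := exists_stationary_extension hf.1
  exact ⟨F, ⟨h1, h2, hf.ae_eq h3.symm⟩, h3⟩

lemma IsStationaryL2.memLp_ref {E : Type*} [NormedAddCommGroup E] {F : Space d → Ω → E}
    (hF : IsStationaryL2 P F) : MemLp (Function.uncurry F) 2 ((refMeasure d).prod P) :=
  hF.stationary.memLp_ref hF.measurable.aestronglyMeasurable hF.memLp

lemma IsStationaryL2.ae_locallyIntegrable {E : Type*} [NormedAddCommGroup E] [NormedSpace ℝ E]
    {F : Space d → Ω → E} (hF : IsStationaryL2 P F) :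
    ∀ᵐ ω ∂P, LocallyIntegrable fun x => F x ω :=
  Integrable.ae_locallyIntegrable (hF.memLp_ref.integrable one_le_two)

lemma IsStationaryL2.memLp_shift {E : Type*} [NormedAddCommGroup E] [MeasurableSpace E]
    [BorelSpace E] [SecondCountableTopology E] {F : Space d → Ω → E}
    (hF : IsStationaryL2 P F) (z : Space d) :
    MemLp (fun p : Space d × Ω => F (p.1 + z) p.2) 2 ((cellMeasure d).prod P) :=
  (hF.stationary.identDistrib_shift hF.measurable.measurable.aemeasurable z).symm.memLp_snd hF.memLp

end

/-! ### Cauchy–Schwarz inequalities for Lebesgue integrals -/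

section

section CauchySchwarz

variable {α : Type*} [MeasurableSpace α] {μ : Measure α}

lemma eLpNorm_two_sq {E : Type*} [NormedAddCommGroup E] (f : α → E) (μ : Measure α) :
    eLpNorm f 2 μ ^ 2 = ∫⁻ x, ‖f x‖ₑ ^ 2 ∂μ := by
  rw [eLpNorm_eq_lintegral_rpow_enorm_toReal two_ne_zero ENNReal.ofNat_ne_top,
    ENNReal.toReal_ofNat, ← ENNReal.rpow_two, ← ENNReal.rpow_mul]
  norm_num

lemma memLp_two_iff {E : Type*} [NormedAddCommGroup E] {f : α → E}
    (hf : AEStronglyMeasurable f μ) : MemLp f 2 μ ↔ ∫⁻ x, ‖f x‖ₑ ^ 2 ∂μ < ∞ := by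
  rw [← eLpNorm_two_sq, ENNReal.pow_lt_top_iff]
  simp [MemLp, hf]

lemma lintegral_mul_sq_le {f g : α → ℝ≥0∞} (hf : AEMeasurable f μ) (hg : AEMeasurable g μ) :
    (∫⁻ x, f x * g x ∂μ) ^ 2 ≤ (∫⁻ x, f x ^ 2 ∂μ) * ∫⁻ x, g x ^ 2 ∂μ := by
  have h := ENNReal.lintegral_mul_le_Lp_mul_Lq μ Real.HolderConjugate.two_two hf hg
  calc (∫⁻ x, f x * g x ∂μ) ^ 2
      ≤ ((∫⁻ a, f a ^ (2 : ℝ) ∂μ) ^ (1 / (2 : ℝ)) * (∫⁻ a, g a ^ (2 : ℝ) ∂μ) ^ (1 / (2 : ℝ))) ^ 2 :=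
        pow_le_pow_left₀ zero_le h 2
    _ = _ := by
        rw [mul_pow, ← ENNReal.rpow_two, ← ENNReal.rpow_two, ← ENNReal.rpow_mul,
          ← ENNReal.rpow_mul]
        norm_num

lemma lintegral_sq_le {f : α → ℝ≥0∞} (hf : AEMeasurable f μ) :
    (∫⁻ x, f x ∂μ) ^ 2 ≤ μ Set.univ * ∫⁻ x, f x ^ 2 ∂μ := by
  have h := lintegral_mul_sq_le (aemeasurable_const (b := (1 : ℝ≥0∞))) hf
  simpa using h

/-- Cauchy–Schwarz for the pair f, 1 with respect to the measure of density k. -/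
lemma lintegral_mul_sq_le_weighted {f k : α → ℝ≥0∞} (hf : Measurable f) (hk : Measurable k) :
    (∫⁻ x, f x * k x ∂μ) ^ 2 ≤ (∫⁻ x, k x ∂μ) * ∫⁻ x, f x ^ 2 * k x ∂μ := by
  have h := lintegral_sq_le (μ := μ.withDensity k) hf.aemeasurable
  rw [lintegral_withDensity_eq_lintegral_mul _ hk hf, withDensity_apply _ MeasurableSet.univ,
    setLIntegral_univ, lintegral_withDensity_eq_lintegral_mul _ hk (hf.pow_const 2)] at h
  simpa [mul_comm] using h

end CauchySchwarz

/-! ### Test functions -/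

section TestFunctions

variable {d : ℕ}

/-- Smooth compactly supported functions. -/
structure IsTest (η : Space d → ℝ) : Prop where
  smooth : ContDiff ℝ (⊤ : ℕ∞) η
  compact : HasCompactSupport η

/-- The `j`-th partial derivative. -/
def partialDeriv (j : Fin d) (η : Space d → ℝ) : Space d → ℝ := fun x => fderiv ℝ η x (basisVec j)

variable {η : Space d → ℝ}

lemma IsTest.continuous (h : IsTest η) : Continuous η := h.smooth.continuous

lemma IsTest.differentiable (h : IsTest η) : Differentiable ℝ η :=
  h.smooth.differentiable (by simp)

lemma IsTest.fderiv_apply (h : IsTest η) (v : Space d) : IsTest fun x => fderiv ℝ η x v where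
  smooth := (h.smooth.fderiv_right (m := (⊤ : ℕ∞)) (by simp)).clm_apply contDiff_const
  compact := h.compact.fderiv_apply (𝕜 := ℝ) v

lemma IsTest.partialDeriv (h : IsTest η) (j : Fin d) : IsTest (partialDeriv j η) :=
  h.fderiv_apply _

lemma IsTest.comp_sub_left (h : IsTest η) (x : Space d) : IsTest fun t => η (x - t) where
  smooth := h.smooth.comp (by fun_prop)
  compact := h.compact.comp_homeomorph (Homeomorph.subLeft x)

lemma IsTest.reflect (h : IsTest η) : IsTest fun t => η (-t) := by
  simpa using h.comp_sub_left 0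

lemma IsTest.integrable (h : IsTest η) : Integrable η :=
  h.continuous.integrable_of_hasCompactSupport h.compact

lemma fderiv_comp_sub_left (h : IsTest η) (x t v : Space d) :
    fderiv ℝ (fun t => η (x - t)) t v = -fderiv ℝ η (x - t) v := by
  have h1 : HasFDerivAt (fun t => η (x - t)) ((fderiv ℝ η (x - t)).comp (-ContinuousLinearMap.id ℝ _)) t :=
    (h.differentiable (x - t)).hasFDerivAt.comp t ((hasFDerivAt_id t).const_sub x)
  rw [h1.fderiv]
  simp

lemma partialDeriv_comp_sub_left (h : IsTest η) (j : Fin d) (x t : Space d) :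
    partialDeriv j (fun t => η (x - t)) t = -partialDeriv j η (x - t) :=
  fderiv_comp_sub_left h x t _

lemma partialDeriv_reflect (h : IsTest η) (j : Fin d) (t : Space d) :
    partialDeriv j (fun t => η (-t)) t = -partialDeriv j η (-t) := by
  simpa using partialDeriv_comp_sub_left h j 0 t

lemma partialDeriv_comm (h : IsTest η) (i j : Fin d) :
    partialDeriv i (partialDeriv j η) = partialDeriv j (partialDeriv i η) := by
  have key : ∀ v w : Space d, ∀ x, fderiv ℝ (fun y => fderiv ℝ η y v) x w =
      fderiv ℝ (fderiv ℝ η) x w v := by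
    intro v w x
    have h2 : DifferentiableAt ℝ (fderiv ℝ η) x :=
      (h.smooth.fderiv_right (m := (⊤ : ℕ∞)) (by simp)).differentiable (by simp) x
    rw [fderiv_clm_apply h2 (differentiableAt_const v)]
    simp
  ext x
  have hs : IsSymmSndFDerivAt ℝ η x :=
    h.smooth.contDiffAt.isSymmSndFDerivAt (by simpa using WithTop.coe_le_coe.2 (le_top (a := (2 : ℕ∞))))
  change fderiv ℝ (fun y => fderiv ℝ η y _) x _ = fderiv ℝ (fun y => fderiv ℝ η y _) x _
  rw [key, key]
  exact hs.eq _ _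

/-- The convolution of η with the constant 1 is the constant ∫ η. Its derivative is zero, and it is
also the convolution of 1 with the derivative of η. -/
lemma IsTest.integral_partialDeriv (h : IsTest η) (j : Fin d) :
    ∫ x, RandomHom.partialDeriv j η x = 0 := by
  have h1 := h.compact.hasFDerivAt_convolution_right (ContinuousLinearMap.mul ℝ ℝ)
    (μ := volume) (locallyIntegrable_const (1 : ℝ)) (h.smooth.of_le (by simp)) 0
  have h2 : convolution (fun _ => (1 : ℝ)) η (ContinuousLinearMap.mul ℝ ℝ) volume =
      fun _ => ∫ t, η t := by
    ext x
    simp [convolution_def, integral_sub_left_eq_self]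
  rw [h2] at h1
  have h3 := congrArg (fun L => L (basisVec j)) (h1.unique (hasFDerivAt_const _ _))
  simp only [zero_apply] at h3
  rw [convolution_precompR_apply _ (locallyIntegrable_const (1 : ℝ)) (h.compact.fderiv ℝ)
    (h.smooth.continuous_fderiv (by simp))] at h3
  simp only [convolution_def, ContinuousLinearMap.mul_apply', one_mul] at h3
  rwa [integral_sub_left_eq_self (fun t => fderiv ℝ η t (basisVec j))] at h3

lemma HasWeakGradient.integral_partialDeriv {u : Space d → ℝ} {g : Space d → Space d}
    (h : HasWeakGradient u g) (hη : IsTest η) (x : Space d) (i : Fin d) :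
    ∫ t, u t * partialDeriv i η (x - t) = ∫ t, g t i * η (x - t) := by
  have h1 := h.integral_eq _ (hη.comp_sub_left x).smooth (hη.comp_sub_left x).compact i
  simp only [fderiv_comp_sub_left hη, mul_neg, integral_neg, neg_inj] at h1
  exact h1

end TestFunctions

/-! ### Convolution in space and mass transport -/

section Smear

variable {d : ℕ} {Ω : Type*} [MeasurableSpace Ω] {P : Measure Ω}

/-- The convolution in space of a random field with a kernel. -/
def smear (F : Space d → Ω → ℝ) (η : Space d → ℝ) : Space d → Ω → ℝ :=
  fun x ω => ∫ t, F t ω * η (x - t)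

lemma smear_eq (F : Space d → Ω → ℝ) (η : Space d → ℝ) (x : Space d) (ω : Ω) :
    smear F η x ω = ∫ y, F (x - y) ω * η y := by
  rw [smear, ← integral_sub_left_eq_self _ volume x]
  simp

lemma stronglyMeasurable_smear {F : Space d → Ω → ℝ} {η : Space d → ℝ}
    (hF : StronglyMeasurable (Function.uncurry F)) (hη : Continuous η) :
    StronglyMeasurable (Function.uncurry (smear F η)) := by
  have h : StronglyMeasurable fun q : (Space d × Ω) × Space d => F q.2 q.1.2 * η (q.1.1 - q.2) :=
    (hF.comp_measurable (measurable_snd.prodMk (measurable_snd.comp measurable_fst))).mul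
      (hη.stronglyMeasurable.comp_measurable
        ((measurable_fst.comp measurable_fst).sub measurable_snd))
  exact h.integral_prod_right' (ν := (volume : Measure (Space d)))

lemma contDiff_smear {F : Space d → Ω → ℝ} {η : Space d → ℝ} {ω : Ω}
    (hF : LocallyIntegrable fun x => F x ω) (hη : IsTest η) :
    ContDiff ℝ (⊤ : ℕ∞) fun x => smear F η x ω :=
  hη.compact.contDiff_convolution_right (ContinuousLinearMap.mul ℝ ℝ) hF hη.smooth

lemma fderiv_smear {F : Space d → Ω → ℝ} {η : Space d → ℝ} {ω : Ω}
    (hF : LocallyIntegrable fun x => F x ω) (hη : IsTest η) (x v : Space d) :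
    fderiv ℝ (fun x => smear F η x ω) x v = smear F (fun y => fderiv ℝ η y v) x ω := by
  have h1 := hη.compact.hasFDerivAt_convolution_right (ContinuousLinearMap.mul ℝ ℝ)
    (μ := volume) hF (hη.smooth.of_le (by simp)) x
  have h2 := h1.fderiv
  change fderiv ℝ (fun x => smear F η x ω) x = _ at h2
  rw [h2, convolution_precompR_apply _ hF (hη.compact.fderiv ℝ)
    (hη.smooth.continuous_fderiv (by simp))]
  rfl

variable [AddAction (Fin d → ℤ) Ω] [IsProbabilityMeasure P]

lemma Stationary.smear {F : Space d → Ω → ℝ} (hF : Stationary P F) (η : Space d → ℝ) :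
    Stationary P (smear F η) := fun k => by
  have h := ae_ae_swap (p := fun x ω => F (x + latticePoint k) ω = F x (k +ᵥ ω)) (hF k)
  -- The exceptional set of ω is independent of x: the stationarity relation is used for almost all
  -- t under the integral, which serves every x at once.
  have h2 : ∀ᵐ ω ∂P, ∀ x, RandomHom.smear F η (x + latticePoint k) ω =
      RandomHom.smear F η x (k +ᵥ ω) := by
    filter_upwards [h] with ω hω x
    rw [RandomHom.smear, RandomHom.smear, ← integral_add_right_eq_self _ (latticePoint k)]
    refine integral_congr_ae ?_
    filter_upwards [hω] with t ht
    rw [ht, add_sub_add_right_eq_sub]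
  filter_upwards [Measure.quasiMeasurePreserving_snd.ae h2] with p hp
  exact hp p.1

variable [MeasurableConstVAdd (Fin d → ℤ) Ω] [VAddInvariantMeasure (Fin d → ℤ) Ω P]

/-- Square integrability is Young's inequality in disguise: weighted Cauchy–Schwarz bounds the
square of the convolution by an average of squared translates, and all translates of a stationary
field have the same norm on the cell. -/
lemma IsStationaryL2.smear {F : Space d → Ω → ℝ} (hF : IsStationaryL2 P F) {η : Space d → ℝ}
    (hη : IsTest η) : IsStationaryL2 P (smear F η) where
  measurable := stronglyMeasurable_smear hF.measurable hη.continuous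
  stationary := hF.stationary.smear η
  memLp := by
    have hm := stronglyMeasurable_smear hF.measurable hη.continuous
    have hηm : Measurable fun y => ‖η y‖ₑ := hη.continuous.measurable.enorm
    have hFm : Measurable fun q : (Space d × Ω) × Space d => ‖F (q.1.1 - q.2) q.1.2‖ₑ :=
      (hF.measurable.measurable.comp (((measurable_fst.comp measurable_fst).sub
        measurable_snd).prodMk (measurable_snd.comp measurable_fst))).enorm
    have hη1 : ∫⁻ y, ‖η y‖ₑ < ∞ := hη.integrable.2
    have hF2 := (memLp_two_iff hF.measurable.aestronglyMeasurable).1 hF.memLp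
    rw [memLp_two_iff hm.aestronglyMeasurable]
    calc ∫⁻ p, ‖Function.uncurry (RandomHom.smear F η) p‖ₑ ^ 2 ∂((cellMeasure d).prod P)
        ≤ ∫⁻ p : Space d × Ω, ((∫⁻ y, ‖η y‖ₑ) * ∫⁻ y, ‖F (p.1 - y) p.2‖ₑ ^ 2 * ‖η y‖ₑ)
            ∂((cellMeasure d).prod P) := by
          refine lintegral_mono fun p => ?_
          refine le_trans (pow_le_pow_left₀ zero_le ?_ 2)
            (lintegral_mul_sq_le_weighted (hFm.comp measurable_prodMk_left) hηm)
          rw [Function.uncurry, smear_eq]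
          refine (enorm_integral_le_lintegral_enorm _).trans (le_of_eq ?_)
          simp [enorm_mul]
      _ = (∫⁻ y, ‖η y‖ₑ) * ∫⁻ y, (∫⁻ p : Space d × Ω, ‖F (p.1 - y) p.2‖ₑ ^ 2 * ‖η y‖ₑ
            ∂((cellMeasure d).prod P)) := by
          rw [lintegral_const_mul' _ _ hη1.ne, lintegral_lintegral_swap]
          exact ((hFm.pow_const 2).mul (hηm.comp measurable_snd)).aemeasurable
      _ = (∫⁻ y, ‖η y‖ₑ) * ∫⁻ y, (∫⁻ p : Space d × Ω, ‖F p.1 p.2‖ₑ ^ 2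
            ∂((cellMeasure d).prod P)) * ‖η y‖ₑ := by
          congr 1
          refine lintegral_congr fun y => ?_
          rw [lintegral_mul_const' _ _ (by simp)]
          congr 1
          simp only [sub_eq_add_neg]
          exact (hF.stationary.comp fun a => ‖a‖ₑ ^ 2).lintegral_shift
            ((hF.measurable.measurable.enorm.pow_const 2).aemeasurable) (-y)
      _ < ∞ := by
          change _ * ∫⁻ y, (∫⁻ p, ‖Function.uncurry F p‖ₑ ^ 2 ∂((cellMeasure d).prod P)) * ‖η y‖ₑ < ∞
          rw [lintegral_const_mul' _ _ hF2.ne]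
          exact ENNReal.mul_lt_top hη1 (ENNReal.mul_lt_top hF2 hη1)

/-- Mass transport: for a jointly stationary kernel, the mass sent from the cell equals the mass
received by the cell. -/
lemma integral_transport {Ψ : Space d → Space d → Ω → ℝ}
    (hm : Measurable fun q : Space d × Space d × Ω => Ψ q.1 q.2.1 q.2.2)
    (hs : ∀ y, Stationary P fun x ω => Ψ x (x + y) ω)
    (hi : Integrable (fun q : Space d × Space d × Ω => Ψ q.2.1 (q.2.1 + q.1) q.2.2)
      ((volume : Measure (Space d)).prod ((cellMeasure d).prod P))) :
    ∫ p : Space d × Ω, (∫ t, Ψ p.1 t p.2) ∂((cellMeasure d).prod P) =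
      ∫ p : Space d × Ω, (∫ x, Ψ x p.1 p.2) ∂((cellMeasure d).prod P) := by
  -- For a fixed displacement y the mass sent from x to x + y is a stationary function of x, so
  -- shifting by -y preserves its law and turns mass sent into mass received.
  have hid : ∀ y, ProbabilityTheory.IdentDistrib
      (fun p : Space d × Ω => Ψ (p.1 - y) p.1 p.2) (fun p : Space d × Ω => Ψ p.1 (p.1 + y) p.2)
      ((cellMeasure d).prod P) ((cellMeasure d).prod P) := by
    intro y
    have hmy : Measurable (Function.uncurry fun x ω => Ψ x (x + y) ω) :=
      hm.comp (measurable_fst.prodMk ((measurable_fst.add_const y).prodMk measurable_snd))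
    convert (hs y).identDistrib_shift hmy.aemeasurable (-y) using 3 with p
    · rw [sub_eq_add_neg]
    · abel
  have hm' : Measurable fun q : Space d × Space d × Ω => Ψ (q.2.1 - q.1) q.2.1 q.2.2 :=
    hm.comp (((measurable_fst.comp measurable_snd).sub measurable_fst).prodMk measurable_snd)
  have hi' : Integrable (fun q : Space d × Space d × Ω => Ψ (q.2.1 - q.1) q.2.1 q.2.2)
      ((volume : Measure (Space d)).prod ((cellMeasure d).prod P)) := by
    rw [integrable_prod_iff hm'.aestronglyMeasurable]
    rw [integrable_prod_iff hi.1] at hi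
    refine ⟨?_, ?_⟩
    · filter_upwards [hi.1] with y hy
      exact (hid y).symm.integrable_snd hy
    · refine hi.2.congr (ae_of_all _ fun y => ?_)
      exact ((hid y).norm.integral_eq).symm
  calc ∫ p : Space d × Ω, (∫ t, Ψ p.1 t p.2) ∂((cellMeasure d).prod P)
      = ∫ p : Space d × Ω, (∫ y, Ψ p.1 (p.1 + y) p.2) ∂((cellMeasure d).prod P) := by
        refine integral_congr_ae (ae_of_all _ fun p => ?_)
        exact (integral_add_left_eq_self (fun t => Ψ p.1 t p.2) p.1).symm
    _ = ∫ y, (∫ p : Space d × Ω, Ψ p.1 (p.1 + y) p.2 ∂((cellMeasure d).prod P)) :=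
        (integral_integral_swap hi).symm
    _ = ∫ y, (∫ p : Space d × Ω, Ψ (p.1 - y) p.1 p.2 ∂((cellMeasure d).prod P)) :=
        integral_congr_ae (ae_of_all _ fun y => (hid y).integral_eq.symm)
    _ = ∫ p : Space d × Ω, (∫ y, Ψ (p.1 - y) p.1 p.2) ∂((cellMeasure d).prod P) :=
        integral_integral_swap hi'
    _ = _ := by
        refine integral_congr_ae (ae_of_all _ fun p => ?_)
        exact integral_sub_left_eq_self (fun x => Ψ x p.1 p.2) volume p.1

/-- Mass transport with F(t) η(x - t): the point t contributes F(t) times the total mass of η.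
Applied to periodic functions, this shows that periodic gradients have zero mean. -/
lemma integral_smear {F : Space d → Ω → ℝ} (hm : Measurable (Function.uncurry F))
    (hs : Stationary P F) (hi : Integrable (Function.uncurry F) ((cellMeasure d).prod P))
    {η : Space d → ℝ} (hη : IsTest η) :
    ∫ p : Space d × Ω, smear F η p.1 p.2 ∂((cellMeasure d).prod P) =
      (∫ p : Space d × Ω, F p.1 p.2 ∂((cellMeasure d).prod P)) * ∫ x, η x := by
  have hid := fun y => hs.identDistrib_shift hm.aemeasurable y
  rw [← integral_mul_const]
  have hmm : Measurable fun q : Space d × Space d × Ω => F (q.2.1 + q.1) q.2.2 * η (-q.1) := by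
    refine (hm.comp (((measurable_fst.comp measurable_snd).add measurable_fst).prodMk
      (measurable_snd.comp measurable_snd))).mul ?_
    exact hη.continuous.measurable.comp measurable_fst.neg
  rw [show (fun p : Space d × Ω => smear F η p.1 p.2) =
    fun p => ∫ t, F t p.2 * η (p.1 - t) from rfl,
    integral_transport (Ψ := fun x t ω => F t ω * η (x - t))]
  · refine integral_congr_ae (ae_of_all _ fun p => ?_)
    simp only
    rw [integral_const_mul, integral_sub_right_eq_self η p.1]
  · refine (hm.comp measurable_snd).mul (hη.continuous.measurable.comp ?_)
    exact measurable_fst.sub (measurable_fst.comp measurable_snd)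
  · intro y
    simpa using (hs.shift y).comp (· * η (-y))
  · simp only [sub_add_cancel_left]
    rw [integrable_prod_iff hmm.aestronglyMeasurable]
    refine ⟨ae_of_all _ fun y => ((hid y).symm.integrable_snd hi).mul_const (η (-y)), ?_⟩
    refine (hη.reflect.integrable.norm.const_mul
      (∫ p : Space d × Ω, ‖F p.1 p.2‖ ∂((cellMeasure d).prod P))).congr (ae_of_all _ fun y => ?_)
    simp only [norm_mul]
    rw [integral_mul_const]
    congr 1
    exact (hid y).norm.integral_eq.symm

/-- Both sides are the total mass of the transport a(x) b(t) k(t - x), counted by origin and by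
destination. -/
lemma integral_mul_smear {a b : Space d → Ω → ℝ} (ha : IsStationaryL2 P a)
    (hb : IsStationaryL2 P b) {k : Space d → ℝ} (hk : IsTest k) :
    ∫ p : Space d × Ω, a p.1 p.2 * smear b (fun x => k (-x)) p.1 p.2 ∂((cellMeasure d).prod P) =
      ∫ p : Space d × Ω, smear a k p.1 p.2 * b p.1 p.2 ∂((cellMeasure d).prod P) := by
  have ham := ha.measurable.measurable
  have hbm := hb.measurable.measurable
  have hmm : Measurable fun q : Space d × Space d × Ω =>
      a q.2.1 q.2.2 * b (q.2.1 + q.1) q.2.2 * k q.1 :=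
    ((ham.comp measurable_snd).mul (hbm.comp (((measurable_fst.comp measurable_snd).add
      measurable_fst).prodMk (measurable_snd.comp measurable_snd)))).mul
      (hk.continuous.measurable.comp measurable_fst)
  have hab : ∀ y, Integrable (fun p : Space d × Ω => a p.1 p.2 * b (p.1 + y) p.2)
      ((cellMeasure d).prod P) := fun y => ha.memLp.integrable_mul (hb.memLp_shift y)
  have h1 := integral_transport (P := P) (Ψ := fun x t ω => a x ω * b t ω * k (t - x)) ?_ ?_ ?_
  · convert h1 using 1
    · refine integral_congr_ae (ae_of_all _ fun p => ?_)
      simp only [smear, neg_sub, mul_assoc]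
      rw [integral_const_mul]
    · refine integral_congr_ae (ae_of_all _ fun p => ?_)
      simp only [smear]
      rw [← integral_mul_const]
      refine integral_congr_ae (ae_of_all _ fun x => ?_)
      simp only
      ring
  · refine ((ham.comp (measurable_fst.prodMk (measurable_snd.comp measurable_snd))).mul
      (hbm.comp measurable_snd)).mul (hk.continuous.measurable.comp ?_)
    exact (measurable_fst.comp measurable_snd).sub measurable_fst
  · intro y
    simpa using ((ha.stationary).comp₂ (hb.stationary.shift y) (· * ·)).comp (· * k y)
  · simp only [add_sub_cancel_left]
    rw [integrable_prod_iff hmm.aestronglyMeasurable]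
    refine ⟨ae_of_all _ fun y => (hab y).mul_const (k y), ?_⟩
    -- Bound |a b| by a² + b²; by stationarity the integral of the shifted b² does not depend on the
    -- shift y, so |k| alone has to be integrable in y.
    refine Integrable.mono' (hk.integrable.norm.const_mul
      ((∫ p : Space d × Ω, a p.1 p.2 ^ 2 ∂((cellMeasure d).prod P)) +
        ∫ p : Space d × Ω, b p.1 p.2 ^ 2 ∂((cellMeasure d).prod P)))
      (hmm.norm.stronglyMeasurable.integral_prod_right').aestronglyMeasurable
      (ae_of_all _ fun y => ?_)
    simp only [norm_mul]
    rw [integral_mul_const, norm_mul, norm_norm]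
    refine mul_le_mul_of_nonneg_right ?_ (norm_nonneg _)
    rw [Real.norm_of_nonneg (integral_nonneg fun p => by positivity)]
    have h2 := (hb.stationary.identDistrib_shift hbm.aemeasurable y).pow (n := 2)
    have h3 := h2.integral_eq
    have ha2 : Integrable (fun p : Space d × Ω => a p.1 p.2 ^ 2) ((cellMeasure d).prod P) :=
      ha.memLp.integrable_sq
    rw [← h3, ← integral_add ha2 (hb.memLp_shift y).integrable_sq]
    refine integral_mono_of_nonneg (ae_of_all _ fun p => by positivity)
      (ha2.add (hb.memLp_shift y).integrable_sq) (ae_of_all _ fun p => ?_)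
    simp only [← abs_mul, Real.norm_eq_abs]
    rw [abs_le]
    constructor <;> nlinarith [sq_nonneg (a p.1 p.2 + b (p.1 + y) p.2),
      sq_nonneg (a p.1 p.2 - b (p.1 + y) p.2), sq_nonneg (a p.1 p.2), sq_nonneg (b (p.1 + y) p.2)]

end Smear

end

/-! ### Countable families of test functions -/

section

section CountableTests

variable {d : ℕ}

lemma IsTest.fderiv_eq_zero {η : Space d → ℝ} {x : Space d} (hx : x ∉ tsupport η) :
    η x = 0 ∧ fderiv ℝ η x = 0 :=
  ⟨image_eq_zero_of_notMem_tsupport hx,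
    image_eq_zero_of_notMem_tsupport fun h => hx (tsupport_fderiv_subset ℝ h)⟩

/-- Test functions are identified with their first-order jets (η, Dη) among the continuous maps with
the compact-open topology. That space is second countable, so the jets of functions supported in K
have a countable dense subset. Convergence there is uniform on K, which lets the tested integrals
pass to the limit by dominated convergence. -/
lemma exists_countable_tests_of_tsupport_subset {K : Set (Space d)} (hK : IsCompact K) :
    ∃ D : Set (Space d → ℝ), D.Countable ∧ (∀ η ∈ D, IsTest η) ∧
      ∀ (F : Space d → ℝ) (G : Space d → Space d), LocallyIntegrable F → LocallyIntegrable G →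
        (∀ η ∈ D, ∫ x, (F x * η x + fderiv ℝ η x (G x)) = 0) →
        ∀ η, IsTest η → tsupport η ⊆ K → ∫ x, (F x * η x + fderiv ℝ η x (G x)) = 0 := by
  have : SecondCountableTopology (Space d →L[ℝ] ℝ) :=
    haveI := FiniteDimensional.proper ℝ (Space d →L[ℝ] ℝ); inferInstance
  set s : Set C(Space d, ℝ × (Space d →L[ℝ] ℝ)) :=
    {c | ∃ η, IsTest η ∧ tsupport η ⊆ K ∧ ∀ x, c x = (η x, fderiv ℝ η x)} with hs
  obtain ⟨t, htc, htd⟩ := TopologicalSpace.exists_countable_dense s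
  refine ⟨(fun c : C(Space d, ℝ × (Space d →L[ℝ] ℝ)) => fun x => (c x).1) '' (Subtype.val '' t),
    (htc.image _).image _, ?_, ?_⟩
  · rintro _ ⟨_, ⟨⟨c, η, hη, -, hc⟩, -, rfl⟩, rfl⟩
    simpa [hc] using hη
  intro F G hF hG hD η hη hηK
  have hηc : Continuous fun x => (η x, fderiv ℝ η x) :=
    hη.continuous.prodMk (hη.smooth.continuous_fderiv (by simp))
  set c₀ : C(Space d, ℝ × (Space d →L[ℝ] ℝ)) := ⟨_, hηc⟩ with hc₀
  have hc₀s : c₀ ∈ s := ⟨η, hη, hηK, fun x => rfl⟩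
  have hcl : c₀ ∈ closure (Subtype.val '' t) := by
    have h1 : (⟨c₀, hc₀s⟩ : s) ∈ closure t := htd _
    exact image_closure_subset_closure_image continuous_subtype_val ⟨_, h1, rfl⟩
  obtain ⟨c, hct, hclim⟩ := mem_closure_iff_seq_limit.1 hcl
  have hunif := (ContinuousMap.tendsto_iff_forall_isCompact_tendstoUniformlyOn.1 hclim) K hK
  have hform : ∀ c ∈ s, ∀ x ∉ K, c x = 0 := by
    rintro c ⟨η', hη', hK', hc⟩ x hx
    have := IsTest.fderiv_eq_zero (fun h => hx (hK' h))
    rw [hc, this.1, this.2]; rfl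
  have hint : ∀ c ∈ s, ∫ x, (F x * (c x).1 + (c x).2 (G x)) =
      ∫ x in K, (F x * (c x).1 + (c x).2 (G x)) := by
    intro c hc
    rw [← integral_indicator hK.measurableSet]
    refine integral_congr_ae (ae_of_all _ fun x => ?_)
    by_cases hx : x ∈ K
    · simp [hx]
    · simp [hx, hform c hc x hx]
  have hcs : ∀ n, c n ∈ s := fun n => by
    obtain ⟨c', -, h⟩ := hct n
    rw [← h]; exact c'.2
  have hzero : ∀ n, ∫ x in K, (F x * (c n x).1 + (c n x).2 (G x)) = 0 := by
    intro n
    rw [← hint _ (hcs n)]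
    obtain ⟨η', hη', hK', hc⟩ := hcs n
    have h2 := hD _ ⟨c n, hct n, rfl⟩
    have h3 : (fun x => (c n x).1) = η' := by ext x; rw [hc]
    simp only [h3] at h2
    simpa only [hc] using h2
  have hlim : Tendsto (fun n => ∫ x in K, (F x * (c n x).1 + (c n x).2 (G x))) atTop
      (𝓝 (∫ x in K, (F x * (c₀ x).1 + (c₀ x).2 (G x)))) := by
    obtain ⟨B, hB⟩ := hK.exists_bound_of_continuousOn c₀.continuous.continuousOn
    have hgood : ∀ᶠ n in atTop, ∀ x ∈ K, ‖c n x‖ ≤ B + 1 := by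
      filter_upwards [Metric.tendstoUniformlyOn_iff.1 hunif 1 one_pos] with n hn x hx
      have h1 := hn x hx
      rw [dist_comm, dist_eq_norm] at h1
      have h2 := norm_le_norm_add_norm_sub' (c n x) (c₀ x)
      linarith [hB x hx]
    refine tendsto_integral_filter_of_dominated_convergence
      (fun x => (B + 1) * (‖F x‖ + ‖G x‖)) ?_ ?_ ?_ ?_
    · refine Eventually.of_forall fun n => ?_
      have h1 : AEStronglyMeasurable F (volume.restrict K) := hF.aestronglyMeasurable.restrict
      have h2 : AEStronglyMeasurable G (volume.restrict K) := hG.aestronglyMeasurable.restrict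
      refine (h1.mul (continuous_fst.comp (c n).continuous).aestronglyMeasurable).add ?_
      exact (isBoundedBilinearMap_apply (𝕜 := ℝ) (E := Space d) (F := ℝ)).continuous
        |>.comp_aestronglyMeasurable
          ((continuous_snd.comp (c n).continuous).aestronglyMeasurable.prodMk h2)
    · filter_upwards [hgood] with n hn
      filter_upwards [ae_restrict_mem hK.measurableSet] with x hx
      have h1 := hn x hx
      have h2 : ‖(c n x).1‖ ≤ B + 1 := (norm_fst_le _).trans h1
      have h3 : ‖(c n x).2‖ ≤ B + 1 := (norm_snd_le _).trans h1
      calc ‖F x * (c n x).1 + (c n x).2 (G x)‖ ≤ ‖F x‖ * ‖(c n x).1‖ + ‖(c n x).2‖ * ‖G x‖ :=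
            (norm_add_le _ _).trans (add_le_add (norm_mul_le _ _) ((c n x).2.le_opNorm _))
        _ ≤ ‖F x‖ * (B + 1) + (B + 1) * ‖G x‖ := by gcongr
        _ = _ := by ring
    · exact (((hF.integrableOn_isCompact hK).norm).add
        ((hG.integrableOn_isCompact hK).norm)).const_mul _
    · filter_upwards [ae_restrict_mem hK.measurableSet] with x hx
      have h1 : Tendsto (fun n => c n x) atTop (𝓝 (c₀ x)) := hunif.tendsto_at hx
      have h2 := (continuous_fst.tendsto _).comp h1
      have h3 := (continuous_snd.tendsto _).comp h1
      exact (h2.const_mul _).add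
        (((ContinuousLinearMap.apply ℝ ℝ (G x)).continuous.tendsto _).comp h3)
  have hfin : ∫ x in K, (F x * (c₀ x).1 + (c₀ x).2 (G x)) = 0 :=
    tendsto_nhds_unique hlim (by simp [hzero])
  rw [← hint _ hc₀s] at hfin
  exact hfin

/-- A countable family of test functions suffices to test first-order distributions. -/
lemma exists_countable_tests (d : ℕ) :
    ∃ D : Set (Space d → ℝ), D.Countable ∧ (∀ η ∈ D, IsTest η) ∧
      ∀ (F : Space d → ℝ) (G : Space d → Space d), LocallyIntegrable F → LocallyIntegrable G →
        (∀ η ∈ D, ∫ x, (F x * η x + fderiv ℝ η x (G x)) = 0) →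
        ∀ η, IsTest η → ∫ x, (F x * η x + fderiv ℝ η x (G x)) = 0 := by
  choose D hD1 hD2 hD3 using fun R : ℕ =>
    exists_countable_tests_of_tsupport_subset (isCompact_closedBall (0 : Space d) R)
  refine ⟨⋃ R, D R, Set.countable_iUnion hD1, ?_, ?_⟩
  · intro η hη
    obtain ⟨R, hR⟩ := Set.mem_iUnion.1 hη
    exact hD2 R η hR
  · intro F G hF hG h η hη
    obtain ⟨r, hr⟩ := hη.compact.isCompact.isBounded.subset_closedBall 0
    obtain ⟨R, hR⟩ := exists_nat_ge r
    exact hD3 R F G hF hG (fun η' h' => h η' (Set.mem_iUnion.2 ⟨R, h'⟩)) η hη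
      (hr.trans (Metric.closedBall_subset_closedBall hR))

end CountableTests

section Inner

variable {α E : Type*} [MeasurableSpace α] {μ : Measure α} [NormedAddCommGroup E]
  [InnerProductSpace ℝ E] {f g : α → E}

lemma inner_toLp (hf : MemLp f 2 μ) (hg : MemLp g 2 μ) :
    ⟪hf.toLp f, hg.toLp g⟫ = ∫ x, ⟪f x, g x⟫ ∂μ := by
  rw [L2.inner_def]
  refine integral_congr_ae ?_
  filter_upwards [hf.coeFn_toLp, hg.coeFn_toLp] with x h1 h2
  rw [h1, h2]

end Inner

section SmoothFunctions

variable {d : ℕ}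

lemma sum_smul_basisVec (v : Space d) : ∑ i, v i • basisVec i = v := by
  ext j
  simp [Finset.sum_apply, Pi.single_apply]

lemma clm_apply_eq_sum (L : Space d →L[ℝ] ℝ) (v : Space d) :
    L v = ∑ i, v i * L (basisVec i) := by
  conv_lhs => rw [← sum_smul_basisVec v]
  simp

lemma hasWeakGradient_of_contDiff {u : Space d → ℝ} {g : Space d → Space d}
    (hu : ContDiff ℝ 1 u) (hg : ∀ x i, g x i = fderiv ℝ u x (basisVec i)) :
    HasWeakGradient u g := by
  have hfc := hu.continuous_fderiv (by simp)
  have hgc : Continuous g := by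
    have : g = fun x => WithLp.toLp 2 fun i => fderiv ℝ u x (basisVec i) := by
      ext x i; exact hg x i
    rw [this]
    refine (PiLp.continuous_toLp 2 _).comp (continuous_pi fun i => ?_)
    exact hfc.clm_apply continuous_const
  refine ⟨hu.continuous.locallyIntegrable, hgc.locallyIntegrable, fun φ hφ hφc j => ?_⟩
  have hφ' : IsTest φ := ⟨hφ, hφc⟩
  have hφj := hφ'.fderiv_apply (basisVec j)
  simp only [hg]
  refine integral_mul_fderiv_eq_neg_fderiv_mul_of_integrable ?_ ?_ ?_
    (fun x _ => hu.differentiable (by simp) x) (fun x _ => hφ'.differentiable x)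
  · exact ((hfc.clm_apply continuous_const).mul hφ'.continuous).integrable_of_hasCompactSupport
      hφc.mul_left
  · exact (hu.continuous.mul hφj.continuous).integrable_of_hasCompactSupport
      hφj.compact.mul_left
  · exact (hu.continuous.mul hφ'.continuous).integrable_of_hasCompactSupport hφc.mul_left

end SmoothFunctions

/-! ### Duality between gradients and divergence -/

section Potentials

variable {d : ℕ} {Ω : Type*} [MeasurableSpace Ω] {P : Measure Ω}

/-- The gradient of `smear F η`. -/
def gradSmear (F : Space d → Ω → ℝ) (η : Space d → ℝ) : Space d → Ω → Space d :=
  fun x ω => WithLp.toLp 2 fun i => smear F (partialDeriv i η) x ω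

/-- The divergence of the convolution of a vector field with a kernel. -/
def divSmear (σ : Space d → Ω → Space d) (η : Space d → ℝ) : Space d → Ω → ℝ :=
  fun x ω => ∑ i, smear (fun t ω => σ t ω i) (partialDeriv i η) x ω

lemma LocallyIntegrable.apply {σ : Space d → Space d} (hσ : LocallyIntegrable σ) (i : Fin d) :
    LocallyIntegrable fun x => σ x i := by
  intro x
  obtain ⟨s, hs, h⟩ := hσ x
  exact ⟨s, hs, (EuclideanSpace.proj (𝕜 := ℝ) i).integrable_comp h⟩

lemma fderiv_smear_basisVec {F : Space d → Ω → ℝ} {η : Space d → ℝ} {ω : Ω}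
    (hF : LocallyIntegrable fun x => F x ω) (hη : IsTest η) (x : Space d) (i : Fin d) :
    fderiv ℝ (fun x => smear F η x ω) x (basisVec i) = gradSmear F η x ω i :=
  fderiv_smear hF hη x _

lemma hasWeakGradient_smear {F : Space d → Ω → ℝ} {η : Space d → ℝ} {ω : Ω}
    (hF : LocallyIntegrable fun x => F x ω) (hη : IsTest η) :
    HasWeakGradient (fun x => smear F η x ω) fun x => gradSmear F η x ω :=
  hasWeakGradient_of_contDiff ((contDiff_smear hF hη).of_le (by simp))
    fun x i => (fderiv_smear_basisVec hF hη x i).symm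

lemma divSmear_eq {σ : Space d → Ω → Space d} {η : Space d → ℝ} {ω : Ω}
    (hσ : LocallyIntegrable fun x => σ x ω) (hη : IsTest η) (x : Space d) :
    divSmear σ η x ω = -∫ t, fderiv ℝ (fun t => η (x - t)) t (σ t ω) := by
  simp only [fderiv_comp_sub_left hη, integral_neg, neg_neg]
  rw [integral_congr_ae (ae_of_all _ fun t => clm_apply_eq_sum (fderiv ℝ η (x - t)) (σ t ω)),
    integral_finsetSum]
  · rfl
  · intro i _
    have hi := (hη.partialDeriv i).comp_sub_left x
    have := (LocallyIntegrable.apply hσ i).integrable_smul_left_of_hasCompactSupport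
      hi.continuous hi.compact
    simpa [mul_comm, partialDeriv] using this

variable [AddAction (Fin d → ℤ) Ω]

lemma isStationaryL2_toLp {f : Fin d → Space d → Ω → ℝ} (hf : ∀ i, IsStationaryL2 P (f i)) :
    IsStationaryL2 P (fun x ω => (WithLp.toLp 2 fun i => f i x ω : Space d)) where
  measurable := by
    refine (PiLp.continuous_toLp 2 _).comp_stronglyMeasurable ?_
    exact (measurable_pi_lambda _ fun i => (hf i).measurable.measurable).stronglyMeasurable
  stationary := fun k => by
    filter_upwards [ae_all_iff.2 fun i => (hf i).stationary k] with p hp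
    simp [hp]
  memLp := by
    have h : MemLp (fun p : Space d × Ω => ∑ i, f i p.1 p.2 • (basisVec i : Space d)) 2
        ((cellMeasure d).prod P) :=
      memLp_finsetSum _ fun i _ =>
        (ContinuousLinearMap.toSpanSingleton ℝ (basisVec i)).comp_memLp' (hf i).memLp
    refine h.ae_eq (ae_of_all _ fun p => ?_)
    exact sum_smul_basisVec (WithLp.toLp 2 fun i => f i p.1 p.2)

lemma IsStationaryL2.apply {σ : Space d → Ω → Space d} (hσ : IsStationaryL2 P σ) (i : Fin d) :
    IsStationaryL2 P fun x ω => σ x ω i :=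
  hσ.comp (EuclideanSpace.proj i)

variable [IsProbabilityMeasure P]
  [MeasurableConstVAdd (Fin d → ℤ) Ω] [VAddInvariantMeasure (Fin d → ℤ) Ω P]

lemma IsStationaryL2.gradSmear {F : Space d → Ω → ℝ} (hF : IsStationaryL2 P F) {η : Space d → ℝ}
    (hη : IsTest η) : IsStationaryL2 P (gradSmear F η) :=
  isStationaryL2_toLp fun i => hF.smear (hη.partialDeriv i)

lemma IsStationaryL2.divSmear {σ : Space d → Ω → Space d} (hσ : IsStationaryL2 P σ)
    {η : Space d → ℝ} (hη : IsTest η) : IsStationaryL2 P (divSmear σ η) :=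
  IsStationaryL2.sum _ fun i _ => (hσ.apply i).smear (hη.partialDeriv i)

lemma integral_inner_eq_sum {σ τ : Space d → Ω → Space d} (hσ : IsStationaryL2 P σ)
    (hτ : IsStationaryL2 P τ) :
    ∫ p : Space d × Ω, ⟪σ p.1 p.2, τ p.1 p.2⟫ ∂((cellMeasure d).prod P) =
      ∑ i, ∫ p : Space d × Ω, σ p.1 p.2 i * τ p.1 p.2 i ∂((cellMeasure d).prod P) := by
  rw [← integral_finsetSum]
  · refine integral_congr_ae (ae_of_all _ fun p => ?_)
    simp [PiLp.inner_apply, mul_comm]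
  · exact fun i _ => (hσ.apply i).memLp.integrable_mul (hτ.apply i).memLp

/-- Integration by parts on the cell. No boundary term appears, because the derivative sits on the
kernel and smearing with the reflected kernel is the adjoint operation. -/
lemma integral_inner_gradSmear {σ : Space d → Ω → Space d} (hσ : IsStationaryL2 P σ)
    {F : Space d → Ω → ℝ} (hF : IsStationaryL2 P F) {η : Space d → ℝ} (hη : IsTest η) :
    ∫ p : Space d × Ω, ⟪σ p.1 p.2, gradSmear F η p.1 p.2⟫ ∂((cellMeasure d).prod P) =
      -∫ p : Space d × Ω, divSmear σ (fun t => η (-t)) p.1 p.2 * F p.1 p.2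
        ∂((cellMeasure d).prod P) := by
  rw [integral_inner_eq_sum hσ (hF.gradSmear hη)]
  have h : ∀ i, ∫ p : Space d × Ω, σ p.1 p.2 i * gradSmear F η p.1 p.2 i
      ∂((cellMeasure d).prod P) = -∫ p : Space d × Ω,
        smear (fun t ω => σ t ω i) (partialDeriv i fun t => η (-t)) p.1 p.2 * F p.1 p.2
        ∂((cellMeasure d).prod P) := by
    intro i
    rw [← integral_mul_smear (hσ.apply i) hF (hη.reflect.partialDeriv i), ← integral_neg]
    refine integral_congr_ae (ae_of_all _ fun p => ?_)
    simp only [partialDeriv_reflect hη, neg_neg, gradSmear, smear, mul_neg, integral_neg]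
  simp_rw [h]
  rw [Finset.sum_neg_distrib, ← integral_finsetSum]
  · simp only [divSmear, Finset.sum_mul]
  · exact fun i _ => ((hσ.apply i).smear (hη.reflect.partialDeriv i)).memLp.integrable_mul hF.memLp

/-- Stationary divergence-free fields are orthogonal to gradients of stationary functions. -/
lemma integral_inner_gradSmear_eq_zero {σ : Space d → Ω → Space d} (hσ : IsStationaryL2 P σ)
    (hdiv : ∀ᵐ ω ∂P, IsDivFree fun x => σ x ω)
    {F : Space d → Ω → ℝ} (hF : IsStationaryL2 P F) {η : Space d → ℝ} (hη : IsTest η) :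
    ∫ p : Space d × Ω, ⟪σ p.1 p.2, gradSmear F η p.1 p.2⟫ ∂((cellMeasure d).prod P) = 0 := by
  rw [integral_inner_gradSmear hσ hF hη, neg_eq_zero]
  refine integral_eq_zero_of_ae ?_
  filter_upwards [Measure.quasiMeasurePreserving_snd.ae hdiv] with p hp
  have hη' := hη.reflect.comp_sub_left p.1
  rw [divSmear_eq hp.locallyIntegrable hη.reflect, hp.integral_eq_zero _ hη'.smooth hη'.compact]
  simp

/-- A smooth stationary field that vanishes on the cell vanishes everywhere. -/
lemma smear_eq_zero_of_ae_cell {F : Space d → Ω → ℝ} (hF : Stationary P F)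
    (hm : StronglyMeasurable (Function.uncurry F)) (hc : ∀ᵐ ω ∂P, Continuous fun x => F x ω)
    (h : ∀ᵐ p : Space d × Ω ∂((cellMeasure d).prod P), F p.1 p.2 = 0) :
    ∀ᵐ ω ∂P, ∀ x, F x ω = 0 := by
  have h1 := hF.ae_eq_of_ae_eq_cell (stationary_const (0 : ℝ)) hm.aestronglyMeasurable
    aestronglyMeasurable_const h
  filter_upwards [ae_ae_swap (p := fun x ω => F x ω = 0) h1, hc] with ω hω hcω
  have := (Continuous.ae_eq_iff_eq volume hcω continuous_const).1 hω
  exact fun x => congrFun this x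

lemma ae_eq_zero_of_integral_mul_self {F : Space d → Ω → ℝ} (hF : IsStationaryL2 P F)
    (h : ∫ p : Space d × Ω, F p.1 p.2 * F p.1 p.2 ∂((cellMeasure d).prod P) = 0) :
    ∀ᵐ p : Space d × Ω ∂((cellMeasure d).prod P), F p.1 p.2 = 0 := by
  have := (integral_eq_zero_iff_of_nonneg (fun p => mul_self_nonneg _)
    (hF.memLp.integrable_mul hF.memLp)).1 h
  filter_upwards [this] with p hp
  exact mul_self_eq_zero.1 hp

/-- For a test function ζ, choose for F the divergence of σ smeared with the reflected ζ.
Orthogonality then says that the integral of F² vanishes, so F vanishes at every point for almost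
every ω. The countable family of tests removes the dependence of the null set on ζ. -/
lemma ae_isDivFree_of_orthogonal {σ : Space d → Ω → Space d} (hσ : IsStationaryL2 P σ)
    (h : ∀ (F : Space d → Ω → ℝ) (η : Space d → ℝ), IsStationaryL2 P F → IsTest η →
      ∫ p : Space d × Ω, ⟪σ p.1 p.2, gradSmear F η p.1 p.2⟫ ∂((cellMeasure d).prod P) = 0) :
    ∀ᵐ ω ∂P, IsDivFree fun x => σ x ω := by
  obtain ⟨D, hD1, hD2, hD3⟩ := exists_countable_tests d
  have hli := hσ.ae_locallyIntegrable
  have h1 : ∀ ζ ∈ D, ∀ᵐ ω ∂P, ∫ t, fderiv ℝ ζ t (σ t ω) = 0 := by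
    intro ζ hζ
    have hζ' := hD2 ζ hζ
    have hD := hσ.divSmear hζ'.reflect
    have h2 := h _ _ hD hζ'
    rw [integral_inner_gradSmear hσ hD hζ', neg_eq_zero] at h2
    have hc : ∀ᵐ ω ∂P, Continuous fun x => divSmear σ (fun t => ζ (-t)) x ω := by
      filter_upwards [hli] with ω hω
      refine continuous_finsetSum _ fun i _ => ?_
      exact (contDiff_smear (LocallyIntegrable.apply hω i)
        (hζ'.reflect.partialDeriv i)).continuous
    filter_upwards [smear_eq_zero_of_ae_cell hD.stationary hD.measurable hc
      (ae_eq_zero_of_integral_mul_self hD h2), hli] with ω hω hωi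
    -- At the origin the smeared divergence is, up to sign, the distributional divergence tested
    -- against ζ itself.
    have h3 := hω 0
    rw [divSmear_eq hωi hζ'.reflect] at h3
    simpa using h3
  filter_upwards [(ae_ball_iff hD1).2 h1, hli] with ω hω hωi
  refine ⟨hωi, fun φ hφ hφc => ?_⟩
  have h4 := hD3 (fun _ => 0) (fun x => σ x ω) (locallyIntegrable_const 0) hωi
    (fun η hη => by simpa using hω η hη) φ ⟨hφ, hφc⟩
  simpa using h4

end Potentials

end

/-! ### Ergodicity: orthogonal gradients are constant -/

section

variable {d : ℕ}

/-- Each mollification of f has zero gradient and is constant, and the mollifications converge to f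
almost everywhere. The ratio bound on the radii keeps the kernels comparable to averages over balls,
as Lebesgue differentiation requires. -/
lemma exists_const_of_smear_fderiv_eq_zero {f : Space d → ℝ} (hf : LocallyIntegrable f)
    (φ : ℕ → ContDiffBump (0 : Space d)) (hφ : Tendsto (fun n => (φ n).rOut) atTop (𝓝 0))
    (hφ2 : ∀ n, (φ n).rOut ≤ 2 * (φ n).rIn)
    (h : ∀ n j x, ∫ t, f t * partialDeriv j ((φ n).normed volume) (x - t) = 0) :
    ∃ c, ∀ᵐ x, f x = c := by
  have htest : ∀ n, IsTest ((φ n).normed volume) := fun n =>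
    ⟨(φ n).contDiff_normed, (φ n).hasCompactSupport_normed⟩
  have hconst : ∀ n x, smear (fun t (_ : Unit) => f t) ((φ n).normed volume) x () =
      smear (fun t (_ : Unit) => f t) ((φ n).normed volume) 0 () := by
    intro n x
    refine is_const_of_fderiv_eq_zero (𝕜 := ℝ)
      ((contDiff_smear (ω := ()) hf (htest n)).differentiable (by simp)) (fun y => ?_) x 0
    ext v
    rw [clm_apply_eq_sum]
    refine Finset.sum_eq_zero fun j _ => ?_
    rw [fderiv_smear_basisVec (ω := ()) hf (htest n)]
    exact mul_eq_zero_of_right _ (h n j y)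
  have hlim := ContDiffBump.ae_convolution_tendsto_right_of_locallyIntegrable (μ := volume) hφ
    (Eventually.of_forall hφ2) hf
  have heq : ∀ n x, convolution ((φ n).normed volume) f (ContinuousLinearMap.lsmul ℝ ℝ) volume x =
      smear (fun t (_ : Unit) => f t) ((φ n).normed volume) 0 () := by
    intro n x
    rw [← hconst n x, convolution_eq_swap]
    refine integral_congr_ae (ae_of_all _ fun t => ?_)
    simp [mul_comm]
  simp only [heq] at hlim
  obtain ⟨x₀, hx₀⟩ := hlim.exists
  refine ⟨f x₀, hlim.mono fun x hx => tendsto_nhds_unique hx hx₀⟩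

variable (d) in
lemma exists_bump_sequence : ∃ φ : ℕ → ContDiffBump (0 : Space d),
    Tendsto (fun n => (φ n).rOut) atTop (𝓝 0) ∧ ∀ n, (φ n).rOut ≤ 2 * (φ n).rIn := by
  refine ⟨fun n => ⟨1 / ((n : ℝ) + 1) / 2, 1 / ((n : ℝ) + 1), by positivity,
    half_lt_self (by positivity)⟩, tendsto_one_div_add_atTop_nhds_zero_nat, fun n => ?_⟩
  simp only
  linarith

variable {Ω : Type*} [MeasurableSpace Ω] {P : Measure Ω} [IsProbabilityMeasure P]
  [AddAction (Fin d → ℤ) Ω] [MeasurableConstVAdd (Fin d → ℤ) Ω]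

/-- A measurable function invariant under an ergodic action is almost everywhere constant. -/
lemma exists_ae_eq_const_of_invariant [ErgodicVAdd (Fin d → ℤ) Ω P] {f : Ω → Space d}
    (hf : Measurable f) (h : ∀ k : Fin d → ℤ, ∀ᵐ ω ∂P, f (k +ᵥ ω) = f ω) :
    ∃ c, ∀ᵐ ω ∂P, f ω = c := by
  refine exists_eventuallyEq_const_of_forall_separating MeasurableSet fun U hU => ?_
  have := aeconst_of_forall_preimage_vadd_ae_eq (Fin d → ℤ) (μ := P) (s := f ⁻¹' U)
    (hf hU).nullMeasurableSet (fun k => by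
      filter_upwards [h k] with ω hω
      change (f (k +ᵥ ω) ∈ U) = (f ω ∈ U)
      rw [hω])
  exact eventuallyConst_set.1 this

/-- A stationary field that is almost surely constant in space is constant. -/
lemma exists_const_of_ae_const_in_space [ErgodicVAdd (Fin d → ℤ) Ω P] {g : Space d → Ω → Space d}
    (hm : StronglyMeasurable (Function.uncurry g)) (hs : Stationary P g)
    (h : ∀ᵐ ω ∂P, ∃ c, ∀ᵐ x, g x ω = c) :
    ∃ c, ∀ᵐ p : Space d × Ω ∂((volume : Measure (Space d)).prod P), g p.1 p.2 = c := by
  -- The cell average is a measurable choice of the spatial constant. Stationarity makes it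
  -- invariant under the action, so ergodicity applies.
  set f : Ω → Space d := fun ω => ∫ x, g x ω ∂(cellMeasure d) with hf
  have hfm : StronglyMeasurable f := hm.integral_prod_left
  have hfg : ∀ᵐ ω ∂P, ∀ᵐ x, g x ω = f ω := by
    filter_upwards [h] with ω ⟨c, hc⟩
    have : f ω = c := by
      rw [hf]
      simp only
      rw [integral_congr_ae (cellMeasure_absolutelyContinuous.ae_le hc)]
      simp
    rwa [this]
  obtain ⟨c, hc⟩ := exists_ae_eq_const_of_invariant (P := P) hfm.measurable (fun k => by
    filter_upwards [hfg, ae_ae_swap (p := fun x ω => g (x + latticePoint k) ω = g x (k +ᵥ ω)) (hs k)]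
      with ω h1 h2
    have h3 : ∀ᵐ x : Space d, g x (k +ᵥ ω) = f ω := by
      filter_upwards [h2, (measurePreserving_add_right (volume : Measure (Space d))
        (latticePoint k)).quasiMeasurePreserving.ae h1] with x hx hx'
      rw [← hx, hx']
    change ∫ x, g x (k +ᵥ ω) ∂(cellMeasure d) = f ω
    rw [integral_congr_ae (cellMeasure_absolutelyContinuous.ae_le h3)]
    simp)
  refine ⟨c, ?_⟩
  have hmeas : MeasurableSet {q : Ω × Space d | g q.2 q.1 = c} :=
    (hm.measurable.comp measurable_swap) (measurableSet_singleton c)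
  have h4 : ∀ᵐ q : Ω × Space d ∂(P.prod volume), g q.2 q.1 = c := by
    rw [Measure.ae_prod_iff_ae_ae hmeas]
    filter_upwards [hfg, hc] with ω h1 h2
    simpa [h2] using h1
  exact Measure.measurePreserving_swap.quasiMeasurePreserving.ae h4

section

variable [VAddInvariantMeasure (Fin d → ℤ) Ω P]

/-- A gradient is curl free: both sides are the convolution of u with the same mixed second
derivative of the kernel. -/
lemma ae_smear_partialDeriv_comm {u : Space d → Ω → ℝ} {g : Space d → Ω → Space d}
    (hu : ∀ᵐ ω ∂P, HasWeakGradient (fun x => u x ω) fun x => g x ω) {ζ : Space d → ℝ}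
    (hζ : IsTest ζ) :
    ∀ᵐ ω ∂P, ∀ i j x, smear (fun t ω => g t ω j) (partialDeriv i ζ) x ω =
      smear (fun t ω => g t ω i) (partialDeriv j ζ) x ω := by
  filter_upwards [hu] with ω hω i j x
  have h1 := hω.integral_partialDeriv (hζ.partialDeriv i) x j
  have h2 := hω.integral_partialDeriv (hζ.partialDeriv j) x i
  rw [partialDeriv_comm hζ] at h2
  exact h1.symm.trans h2

/-- A stationary gradient orthogonal to all gradients of stationary functions has vanishing
mollified derivatives. -/
lemma ae_smear_partialDeriv_eq_zero {g : Space d → Ω → Space d} (hg : IsStationaryL2 P g)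
    {u : Space d → Ω → ℝ} (hu : ∀ᵐ ω ∂P, HasWeakGradient (fun x => u x ω) fun x => g x ω)
    (h : ∀ (F : Space d → Ω → ℝ) (η : Space d → ℝ), IsStationaryL2 P F → IsTest η →
      ∫ p : Space d × Ω, ⟪g p.1 p.2, gradSmear F η p.1 p.2⟫ ∂((cellMeasure d).prod P) = 0)
    {ζ : Space d → ℝ} (hζ : IsTest ζ) (i j : Fin d) :
    ∀ᵐ ω ∂P, ∀ x, smear (fun t ω => g t ω i) (partialDeriv j ζ) x ω = 0 := by
  set ζ' := partialDeriv j ζ with hζ'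
  have hζt : IsTest ζ' := hζ.partialDeriv j
  set F := smear (fun t ω => g t ω j) ζ with hF
  have hFs : IsStationaryL2 P F := (hg.apply j).smear hζ
  have hs : ∀ i, IsStationaryL2 P (smear (fun t ω => g t ω i) ζ') := fun i =>
    (hg.apply i).smear hζt
  have h0 := h F (fun t => ζ' (-t)) hFs hζt.reflect
  -- With F = g_j * ζ, curl-freeness gives ∂_i F = g_i * ∂_j ζ. The gradient of F smeared with the
  -- reflected ∂_j ζ thus has components (g_i * ∂_j ζ) smeared with that reflected kernel.
  have hswap : ∀ᵐ ω ∂P, ∀ i x, gradSmear F (fun t => ζ' (-t)) x ω i =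
      smear (smear (fun t ω => g t ω i) ζ') (fun t => ζ' (-t)) x ω := by
    filter_upwards [ae_smear_partialDeriv_comm hu hζ, hg.ae_locallyIntegrable] with ω h1 h2 i x
    have h3 := (hasWeakGradient_smear (F := fun t ω => g t ω j) (ω := ω)
      (LocallyIntegrable.apply h2 j) hζ).integral_partialDeriv hζt.reflect x i
    refine h3.trans (integral_congr_ae (ae_of_all _ fun t => ?_))
    simp only [gradSmear]
    rw [h1 i j t]
  -- Moving the reflected kernel back onto g_i shows that orthogonality is the vanishing of a sum of
  -- squared norms of the mollified derivatives.
  have hsum : ∑ i, ∫ p : Space d × Ω, smear (fun t ω => g t ω i) ζ' p.1 p.2 *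
      smear (fun t ω => g t ω i) ζ' p.1 p.2 ∂((cellMeasure d).prod P) = 0 := by
    rw [← h0, integral_inner_eq_sum hg (hFs.gradSmear hζt.reflect)]
    refine Finset.sum_congr rfl fun i _ => ?_
    rw [← integral_mul_smear (hg.apply i) (hs i) hζt]
    refine integral_congr_ae ?_
    filter_upwards [Measure.quasiMeasurePreserving_snd.ae hswap] with p hp
    rw [hp i p.1]
  have hzero := (Finset.sum_eq_zero_iff_of_nonneg (fun i _ =>
    integral_nonneg fun p => mul_self_nonneg _)).1 hsum i (Finset.mem_univ i)
  refine smear_eq_zero_of_ae_cell (hs i).stationary (hs i).measurable ?_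
    (ae_eq_zero_of_integral_mul_self (hs i) hzero)
  filter_upwards [hg.ae_locallyIntegrable] with ω hω
  exact (contDiff_smear (LocallyIntegrable.apply hω i) hζt).continuous

end

/-- A stationary gradient orthogonal to all gradients of stationary functions is constant. -/
lemma exists_const_of_orthogonal [ErgodicVAdd (Fin d → ℤ) Ω P] {g : Space d → Ω → Space d}
    (hg : IsStationaryL2 P g)
    {u : Space d → Ω → ℝ} (hu : ∀ᵐ ω ∂P, HasWeakGradient (fun x => u x ω) fun x => g x ω)
    (h : ∀ (F : Space d → Ω → ℝ) (η : Space d → ℝ), IsStationaryL2 P F → IsTest η →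
      ∫ p : Space d × Ω, ⟪g p.1 p.2, gradSmear F η p.1 p.2⟫ ∂((cellMeasure d).prod P) = 0) :
    ∃ c, ∀ᵐ p : Space d × Ω ∂((volume : Measure (Space d)).prod P), g p.1 p.2 = c := by
  obtain ⟨φ, hφ, hφ2⟩ := exists_bump_sequence d
  have htest : ∀ n, IsTest ((φ n).normed volume) := fun n =>
    ⟨(φ n).contDiff_normed, (φ n).hasCompactSupport_normed⟩
  refine exists_const_of_ae_const_in_space hg.measurable hg.stationary ?_
  have hz := ae_all_iff.2 fun n => ae_all_iff.2 fun i => ae_all_iff.2 fun j =>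
    ae_smear_partialDeriv_eq_zero hg hu h (htest n) i j
  filter_upwards [hz, hg.ae_locallyIntegrable] with ω h1 h2
  choose c hc using fun i => exists_const_of_smear_fderiv_eq_zero
    (LocallyIntegrable.apply h2 i) φ hφ hφ2 (fun n j x => h1 n i j x)
  refine ⟨WithLp.toLp 2 c, ?_⟩
  filter_upwards [ae_all_iff.2 hc] with x hx
  ext i
  exact hx i

end

/-! ### Integrals against compactly supported weights -/

section

variable {d : ℕ} {Ω : Type*} [MeasurableSpace Ω] {P : Measure Ω}

section Weights

lemma exists_abs_le_refDensity {k : Space d → ℝ} (hk : Continuous k) (hc : HasCompactSupport k) :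
    ∃ C : ℝ, ∀ x, |k x| ≤ C * refDensity x := by
  have h1 : Continuous fun x => k x * (refDensity x)⁻¹ :=
    hk.mul (continuous_refDensity.inv₀ fun x => (refDensity_pos x).ne')
  obtain ⟨C, hC⟩ := (hc.mul_right (f' := fun x => (refDensity x)⁻¹)).exists_bound_of_continuous h1
  refine ⟨C, fun x => ?_⟩
  have h2 : ‖k x * (refDensity x)⁻¹‖ ≤ C := hC x
  rw [Real.norm_eq_abs, abs_mul, abs_of_pos (inv_pos.2 (refDensity_pos x)), ← div_eq_mul_inv,
    div_le_iff₀ (refDensity_pos x)] at h2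
  exact h2

variable [IsProbabilityMeasure P]

lemma exists_lintegral_mul_le_ref {k : Space d → ℝ} (hk : Continuous k)
    (hc : HasCompactSupport k) : ∃ C : ℝ, ∀ U : Space d → Ω → ℝ,
      StronglyMeasurable (Function.uncurry U) →
      ∫⁻ p : Space d × Ω, ‖U p.1 p.2 * k p.1‖ₑ ∂((volume : Measure (Space d)).prod P) ≤
        ENNReal.ofReal C * ∫⁻ p : Space d × Ω, ‖U p.1 p.2‖ₑ ∂((refMeasure d).prod P) := by
  obtain ⟨C, hC⟩ := exists_abs_le_refDensity hk hc
  refine ⟨C, fun U hU => ?_⟩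
  have hUm : Measurable fun p : Space d × Ω => ‖U p.1 p.2‖ₑ := hU.measurable.enorm
  have hkm : Measurable fun p : Space d × Ω => k p.1 := hk.measurable.comp measurable_fst
  have hUk : Measurable fun p : Space d × Ω => ‖U p.1 p.2 * k p.1‖ₑ :=
    (hU.measurable.mul hkm).enorm
  rw [lintegral_prod _ hUk.aemeasurable,
    lintegral_prod _ hUm.aemeasurable, lintegral_refMeasure,
    ← lintegral_const_mul' _ _ ENNReal.ofReal_ne_top]
  refine lintegral_mono fun x => ?_
  simp only [enorm_mul]
  rw [lintegral_mul_const' _ _ (by simp), mul_comm, ← mul_assoc]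
  gcongr
  have h := hC x
  have hC0 : 0 ≤ C := by
    have := (abs_nonneg _).trans h
    exact nonneg_of_mul_nonneg_left this (refDensity_pos x)
  rw [← ENNReal.ofReal_mul hC0, ← ofReal_norm]
  exact ENNReal.ofReal_le_ofReal h

lemma integrable_mul_of_ref {U : Space d → Ω → ℝ} (hm : StronglyMeasurable (Function.uncurry U))
    (hU : Integrable (Function.uncurry U) ((refMeasure d).prod P)) {k : Space d → ℝ}
    (hk : Continuous k) (hc : HasCompactSupport k) :
    Integrable (fun p : Space d × Ω => U p.1 p.2 * k p.1)
      ((volume : Measure (Space d)).prod P) := by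
  obtain ⟨C, hC⟩ := exists_lintegral_mul_le_ref (P := P) hk hc
  refine ⟨(hm.mul (hk.stronglyMeasurable.comp_measurable measurable_fst)).aestronglyMeasurable, ?_⟩
  exact (hC U hm).trans_lt (ENNReal.mul_lt_top ENNReal.ofReal_lt_top hU.2)

end Weights

/-! ### A Poincaré inequality for stationary potentials -/

section Poincare

/-- The subtraction of the spatial mean over the unit cell. -/
def centered (u : Space d → Ω → ℝ) : Space d → Ω → ℝ :=
  fun x ω => u x ω - ∫ y, u y ω ∂(cellMeasure d)

variable [AddAction (Fin d → ℤ) Ω]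

/-- `u` is a stationary function, smooth in space, with gradient `g`. -/
structure IsSmoothPotential (P : Measure Ω) (u : Space d → Ω → ℝ) (g : Space d → Ω → Space d) :
    Prop where
  isStationaryL2 : IsStationaryL2 P u
  isStationaryL2_grad : IsStationaryL2 P g
  smooth : ∀ᵐ ω ∂P, ContDiff ℝ 1 fun x => u x ω
  grad : ∀ᵐ ω ∂P, ∀ x i, g x ω i = fderiv ℝ (fun x => u x ω) x (basisVec i)

lemma IsSmoothPotential.add {u v : Space d → Ω → ℝ} {g h : Space d → Ω → Space d}
    (hu : IsSmoothPotential P u g) (hv : IsSmoothPotential P v h) :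
    IsSmoothPotential P (fun x ω => u x ω + v x ω) fun x ω => g x ω + h x ω where
  isStationaryL2 := hu.isStationaryL2.add hv.isStationaryL2
  isStationaryL2_grad := hu.isStationaryL2_grad.add hv.isStationaryL2_grad
  smooth := by
    filter_upwards [hu.smooth, hv.smooth] with ω h1 h2
    exact h1.add h2
  grad := by
    filter_upwards [hu.smooth, hv.smooth, hu.grad, hv.grad] with ω h1 h2 h3 h4 x i
    rw [fderiv_fun_add (h1.differentiable (by simp) x) (h2.differentiable (by simp) x)]
    simp [h3, h4]

lemma IsSmoothPotential.const_smul {u : Space d → Ω → ℝ} {g : Space d → Ω → Space d}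
    (hu : IsSmoothPotential P u g) (c : ℝ) :
    IsSmoothPotential P (fun x ω => c • u x ω) fun x ω => c • g x ω where
  isStationaryL2 := hu.isStationaryL2.const_smul c
  isStationaryL2_grad := hu.isStationaryL2_grad.const_smul c
  smooth := by
    filter_upwards [hu.smooth] with ω h1
    exact h1.const_smul c
  grad := by
    filter_upwards [hu.smooth, hu.grad] with ω h1 h3 x i
    rw [fderiv_fun_const_smul (h1.differentiable (by simp) x)]
    simp [h3]

variable [IsProbabilityMeasure P]

lemma isSmoothPotential_zero :
    IsSmoothPotential P (fun (_ : Space d) (_ : Ω) => (0 : ℝ)) fun _ _ => 0 where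
  isStationaryL2 := isStationaryL2_const 0
  isStationaryL2_grad := isStationaryL2_const 0
  smooth := ae_of_all _ fun _ => contDiff_const
  grad := ae_of_all _ fun _ x i => by simp

variable [MeasurableConstVAdd (Fin d → ℤ) Ω] [VAddInvariantMeasure (Fin d → ℤ) Ω P]

lemma isSmoothPotential_smear {F : Space d → Ω → ℝ} (hF : IsStationaryL2 P F) {η : Space d → ℝ}
    (hη : IsTest η) : IsSmoothPotential P (smear F η) (gradSmear F η) where
  isStationaryL2 := hF.smear hη
  isStationaryL2_grad := hF.gradSmear hη
  smooth := by
    filter_upwards [hF.ae_locallyIntegrable] with ω hω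
    exact (contDiff_smear hω hη).of_le (by simp)
  grad := by
    filter_upwards [hF.ae_locallyIntegrable] with ω hω x i
    exact (fderiv_smear_basisVec hω hη x i).symm

/-- Fundamental theorem of calculus along the segment from y to y + h, followed by Cauchy–Schwarz on
the unit interval. -/
lemma enorm_sub_sq_le_lintegral {u : Space d → ℝ} {g : Space d → Space d} (hu : ContDiff ℝ 1 u)
    (hg : ∀ x i, g x i = fderiv ℝ u x (basisVec i)) (hgm : Measurable g) (y h : Space d) :
    ‖u (y + h) - u y‖ₑ ^ 2 ≤
      ∫⁻ t in Set.Ioc (0 : ℝ) 1, ‖h‖ₑ ^ 2 * ‖g (y + t • h)‖ₑ ^ 2 := by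
  have hder : ∀ t : ℝ, HasDerivAt (fun t : ℝ => u (y + t • h)) (fderiv ℝ u (y + t • h) h) t := by
    intro t
    have h1 : HasDerivAt (fun t : ℝ => y + t • h) h t := by
      simpa using ((hasDerivAt_id t).smul_const h).const_add y
    exact (hu.differentiable (by simp) _).hasFDerivAt.comp_hasDerivAt t h1
  have hcont : Continuous fun t : ℝ => fderiv ℝ u (y + t • h) h :=
    ((hu.continuous_fderiv (by simp)).comp (by fun_prop)).clm_apply continuous_const
  have hftc := intervalIntegral.integral_eq_sub_of_hasDerivAt (a := 0) (b := 1)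
    (fun t _ => hder t) (hcont.intervalIntegrable _ _)
  simp only [one_smul, zero_smul, add_zero] at hftc
  have hmeas : Measurable fun t : ℝ => ‖h‖ₑ * ‖g (y + t • h)‖ₑ :=
    ((hgm.comp (by fun_prop)).enorm).const_mul _
  have hle : ∀ t : ℝ, ‖fderiv ℝ u (y + t • h) h‖ₑ ≤ ‖h‖ₑ * ‖g (y + t • h)‖ₑ := by
    intro t
    have h2 : fderiv ℝ u (y + t • h) h = ⟪h, g (y + t • h)⟫ := by
      rw [clm_apply_eq_sum, PiLp.inner_apply]
      refine Finset.sum_congr rfl fun i _ => ?_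
      rw [hg]
      simp [mul_comm]
    rw [h2]
    simp only [← ofReal_norm, ← ENNReal.ofReal_mul (norm_nonneg _)]
    exact ENNReal.ofReal_le_ofReal (norm_inner_le_norm _ _)
  rw [← hftc, intervalIntegral.integral_of_le zero_le_one]
  calc ‖∫ t in Set.Ioc (0 : ℝ) 1, fderiv ℝ u (y + t • h) h‖ₑ ^ 2
      ≤ (∫⁻ t in Set.Ioc (0 : ℝ) 1, ‖h‖ₑ * ‖g (y + t • h)‖ₑ) ^ 2 :=
        pow_le_pow_left₀ zero_le ((enorm_integral_le_lintegral_enorm _).trans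
          (lintegral_mono hle)) 2
    _ ≤ ∫⁻ t in Set.Ioc (0 : ℝ) 1, (‖h‖ₑ * ‖g (y + t • h)‖ₑ) ^ 2 := by
        have := lintegral_sq_le (μ := volume.restrict (Set.Ioc (0 : ℝ) 1)) hmeas.aemeasurable
        simpa using this
    _ = _ := by simp only [mul_pow]

/-- All points of the segment are shifts of the base point, and shifts preserve the norm of the
stationary gradient. The bound involves neither u nor the cell containing the endpoint, and grows
only quadratically in h. -/
lemma IsSmoothPotential.lintegral_increment_le {u : Space d → Ω → ℝ} {g : Space d → Ω → Space d}
    (hu : IsSmoothPotential P u g) (h : Space d) :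
    ∫⁻ p : Space d × Ω, ‖u (p.1 + h) p.2 - u p.1 p.2‖ₑ ^ 2 ∂((cellMeasure d).prod P) ≤
      ‖h‖ₑ ^ 2 * ∫⁻ p : Space d × Ω, ‖g p.1 p.2‖ₑ ^ 2 ∂((cellMeasure d).prod P) := by
  have hgm := hu.isStationaryL2_grad.measurable.measurable
  have hm : Measurable fun q : (Space d × Ω) × ℝ => ‖h‖ₑ ^ 2 * ‖g (q.1.1 + q.2 • h) q.1.2‖ₑ ^ 2 := by
    have h1 : Measurable fun q : (Space d × Ω) × ℝ => (q.1.1 + q.2 • h, q.1.2) :=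
      ((measurable_fst.comp measurable_fst).add (measurable_snd.smul_const h)).prodMk
        (measurable_snd.comp measurable_fst)
    exact ((hgm.comp h1).enorm.pow_const 2).const_mul _
  calc ∫⁻ p : Space d × Ω, ‖u (p.1 + h) p.2 - u p.1 p.2‖ₑ ^ 2 ∂((cellMeasure d).prod P)
      ≤ ∫⁻ p : Space d × Ω, (∫⁻ t in Set.Ioc (0 : ℝ) 1, ‖h‖ₑ ^ 2 * ‖g (p.1 + t • h) p.2‖ₑ ^ 2)
          ∂((cellMeasure d).prod P) := by
        refine lintegral_mono_ae ?_
        filter_upwards [Measure.quasiMeasurePreserving_snd.ae hu.smooth,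
          Measure.quasiMeasurePreserving_snd.ae hu.grad] with p h1 h2
        exact enorm_sub_sq_le_lintegral h1 h2 (hgm.comp measurable_prodMk_right) p.1 h
    _ = ∫⁻ t in Set.Ioc (0 : ℝ) 1, (∫⁻ p : Space d × Ω, ‖h‖ₑ ^ 2 * ‖g (p.1 + t • h) p.2‖ₑ ^ 2
          ∂((cellMeasure d).prod P)) := lintegral_lintegral_swap hm.aemeasurable
    _ = ∫⁻ t in Set.Ioc (0 : ℝ) 1, ‖h‖ₑ ^ 2 * (∫⁻ p : Space d × Ω, ‖g p.1 p.2‖ₑ ^ 2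
          ∂((cellMeasure d).prod P)) := by
        refine lintegral_congr fun t => ?_
        rw [lintegral_const_mul' _ _ (by simp)]
        congr 1
        exact (hu.isStationaryL2_grad.stationary.comp fun a => ‖a‖ₑ ^ 2).lintegral_shift
          (hgm.enorm.pow_const 2).aemeasurable (t • h)
    _ = _ := by simp

/-- The constant in the Poincaré inequality below. -/
def poincareConst (d : ℕ) : ℝ≥0∞ :=
  ENNReal.ofReal (refConst d) * ∫⁻ x : Space d, ‖x‖ₑ ^ 2 * ENNReal.ofReal (refDensity x)

lemma poincareConst_ne_top : poincareConst d ≠ ∞ :=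
  ENNReal.mul_ne_top ENNReal.ofReal_ne_top lintegral_sq_mul_refDensity_lt_top.ne

lemma stronglyMeasurable_centered {u : Space d → Ω → ℝ}
    (hu : StronglyMeasurable (Function.uncurry u)) :
    StronglyMeasurable (Function.uncurry (centered u)) :=
  hu.sub ((hu.integral_prod_left (μ := cellMeasure d)).comp_measurable measurable_snd)

/-- Poincaré inequality: a potential with zero mean over the cell is controlled by its gradient. -/
lemma IsSmoothPotential.lintegral_centered_le {u : Space d → Ω → ℝ} {g : Space d → Ω → Space d}
    (hu : IsSmoothPotential P u g) :
    ∫⁻ p : Space d × Ω, ‖centered u p.1 p.2‖ₑ ^ 2 ∂((refMeasure d).prod P) ≤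
      poincareConst d * ∫⁻ p : Space d × Ω, ‖g p.1 p.2‖ₑ ^ 2 ∂((cellMeasure d).prod P) := by
  have hum := hu.isStationaryL2.measurable.measurable
  have hcm := (stronglyMeasurable_centered hu.isStationaryL2.measurable).measurable
  have hui : ∀ᵐ ω ∂P, Integrable (fun x => u x ω) (cellMeasure d) :=
    (hu.isStationaryL2.memLp.integrable one_le_two).prod_left_ae
  have hinc : Measurable fun q : (Ω × Space d) × Space d =>
      ‖u (q.1.2 + q.2) q.1.1 - u q.1.2 q.1.1‖ₑ ^ 2 := by
    have h1 : Measurable fun q : (Ω × Space d) × Space d => (q.1.2 + q.2, q.1.1) :=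
      ((measurable_snd.comp measurable_fst).add measurable_snd).prodMk
        (measurable_fst.comp measurable_fst)
    have h2 : Measurable fun q : (Ω × Space d) × Space d => (q.1.2, q.1.1) :=
      (measurable_snd.comp measurable_fst).prodMk (measurable_fst.comp measurable_fst)
    exact ((hum.comp h1).sub (hum.comp h2)).enorm.pow_const 2
  have hincw : Measurable fun q : (Ω × Space d) × Space d =>
      ENNReal.ofReal (refDensity q.2) * ‖u (q.1.2 + q.2) q.1.1 - u q.1.2 q.1.1‖ₑ ^ 2 :=
    (measurable_refDensity.comp measurable_snd).mul hinc
  have hslice : ∀ ω, Measurable fun x => u x ω := fun ω => hum.comp measurable_prodMk_right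
  calc ∫⁻ p : Space d × Ω, ‖centered u p.1 p.2‖ₑ ^ 2 ∂((refMeasure d).prod P)
      = ∫⁻ ω, (∫⁻ x, ‖centered u x ω‖ₑ ^ 2 ∂(refMeasure d)) ∂P :=
        lintegral_prod_symm _ (hcm.enorm.pow_const 2).aemeasurable
    -- The centered potential at x is the mean over y in the cell of u(x) - u(y); Jensen's
    -- inequality moves the square inside.
    _ ≤ ∫⁻ ω, (∫⁻ x, (∫⁻ y, ‖u x ω - u y ω‖ₑ ^ 2 ∂(cellMeasure d)) ∂(refMeasure d)) ∂P := by
        refine lintegral_mono_ae ?_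
        filter_upwards [hui] with ω hω
        refine lintegral_mono fun x => ?_
        have h1 : centered u x ω = ∫ y, (u x ω - u y ω) ∂(cellMeasure d) := by
          rw [integral_sub (integrable_const _) hω]
          simp [centered]
        rw [h1]
        refine (pow_le_pow_left₀ zero_le (enorm_integral_le_lintegral_enorm _) 2).trans ?_
        have := lintegral_sq_le (μ := cellMeasure d)
          ((hslice ω).const_sub (u x ω)).enorm.aemeasurable
        simpa using this
    _ = ∫⁻ ω, (∫⁻ y, (∫⁻ x, ‖u x ω - u y ω‖ₑ ^ 2 ∂(refMeasure d)) ∂(cellMeasure d)) ∂P := by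
        refine lintegral_congr fun ω => lintegral_lintegral_swap ?_
        exact ((((hslice ω).comp measurable_fst).sub
          ((hslice ω).comp measurable_snd)).enorm.pow_const 2).aemeasurable
    -- Substitute x = y + h and compare the density at y + h with that at h. The increment bound
    -- then leaves the second moment of the density.
    _ ≤ ∫⁻ ω, (∫⁻ y, (∫⁻ h, ENNReal.ofReal (refConst d) * (ENNReal.ofReal (refDensity h) *
          ‖u (y + h) ω - u y ω‖ₑ ^ 2)) ∂(cellMeasure d)) ∂P := by
        refine lintegral_mono fun ω => lintegral_mono_ae ?_
        filter_upwards [ae_mem_unitCell] with y hy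
        rw [lintegral_refMeasure, ← lintegral_add_left_eq_self _ y]
        refine lintegral_mono fun h => ?_
        rw [← mul_assoc, ← ENNReal.ofReal_mul (by unfold refConst; positivity), add_comm y h]
        gcongr
        exact refDensity_add_le h hy
    _ = ENNReal.ofReal (refConst d) * ∫⁻ q : Ω × Space d, (∫⁻ h, ENNReal.ofReal (refDensity h) *
          ‖u (q.2 + h) q.1 - u q.2 q.1‖ₑ ^ 2) ∂(P.prod (cellMeasure d)) := by
        rw [← lintegral_const_mul' _ _ (by simp)]
        simp_rw [← lintegral_const_mul' (ENNReal.ofReal (refConst d)) _ ENNReal.ofReal_ne_top]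
        rw [lintegral_prod _ (hincw.const_mul _).lintegral_prod_right'.aemeasurable]
    _ = ENNReal.ofReal (refConst d) * ∫⁻ h, (∫⁻ q : Ω × Space d, ENNReal.ofReal (refDensity h) *
          ‖u (q.2 + h) q.1 - u q.2 q.1‖ₑ ^ 2 ∂(P.prod (cellMeasure d))) := by
        rw [lintegral_lintegral_swap hincw.aemeasurable]
    _ ≤ ENNReal.ofReal (refConst d) * ∫⁻ h : Space d, ENNReal.ofReal (refDensity h) *
          (‖h‖ₑ ^ 2 * ∫⁻ p : Space d × Ω, ‖g p.1 p.2‖ₑ ^ 2 ∂((cellMeasure d).prod P)) := by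
        gcongr with h
        rw [lintegral_const_mul' _ _ (by simp)]
        gcongr
        refine le_trans (le_of_eq ?_) (hu.lintegral_increment_le h)
        rw [← lintegral_prod_swap]
        rfl
    _ = _ := by
        have hg2 := (memLp_two_iff hu.isStationaryL2_grad.measurable.aestronglyMeasurable).1
          hu.isStationaryL2_grad.memLp
        simp_rw [← mul_assoc]
        change _ * ∫⁻ h, _ * ∫⁻ p, ‖Function.uncurry g p‖ₑ ^ 2 ∂((cellMeasure d).prod P) = _
        rw [poincareConst, lintegral_mul_const' _ _ hg2.ne, ← mul_assoc]
        simp_rw [mul_comm (ENNReal.ofReal (refDensity _))]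
        rfl

end Poincare

end

/-! ### Limits and expectations of weak gradients -/

section

variable {d : ℕ} {Ω : Type*} [MeasurableSpace Ω] {P : Measure Ω} [IsProbabilityMeasure P]

section WeakGradientLimit

lemma tendsto_lintegral_enorm_sub {ι E : Type*} [NormedAddCommGroup E] {l : Filter ι}
    {U : ι → Space d → Ω → E} {u : Space d → Ω → E}
    (hU : ∀ n, StronglyMeasurable (Function.uncurry (U n)))
    (hu : StronglyMeasurable (Function.uncurry u))
    (h : Tendsto (fun n => eLpNorm (Function.uncurry (U n) - Function.uncurry u) 2
      ((refMeasure d).prod P)) l (𝓝 0)) :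
    Tendsto (fun n => ∫⁻ p : Space d × Ω, ‖u p.1 p.2 - U n p.1 p.2‖ₑ ∂((refMeasure d).prod P)) l
      (𝓝 0) := by
  have h2 := ENNReal.Tendsto.mul_const h (b := ((refMeasure d).prod P) Set.univ ^ (1 / 2 : ℝ))
    (Or.inr (ENNReal.rpow_lt_top_of_nonneg (by norm_num) (measure_ne_top _ _)).ne)
  rw [zero_mul] at h2
  refine tendsto_of_tendsto_of_tendsto_of_le_of_le tendsto_const_nhds h2 (fun _ => zero_le)
    fun n => ?_
  have h3 := eLpNorm_le_eLpNorm_mul_rpow_measure_univ (μ := (refMeasure d).prod P)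
    (p := 1) (q := 2) one_le_two ((hU n).sub hu).aestronglyMeasurable
  rw [eLpNorm_one_eq_lintegral_enorm] at h3
  norm_num at h3
  refine le_trans (le_of_eq (lintegral_congr fun p => ?_)) (h3.trans (le_of_eq (by norm_num)))
  rw [enorm_sub_rev]
  rfl

lemma ae_integral_mul_eq {u v : Space d → Ω → ℝ} {k m : Space d → ℝ}
    (hum : StronglyMeasurable (Function.uncurry u))
    (hu : Integrable (Function.uncurry u) ((refMeasure d).prod P))
    (hvm : StronglyMeasurable (Function.uncurry v))
    (hv : Integrable (Function.uncurry v) ((refMeasure d).prod P)) (hk : IsTest k)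
    (hm : IsTest m) :
    ∀ᵐ ω ∂P, Integrable (fun x => u x ω * k x) ∧ Integrable (fun x => v x ω * m x) := by
  filter_upwards [(integrable_mul_of_ref hum hu hk.continuous hk.compact).prod_left_ae,
    (integrable_mul_of_ref hvm hv hm.continuous hm.compact).prod_left_ae] with ω h1 h2
  exact ⟨h1, h2⟩

/-- For one test function, the defect in the weak gradient identity is linear in the pair
(potential, gradient) and continuous from the weighted L² space to L¹(P). It vanishes for the
approximants, hence for the limit. Countably many tests then give a common null set. -/
lemma ae_hasWeakGradient_of_tendsto {U : ℕ → Space d → Ω → ℝ} {u : Space d → Ω → ℝ}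
    {G : ℕ → Space d → Ω → Space d} {g : Space d → Ω → Space d}
    (hUm : ∀ n, StronglyMeasurable (Function.uncurry (U n)))
    (hum : StronglyMeasurable (Function.uncurry u))
    (hGm : ∀ n, StronglyMeasurable (Function.uncurry (G n)))
    (hgm : StronglyMeasurable (Function.uncurry g))
    (hU2 : ∀ n, MemLp (Function.uncurry (U n)) 2 ((refMeasure d).prod P))
    (hu2 : MemLp (Function.uncurry u) 2 ((refMeasure d).prod P))
    (hG2 : ∀ n, MemLp (Function.uncurry (G n)) 2 ((refMeasure d).prod P))
    (hg2 : MemLp (Function.uncurry g) 2 ((refMeasure d).prod P))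
    (hUu : Tendsto (fun n => eLpNorm (Function.uncurry (U n) - Function.uncurry u) 2
      ((refMeasure d).prod P)) atTop (𝓝 0))
    (hGg : Tendsto (fun n => eLpNorm (Function.uncurry (G n) - Function.uncurry g) 2
      ((refMeasure d).prod P)) atTop (𝓝 0))
    (hweak : ∀ n, ∀ᵐ ω ∂P, HasWeakGradient (fun x => U n x ω) fun x => G n x ω) :
    ∀ᵐ ω ∂P, HasWeakGradient (fun x => u x ω) fun x => g x ω := by
  have hui := hu2.integrable one_le_two
  have hgi := hg2.integrable one_le_two
  have hGjm : ∀ n j, StronglyMeasurable (Function.uncurry fun x ω => G n x ω j) := fun n j =>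
    (EuclideanSpace.proj (𝕜 := ℝ) j).continuous.comp_stronglyMeasurable (hGm n)
  have hgjm : ∀ j, StronglyMeasurable (Function.uncurry fun x ω => g x ω j) := fun j =>
    (EuclideanSpace.proj (𝕜 := ℝ) j).continuous.comp_stronglyMeasurable hgm
  have hGji : ∀ n j, Integrable (Function.uncurry fun x ω => G n x ω j) ((refMeasure d).prod P) :=
    fun n j => (EuclideanSpace.proj (𝕜 := ℝ) j).integrable_comp ((hG2 n).integrable one_le_two)
  have hgji : ∀ j, Integrable (Function.uncurry fun x ω => g x ω j) ((refMeasure d).prod P) :=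
    fun j => (EuclideanSpace.proj (𝕜 := ℝ) j).integrable_comp hgi
  have hL1 := tendsto_lintegral_enorm_sub hUm hum hUu
  have hL1g := tendsto_lintegral_enorm_sub hGm hgm hGg
  have key : ∀ φ, IsTest φ → ∀ j, ∀ᵐ ω ∂P,
      ∫ x, (u x ω * partialDeriv j φ x + g x ω j * φ x) = 0 := by
    intro φ hφ j
    have hφj := hφ.partialDeriv j
    obtain ⟨C1, hC1⟩ := exists_lintegral_mul_le_ref (P := P) hφj.continuous hφj.compact
    obtain ⟨C2, hC2⟩ := exists_lintegral_mul_le_ref (P := P) hφ.continuous hφ.compact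
    have hbound : ∀ n, ∫⁻ ω, ‖∫ x, (u x ω * partialDeriv j φ x + g x ω j * φ x)‖ₑ ∂P ≤
        ENNReal.ofReal C1 * ∫⁻ p : Space d × Ω, ‖u p.1 p.2 - U n p.1 p.2‖ₑ
          ∂((refMeasure d).prod P) +
        ENNReal.ofReal C2 * ∫⁻ p : Space d × Ω, ‖g p.1 p.2 - G n p.1 p.2‖ₑ
          ∂((refMeasure d).prod P) := by
      intro n
      have hdm : StronglyMeasurable (Function.uncurry fun x ω => u x ω - U n x ω) :=
        hum.sub (hUm n)
      have hdgm : StronglyMeasurable (Function.uncurry fun x ω => g x ω j - G n x ω j) :=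
        (hgjm j).sub (hGjm n j)
      have hm1 : Measurable fun p : Space d × Ω =>
          ‖(u p.1 p.2 - U n p.1 p.2) * partialDeriv j φ p.1‖ₑ :=
        (hdm.measurable.mul (hφj.continuous.measurable.comp measurable_fst)).enorm
      have hm2 : Measurable fun p : Space d × Ω => ‖(g p.1 p.2 j - G n p.1 p.2 j) * φ p.1‖ₑ :=
        (hdgm.measurable.mul (hφ.continuous.measurable.comp measurable_fst)).enorm
      calc ∫⁻ ω, ‖∫ x, (u x ω * partialDeriv j φ x + g x ω j * φ x)‖ₑ ∂P
          ≤ ∫⁻ ω, ((∫⁻ x, ‖(u x ω - U n x ω) * partialDeriv j φ x‖ₑ) +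
              ∫⁻ x, ‖(g x ω j - G n x ω j) * φ x‖ₑ) ∂P := by
            refine lintegral_mono_ae ?_
            filter_upwards [hweak n, ae_integral_mul_eq hum hui (hgjm j) (hgji j) hφj hφ,
              ae_integral_mul_eq (hUm n) ((hU2 n).integrable one_le_two) (hGjm n j) (hGji n j)
                hφj hφ] with ω h1 h2 h3
            have h4 : ∫ x, (U n x ω * partialDeriv j φ x + G n x ω j * φ x) = 0 := by
              rw [integral_add h3.1 h3.2]
              have := h1.integral_eq φ hφ.smooth hφ.compact j
              simp only [partialDeriv]
              rw [this]
              ring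
            have h5 : ∫ x, (u x ω * partialDeriv j φ x + g x ω j * φ x) =
                ∫ x, ((u x ω - U n x ω) * partialDeriv j φ x + (g x ω j - G n x ω j) * φ x) := by
              have i1 : Integrable fun x => u x ω * partialDeriv j φ x + g x ω j * φ x :=
                h2.1.add h2.2
              have i2 : Integrable fun x => U n x ω * partialDeriv j φ x + G n x ω j * φ x :=
                h3.1.add h3.2
              rw [← sub_zero (∫ x, (u x ω * partialDeriv j φ x + g x ω j * φ x)), ← h4,
                ← integral_sub i1 i2]
              refine integral_congr_ae (ae_of_all _ fun x => ?_)
              simp only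
              ring
            rw [h5]
            refine (enorm_integral_le_lintegral_enorm _).trans ?_
            have hm1ω : Measurable fun x => ‖(u x ω - U n x ω) * partialDeriv j φ x‖ₑ :=
              hm1.comp measurable_prodMk_right
            rw [← lintegral_add_left hm1ω]
            exact lintegral_mono fun x => enorm_add_le _ _
        _ = (∫⁻ p : Space d × Ω, ‖(u p.1 p.2 - U n p.1 p.2) * partialDeriv j φ p.1‖ₑ
              ∂((volume : Measure (Space d)).prod P)) +
            ∫⁻ p : Space d × Ω, ‖(g p.1 p.2 j - G n p.1 p.2 j) * φ p.1‖ₑ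
              ∂((volume : Measure (Space d)).prod P) := by
            rw [lintegral_add_left hm1.lintegral_prod_left',
              lintegral_prod_symm _ hm1.aemeasurable, lintegral_prod_symm _ hm2.aemeasurable]
        _ ≤ _ := by
            refine add_le_add (hC1 _ hdm) ((hC2 _ hdgm).trans ?_)
            gcongr with p
            simp only [← ofReal_norm]
            refine ENNReal.ofReal_le_ofReal ?_
            simpa using PiLp.norm_apply_le (g p.1 p.2 - G n p.1 p.2) j
    have hlim : Tendsto (fun n => ENNReal.ofReal C1 * ∫⁻ p : Space d × Ω,
          ‖u p.1 p.2 - U n p.1 p.2‖ₑ ∂((refMeasure d).prod P) +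
        ENNReal.ofReal C2 * ∫⁻ p : Space d × Ω, ‖g p.1 p.2 - G n p.1 p.2‖ₑ
          ∂((refMeasure d).prod P)) atTop (𝓝 0) := by
      have h1 := ENNReal.Tendsto.const_mul hL1 (a := ENNReal.ofReal C1)
        (Or.inr ENNReal.ofReal_ne_top)
      have h2 := ENNReal.Tendsto.const_mul hL1g (a := ENNReal.ofReal C2)
        (Or.inr ENNReal.ofReal_ne_top)
      simpa using h1.add h2
    have hz := le_antisymm (ge_of_tendsto' hlim hbound) zero_le
    have hmeas : Measurable fun ω => ‖∫ x, (u x ω * partialDeriv j φ x + g x ω j * φ x)‖ₑ := by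
      refine (StronglyMeasurable.integral_prod_left (μ := (volume : Measure (Space d)))
        (f := fun x ω => u x ω * partialDeriv j φ x + g x ω j * φ x) ?_).measurable.enorm
      exact (hum.mul (hφj.continuous.stronglyMeasurable.comp_measurable measurable_fst)).add
        ((hgjm j).mul (hφ.continuous.stronglyMeasurable.comp_measurable measurable_fst))
    rw [lintegral_eq_zero_iff hmeas] at hz
    filter_upwards [hz] with ω hω
    exact enorm_eq_zero.1 hω
  obtain ⟨D, hD1, hD2, hD3⟩ := exists_countable_tests d
  have hall : ∀ᵐ ω ∂P, ∀ φ ∈ D, ∀ j,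
      ∫ x, (u x ω * partialDeriv j φ x + g x ω j * φ x) = 0 :=
    (ae_ball_iff hD1).2 fun φ hφ => ae_all_iff.2 fun j => key φ (hD2 φ hφ) j
  filter_upwards [hall, Integrable.ae_locallyIntegrable hui, Integrable.ae_locallyIntegrable hgi]
    with ω h1 h2 h3
  refine ⟨h2, h3, fun φ hφ hφc j => ?_⟩
  have hφt : IsTest φ := ⟨hφ, hφc⟩
  have hφj := hφt.partialDeriv j
  have hvec : LocallyIntegrable fun x => u x ω • (basisVec j : Space d) := by
    intro x
    obtain ⟨s, hs, h⟩ := h2 x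
    exact ⟨s, hs, Integrable.smul_const h _⟩
  -- The weak derivative identity in direction j is a first-order distribution with zeroth-order
  -- part g_j and vector part u e_j.
  have h4 := hD3 (fun x => g x ω j) (fun x => u x ω • basisVec j) (LocallyIntegrable.apply h3 j)
    hvec (fun η hη => by
      refine Eq.trans (integral_congr_ae (ae_of_all _ fun x => ?_)) (h1 η hη j)
      simp only [map_smul, smul_eq_mul, partialDeriv]
      ring) φ hφt
  have i1 : Integrable fun x => g x ω j * φ x := by
    simpa [mul_comm] using (LocallyIntegrable.apply h3 j).integrable_smul_left_of_hasCompactSupport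
      hφt.continuous hφt.compact
  have i2 : Integrable fun x => u x ω * fderiv ℝ φ x (basisVec j) := by
    simpa [mul_comm, partialDeriv] using h2.integrable_smul_left_of_hasCompactSupport
      hφj.continuous hφj.compact
  have h5 : ∫ x, (g x ω j * φ x + u x ω * fderiv ℝ φ x (basisVec j)) = 0 := by
    simpa using h4
  rw [integral_add i1 i2] at h5
  linarith

end WeakGradientLimit

/-- Fubini against a test function exchanges expectation and weak derivative. Square integrability
for the finite reference measure supplies the required absolute integrability. -/
lemma hasWeakGradient_integral {u : Space d → Ω → ℝ} {g : Space d → Ω → Space d}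
    (hum : StronglyMeasurable (Function.uncurry u)) (hgm : StronglyMeasurable (Function.uncurry g))
    (hu2 : MemLp (Function.uncurry u) 2 ((refMeasure d).prod P))
    (hg2 : MemLp (Function.uncurry g) 2 ((refMeasure d).prod P))
    (hweak : ∀ᵐ ω ∂P, HasWeakGradient (fun x => u x ω) fun x => g x ω) :
    HasWeakGradient (fun x => ∫ ω, u x ω ∂P) fun x => ∫ ω, g x ω ∂P := by
  have hui := hu2.integrable one_le_two
  have hgi := hg2.integrable one_le_two
  refine ⟨LocallyIntegrable.of_refMeasure hui.integral_prod_left,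
    LocallyIntegrable.of_refMeasure hgi.integral_prod_left, fun φ hφ hφc j => ?_⟩
  have hφt : IsTest φ := ⟨hφ, hφc⟩
  have hφj := hφt.partialDeriv j
  have hgjm : StronglyMeasurable (Function.uncurry fun x ω => g x ω j) :=
    (EuclideanSpace.proj (𝕜 := ℝ) j).continuous.comp_stronglyMeasurable hgm
  have hgji : Integrable (Function.uncurry fun x ω => g x ω j) ((refMeasure d).prod P) :=
    (EuclideanSpace.proj (𝕜 := ℝ) j).integrable_comp hgi
  have i1 := integrable_mul_of_ref hum hui hφj.continuous hφj.compact
  have i2 := integrable_mul_of_ref hgjm hgji hφt.continuous hφt.compact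
  have hcomp : ∀ᵐ x : Space d, (∫ ω, g x ω ∂P) j = ∫ ω, g x ω j ∂P := by
    filter_upwards [absolutelyContinuous_refMeasure.ae_le hgi.prod_right_ae] with x hx
    exact ((EuclideanSpace.proj (𝕜 := ℝ) j).integral_comp_comm hx).symm
  calc ∫ x, (∫ ω, u x ω ∂P) * fderiv ℝ φ x (basisVec j)
      = ∫ x, (∫ ω, u x ω * partialDeriv j φ x ∂P) := by
        refine integral_congr_ae (ae_of_all _ fun x => ?_)
        exact (integral_mul_const _ _).symm
    _ = ∫ ω, (∫ x, u x ω * partialDeriv j φ x) ∂P := integral_integral_swap i1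
    _ = ∫ ω, (-∫ x, g x ω j * φ x) ∂P := by
        refine integral_congr_ae ?_
        filter_upwards [hweak] with ω hω
        exact hω.integral_eq φ hφ hφc j
    _ = -∫ x, (∫ ω, g x ω j * φ x ∂P) := by
        rw [integral_neg, ← integral_integral_swap i2]
    _ = _ := by
        congr 1
        refine integral_congr_ae ?_
        filter_upwards [hcomp] with x hx
        rw [hx]
        exact integral_mul_const _ _

end

/-! ### The space of stationary gradients -/

section

variable {d : ℕ} {Ω : Type*} [MeasurableSpace Ω] {P : Measure Ω}

/-- Square integrable vector fields on `Q × Ω`. -/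
abbrev FieldSpace (d : ℕ) {Ω : Type*} [MeasurableSpace Ω] (P : Measure Ω) :=
  Lp (Space d) 2 ((cellMeasure d).prod P)

section WeakGradientAlgebra

lemma HasWeakGradient.congr_grad {u : Space d → ℝ} {g h : Space d → Space d}
    (hu : HasWeakGradient u g) (hgh : g =ᵐ[volume] h) : HasWeakGradient u h where
  locallyIntegrable := hu.locallyIntegrable
  locallyIntegrable_grad := (locallyIntegrable_congr hgh).1 hu.locallyIntegrable_grad
  integral_eq := fun φ hφ hφc j => by
    rw [hu.integral_eq φ hφ hφc j]
    congr 1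
    refine integral_congr_ae ?_
    filter_upwards [hgh] with x hx
    rw [hx]

lemma HasWeakGradient.integrable_mul {u : Space d → ℝ} {g : Space d → Space d}
    (hu : HasWeakGradient u g) {φ : Space d → ℝ} (hφ : IsTest φ) (j : Fin d) :
    Integrable (fun x => u x * fderiv ℝ φ x (basisVec j)) ∧ Integrable fun x => g x j * φ x := by
  constructor
  · simpa [mul_comm, partialDeriv] using
      hu.locallyIntegrable.integrable_smul_left_of_hasCompactSupport
        (hφ.partialDeriv j).continuous (hφ.partialDeriv j).compact
  · simpa [mul_comm] using
      (LocallyIntegrable.apply hu.locallyIntegrable_grad j).integrable_smul_left_of_hasCompactSupport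
        hφ.continuous hφ.compact

lemma HasWeakGradient.sub {u v : Space d → ℝ} {g h : Space d → Space d}
    (hu : HasWeakGradient u g) (hv : HasWeakGradient v h) :
    HasWeakGradient (fun x => u x - v x) fun x => g x - h x where
  locallyIntegrable := hu.locallyIntegrable.sub hv.locallyIntegrable
  locallyIntegrable_grad := hu.locallyIntegrable_grad.sub hv.locallyIntegrable_grad
  integral_eq := fun φ hφ hφc j => by
    have h1 := hu.integrable_mul ⟨hφ, hφc⟩ j
    have h2 := hv.integrable_mul ⟨hφ, hφc⟩ j
    simp only [sub_mul, PiLp.sub_apply]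
    rw [integral_sub h1.1 h2.1, integral_sub h1.2 h2.2, hu.integral_eq φ hφ hφc j,
      hv.integral_eq φ hφ hφc j]
    ring

lemma HasWeakGradient.sub_const {u : Space d → ℝ} {g : Space d → Space d}
    (hu : HasWeakGradient u g) (c : ℝ) : HasWeakGradient (fun x => u x - c) g := by
  have h := hu.sub (hasWeakGradient_of_contDiff (u := fun _ => c) (g := fun _ => 0) contDiff_const
    fun x i => by simp)
  simpa using h

lemma isDivFree_const (c : Space d) : IsDivFree fun _ : Space d => c where
  locallyIntegrable := locallyIntegrable_const c
  integral_eq_zero := fun φ hφ hφc => by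
    have hφt : IsTest φ := ⟨hφ, hφc⟩
    simp only [clm_apply_eq_sum _ c]
    rw [integral_finsetSum (f := fun i x => c i * fderiv ℝ φ x (basisVec i)) _
      fun i _ => ((hφt.partialDeriv i).integrable.const_mul (c i))]
    refine Finset.sum_eq_zero fun i _ => ?_
    rw [integral_const_mul]
    exact mul_eq_zero_of_right _ (hφt.integral_partialDeriv i)

lemma IsDivFree.congr {σ τ : Space d → Space d} (h : IsDivFree σ) (hst : σ =ᵐ[volume] τ) :
    IsDivFree τ where
  locallyIntegrable := (locallyIntegrable_congr hst).1 h.locallyIntegrable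
  integral_eq_zero := fun φ hφ hφc => by
    rw [← h.integral_eq_zero φ hφ hφc]
    refine integral_congr_ae ?_
    filter_upwards [hst] with x hx
    rw [hx]

end WeakGradientAlgebra

variable [AddAction (Fin d → ℤ) Ω] [IsProbabilityMeasure P]

variable [MeasurableConstVAdd (Fin d → ℤ) Ω] [VAddInvariantMeasure (Fin d → ℤ) Ω P]

variable (P) in
/-- The span of the gradients of mollified stationary functions. -/
def smoothGradients : Submodule ℝ (FieldSpace d P) :=
  Submodule.span ℝ {f | ∃ (F : Space d → Ω → ℝ) (η : Space d → ℝ) (hF : IsStationaryL2 P F)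
    (hη : IsTest η), f = (hF.gradSmear hη).memLp.toLp _}

variable (P) in
/-- The closed subspace of the square integrable stationary gradients with zero mean. -/
def gradientSpace : Submodule ℝ (FieldSpace d P) := (smoothGradients P).topologicalClosure

lemma isClosed_gradientSpace : 
    IsClosed ((gradientSpace P : Submodule ℝ (FieldSpace d P)) : Set (FieldSpace d P)) :=
  Submodule.isClosed_topologicalClosure _

instance : CompleteSpace (gradientSpace (d := d) P) :=
  isClosed_gradientSpace.completeSpace_coe

lemma gradSmear_mem_gradientSpace {F : Space d → Ω → ℝ} {η : Space d → ℝ}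
    (hF : IsStationaryL2 P F) (hη : IsTest η) :
    (hF.gradSmear hη).memLp.toLp _ ∈ gradientSpace P :=
  Submodule.le_topologicalClosure _ (Submodule.subset_span ⟨F, η, hF, hη, rfl⟩)

lemma inner_eq_zero_of_gradSmear {f : FieldSpace d P}
    (hf : ∀ (F : Space d → Ω → ℝ) (η : Space d → ℝ) (hF : IsStationaryL2 P F) (hη : IsTest η),
      ⟪f, (hF.gradSmear hη).memLp.toLp _⟫ = 0) {h : FieldSpace d P} (hh : h ∈ gradientSpace P) :
    ⟪f, h⟫ = 0 := by
  have : gradientSpace P ≤ (ℝ ∙ f)ᗮ := by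
    refine Submodule.topologicalClosure_minimal _ (Submodule.span_le.2 ?_)
      (Submodule.isClosed_orthogonal _)
    rintro _ ⟨F, η, hF, hη, rfl⟩
    exact Submodule.mem_orthogonal_singleton_iff_inner_right.2 (hf F η hF hη)
  exact Submodule.mem_orthogonal_singleton_iff_inner_right.1 (this hh)

lemma inner_gradientSpace_eq_zero {σ : Space d → Ω → Space d} (hσ : IsStationaryL2 P σ)
    (hdiv : ∀ᵐ ω ∂P, IsDivFree fun x => σ x ω) {h : FieldSpace d P} (hh : h ∈ gradientSpace P) :
    ⟪hσ.memLp.toLp _, h⟫ = 0 := by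
  refine inner_eq_zero_of_gradSmear (fun F η hF hη => ?_) hh
  rw [inner_toLp]
  exact integral_inner_gradSmear_eq_zero hσ hdiv hF hη

lemma ae_isDivFree_of_inner_eq_zero {σ : Space d → Ω → Space d} (hσ : IsStationaryL2 P σ)
    (h : ∀ f ∈ gradientSpace P, ⟪hσ.memLp.toLp _, f⟫ = 0) :
    ∀ᵐ ω ∂P, IsDivFree fun x => σ x ω := by
  refine ae_isDivFree_of_orthogonal hσ fun F η hF hη => ?_
  have := h _ (gradSmear_mem_gradientSpace hF hη)
  rwa [inner_toLp] at this

/-- Constant fields are divergence free, hence orthogonal to all gradients; this says that the mean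
has zero inner product with every vector. -/
lemma integral_eq_zero_of_mem_gradientSpace {f : FieldSpace d P} (hf : f ∈ gradientSpace P) :
    ∫ p, f p ∂((cellMeasure d).prod P) = 0 := by
  refine ext_inner_left ℝ fun c => ?_
  have h1 := inner_gradientSpace_eq_zero (isStationaryL2_const (P := P) c)
    (ae_of_all _ fun _ => isDivFree_const c) hf
  have hfi : Integrable f ((cellMeasure d).prod P) := (Lp.memLp f).integrable one_le_two
  rw [L2.inner_def] at h1
  rw [← integral_inner hfi, inner_zero_right, ← h1]
  refine integral_congr_ae ?_
  filter_upwards [(isStationaryL2_const (P := P) c).memLp.coeFn_toLp] with p hp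
  rw [hp]
  rfl

lemma exists_isSmoothPotential {f : FieldSpace d P} (hf : f ∈ smoothGradients P) :
    ∃ (u : Space d → Ω → ℝ) (g : Space d → Ω → Space d), IsSmoothPotential P u g ∧
      Function.uncurry g =ᵐ[(cellMeasure d).prod P] f := by
  induction hf using Submodule.span_induction with
  | mem f hf =>
    obtain ⟨F, η, hF, hη, rfl⟩ := hf
    exact ⟨_, _, isSmoothPotential_smear hF hη, (MemLp.coeFn_toLp _).symm⟩
  | zero => exact ⟨_, _, isSmoothPotential_zero, (Lp.coeFn_zero _ _ _).symm⟩
  | add f f' _ _ h h' =>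
    obtain ⟨u, g, h1, h2⟩ := h
    obtain ⟨u', g', h1', h2'⟩ := h'
    refine ⟨_, _, h1.add h1', ?_⟩
    filter_upwards [h2, h2', Lp.coeFn_add f f'] with p hp hp' hp2
    rw [hp2, Pi.add_apply, ← hp, ← hp']
    rfl
  | smul c f _ h =>
    obtain ⟨u, g, h1, h2⟩ := h
    refine ⟨_, _, h1.const_smul c, ?_⟩
    filter_upwards [h2, Lp.coeFn_smul c f] with p hp hp2
    rw [hp2, Pi.smul_apply, ← hp]
    rfl

/-- Poincaré inequality for the difference of two potentials. -/
lemma eLpNorm_centered_sub_le {u v : Space d → Ω → ℝ} {g h : Space d → Ω → Space d}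
    (hu : IsSmoothPotential P u g) (hv : IsSmoothPotential P v h) :
    eLpNorm (Function.uncurry (centered u) - Function.uncurry (centered v)) 2
        ((refMeasure d).prod P) ≤
      poincareConst d ^ (1 / 2 : ℝ) *
        eLpNorm (Function.uncurry g - Function.uncurry h) 2 ((cellMeasure d).prod P) := by
  have hsq : ∀ a : ℝ≥0∞, (a ^ 2) ^ (1 / 2 : ℝ) = a := fun a => by
    rw [← ENNReal.rpow_natCast, ← ENNReal.rpow_mul]; norm_num
  -- The difference is again a smooth potential, and centering is linear.
  have hw := (hu.add (hv.const_smul (-1))).lintegral_centered_le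
  have hi : ∀ {u : Space d → Ω → ℝ} {g}, IsSmoothPotential P u g →
      ∀ᵐ ω ∂P, Integrable (fun x => u x ω) (cellMeasure d) := fun hu =>
    (hu.isStationaryL2.memLp.integrable one_le_two).prod_left_ae
  rw [← hsq (eLpNorm _ 2 ((refMeasure d).prod P)),
    ← hsq (eLpNorm _ 2 ((cellMeasure d).prod P)), ← ENNReal.mul_rpow_of_nonneg _ _ (by norm_num),
    eLpNorm_two_sq, eLpNorm_two_sq]
  refine ENNReal.rpow_le_rpow (le_trans (le_of_eq ?_) (hw.trans (le_of_eq ?_))) (by norm_num)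
  · refine lintegral_congr_ae ?_
    filter_upwards [Measure.quasiMeasurePreserving_snd.ae (hi hu),
      Measure.quasiMeasurePreserving_snd.ae (hi hv)] with p h1 h2
    congr 2
    simp only [Pi.sub_apply, Function.uncurry, centered, smul_eq_mul, neg_mul, one_mul]
    simp only [← sub_eq_add_neg]
    rw [integral_sub h1 h2]
    ring
  · congr 1
    refine lintegral_congr fun p => ?_
    congr 2
    simp [Function.uncurry, sub_eq_add_neg]

end

/-! ### Potentials of the gradient space -/

section

variable {d : ℕ} {Ω : Type*} [MeasurableSpace Ω] {P : Measure Ω} [IsProbabilityMeasure P]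
  [AddAction (Fin d → ℤ) Ω] [MeasurableConstVAdd (Fin d → ℤ) Ω]

section Invariant

variable [VAddInvariantMeasure (Fin d → ℤ) Ω P]

lemma IsSmoothPotential.ae_hasWeakGradient_centered {u : Space d → Ω → ℝ}
    {g : Space d → Ω → Space d} (hu : IsSmoothPotential P u g) :
    ∀ᵐ ω ∂P, HasWeakGradient (fun x => centered u x ω) fun x => g x ω := by
  filter_upwards [hu.smooth, hu.grad] with ω h1 h2
  exact (hasWeakGradient_of_contDiff h1 h2).sub_const _

lemma IsSmoothPotential.memLp_centered {u : Space d → Ω → ℝ} {g : Space d → Ω → Space d}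
    (hu : IsSmoothPotential P u g) :
    MemLp (Function.uncurry (centered u)) 2 ((refMeasure d).prod P) := by
  refine (memLp_two_iff
    (stronglyMeasurable_centered hu.isStationaryL2.measurable).aestronglyMeasurable).2 ?_
  refine hu.lintegral_centered_le.trans_lt (ENNReal.mul_lt_top poincareConst_ne_top.lt_top ?_)
  exact (memLp_two_iff hu.isStationaryL2_grad.measurable.aestronglyMeasurable).1
    hu.isStationaryL2_grad.memLp

lemma isStationaryGradient_of_mem {f : FieldSpace d P} (hf : f ∈ gradientSpace P)
    {u : Space d → Ω → ℝ} {g : Space d → Ω → Space d}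
    (hum : StronglyMeasurable (Function.uncurry u)) (hg : IsStationaryL2 P g)
    (hgf : Function.uncurry g =ᵐ[(cellMeasure d).prod P] f)
    (hug : ∀ᵐ ω ∂P, HasWeakGradient (fun x => u x ω) fun x => g x ω) :
    IsStationaryGradient P u g where
  measurable := hum.aestronglyMeasurable
  measurable_grad := hg.measurable.aestronglyMeasurable
  hasWeakGradient := hug
  stationary := hg.stationary
  memLp := hg.memLp
  mean_eq_zero := by
    have h := integral_prod_symm _ (hg.memLp.integrable one_le_two)
    rw [integral_congr_ae hgf, integral_eq_zero_of_mem_gradientSpace hf] at h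
    exact h.symm

/-- Every element of the gradient space is the gradient of a potential with an expectation. -/
lemma exists_potential {f : FieldSpace d P} (hf : f ∈ gradientSpace P) :
    ∃ (u : Space d → Ω → ℝ) (g : Space d → Ω → Space d), IsStationaryGradient P u g ∧
      IsStationaryL2 P g ∧ Function.uncurry g =ᵐ[(cellMeasure d).prod P] f ∧
      (∀ᵐ x : Space d, Integrable (u x) P) ∧
      HasWeakGradient (fun x => ∫ ω, u x ω ∂P) fun x => ∫ ω, g x ω ∂P := by
  obtain ⟨s, hs, hlim⟩ := mem_closure_iff_seq_limit.1 hf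
  choose U G hUG hGs using fun n => exists_isSmoothPotential (hs n)
  -- Only the gradients are known to converge. Subtracting the cell mean fixes the free constants,
  -- and the Poincaré inequality makes the centered potentials Cauchy in the weighted space.
  set v : ℕ → Lp ℝ 2 ((refMeasure d).prod P) := fun n => (hUG n).memLp_centered.toLp _ with hv
  set K := poincareConst d ^ (1 / 2 : ℝ) with hK
  have hK' : K ≠ ∞ := (ENNReal.rpow_lt_top_of_nonneg (by norm_num) poincareConst_ne_top).ne
  have hdist : ∀ m n, dist (v m) (v n) ≤ K.toReal * dist (s m) (s n) := by
    intro m n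
    rw [dist_edist, dist_edist, ← ENNReal.toReal_mul]
    refine ENNReal.toReal_mono (ENNReal.mul_ne_top hK' (edist_ne_top _ _)) ?_
    rw [hv, Lp.edist_toLp_toLp, Lp.edist_def, ← eLpNorm_congr_ae ((hGs m).sub (hGs n))]
    exact eLpNorm_centered_sub_le (hUG m) (hUG n)
  have hcauchy : CauchySeq v := by
    rw [cauchySeq_iff_tendsto_dist_atTop_0]
    have h1 := (cauchySeq_iff_tendsto_dist_atTop_0.1 hlim.cauchySeq).const_mul K.toReal
    rw [mul_zero] at h1
    exact squeeze_zero (fun _ => dist_nonneg) (fun p => hdist p.1 p.2) h1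
  obtain ⟨w, hw⟩ := cauchySeq_tendsto_of_complete hcauchy
  set u : Space d → Ω → ℝ := fun x ω => w (x, ω) with hu
  have hum : StronglyMeasurable (Function.uncurry u) := Lp.stronglyMeasurable w
  have hu2 : MemLp (Function.uncurry u) 2 ((refMeasure d).prod P) := Lp.memLp w
  obtain ⟨g, hg, hgf⟩ := exists_isStationaryL2_of_memLp (Lp.memLp f)
  have hUu : Tendsto (fun n => eLpNorm (Function.uncurry (centered (U n)) - Function.uncurry u) 2
      ((refMeasure d).prod P)) atTop (𝓝 0) := by
    have h1 := tendsto_iff_edist_tendsto_0.1 hw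
    refine h1.congr fun n => ?_
    rw [Lp.edist_def]
    refine eLpNorm_congr_ae ?_
    filter_upwards [(hUG n).memLp_centered.coeFn_toLp] with p hp
    rw [Pi.sub_apply, Pi.sub_apply, hp]
    rfl
  have hGg : Tendsto (fun n => eLpNorm (Function.uncurry (G n) - Function.uncurry g) 2
      ((refMeasure d).prod P)) atTop (𝓝 0) := by
    have h1 := ENNReal.Tendsto.const_mul (tendsto_iff_edist_tendsto_0.1 hlim)
      (a := refBound d ^ (1 / 2 : ℝ))
      (Or.inr (ENNReal.rpow_lt_top_of_nonneg (by norm_num) refBound_ne_top).ne)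
    rw [mul_zero] at h1
    refine tendsto_of_tendsto_of_tendsto_of_le_of_le tendsto_const_nhds h1 (fun _ => zero_le)
      fun n => ?_
    have h2 := (((hUG n).isStationaryL2_grad).add (hg.const_smul (-1)))
    have h3 := h2.stationary.eLpNorm_ref_le h2.measurable.aestronglyMeasurable
    have h4 : (Function.uncurry fun x ω => G n x ω + (-1 : ℝ) • g x ω) =
        Function.uncurry (G n) - Function.uncurry g := by
      ext1 p
      simp [Function.uncurry, sub_eq_add_neg]
    rw [h4] at h3
    simp only [Lp.edist_def]
    rwa [← eLpNorm_congr_ae ((hGs n).sub hgf)]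
  have hweak := ae_hasWeakGradient_of_tendsto
    (fun n => stronglyMeasurable_centered (hUG n).isStationaryL2.measurable) hum
    (fun n => (hUG n).isStationaryL2_grad.measurable) hg.measurable
    (fun n => (hUG n).memLp_centered) hu2 (fun n => (hUG n).isStationaryL2_grad.memLp_ref)
    hg.memLp_ref hUu hGg fun n => (hUG n).ae_hasWeakGradient_centered
  exact ⟨u, g, isStationaryGradient_of_mem hf hum hg hgf hweak, hg, hgf,
    absolutelyContinuous_refMeasure.ae_le (hu2.integrable one_le_two).prod_right_ae,
    hasWeakGradient_integral hum hg.measurable hu2 hg.memLp_ref hweak⟩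

lemma IsStationaryGradient.integral_eq_zero {u : Space d → Ω → ℝ} {g : Space d → Ω → Space d}
    (hu : IsStationaryGradient P u g) :
    ∫ p : Space d × Ω, g p.1 p.2 ∂((cellMeasure d).prod P) = 0 := by
  rw [← hu.mean_eq_zero]
  exact integral_prod_symm _ (hu.memLp.integrable one_le_two)

end Invariant

/-- Under ergodicity, every stationary gradient with zero mean belongs to the gradient space. -/
lemma IsStationaryGradient.mem_gradientSpace [ErgodicVAdd (Fin d → ℤ) Ω P]
    {u : Space d → Ω → ℝ} {g : Space d → Ω → Space d} (hu : IsStationaryGradient P u g) :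
    hu.memLp.toLp _ ∈ gradientSpace P := by
  obtain ⟨g', hg', hgg'⟩ := exists_isStationaryL2 hu.measurable_grad hu.stationary hu.memLp
  have hcell := (cell_prod_absolutelyContinuous (d := d) P).ae_le hgg'
  -- Decompose along V and its complement. The component in V has a potential u₁, so the other one
  -- is the gradient of u - u₁ and is orthogonal to V. By ergodicity it is constant, and its mean is
  -- zero.
  obtain ⟨y, hy, z, hz, hyz⟩ :=
    (gradientSpace (d := d) P).exists_add_mem_mem_orthogonal (hu.memLp.toLp _)
  obtain ⟨u₁, g₁, hu₁, hg₁, hgy, -, -⟩ := exists_potential hy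
  have hσ := hg'.add (hg₁.const_smul (-1))
  have hσz : Function.uncurry (fun x ω => g' x ω + (-1 : ℝ) • g₁ x ω) =ᵐ[(cellMeasure d).prod P]
      z := by
    have h1 := hu.memLp.coeFn_toLp
    rw [hyz] at h1
    filter_upwards [hcell, hgy, h1, Lp.coeFn_add y z] with p h2 h3 h4 h5
    rw [h5, Pi.add_apply] at h4
    simp only [Function.uncurry] at *
    rw [← h2, ← h4, h3]
    simp
  have hweak : ∀ᵐ ω ∂P, HasWeakGradient (fun x => u x ω - u₁ x ω)
      fun x => g' x ω + (-1 : ℝ) • g₁ x ω := by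
    filter_upwards [hu.hasWeakGradient, hu₁.hasWeakGradient,
      ae_ae_swap (p := fun x ω => g x ω = g' x ω) hgg'] with ω h1 h2 h3
    simpa [sub_eq_add_neg] using (h1.congr_grad h3).sub h2
  obtain ⟨c, hc⟩ := exists_const_of_orthogonal hσ hweak fun F η hF hη => by
    have h1 := Submodule.inner_left_of_mem_orthogonal (gradSmear_mem_gradientSpace hF hη) hz
    rw [L2.inner_def] at h1
    rw [← h1]
    refine integral_congr_ae ?_
    filter_upwards [hσz, (hF.gradSmear hη).memLp.coeFn_toLp] with p h2 h3
    rw [← h2, h3]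
    rfl
  have hc' := (cell_prod_absolutelyContinuous (d := d) P).ae_le hc
  have hmean : ∫ p : Space d × Ω, (g' p.1 p.2 + (-1 : ℝ) • g₁ p.1 p.2)
      ∂((cellMeasure d).prod P) = 0 := by
    have h1 : ∫ p : Space d × Ω, g' p.1 p.2 ∂((cellMeasure d).prod P) = 0 := by
      rw [← hu.integral_eq_zero]
      exact integral_congr_ae (EventuallyEq.symm hcell)
    have h2 := hu₁.integral_eq_zero
    have i1 : Integrable (fun p : Space d × Ω => g' p.1 p.2) ((cellMeasure d).prod P) :=
      hg'.memLp.integrable one_le_two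
    have i2 : Integrable (fun p : Space d × Ω => g₁ p.1 p.2) ((cellMeasure d).prod P) :=
      hg₁.memLp.integrable one_le_two
    simp only [neg_smul, one_smul, ← sub_eq_add_neg]
    rw [integral_sub i1 i2, h1, h2, sub_zero]
  have hc0 : c = 0 := by
    rw [integral_congr_ae hc'] at hmean
    simpa using hmean
  have hz0 : z = 0 := by
    refine (Lp.eq_zero_iff_ae_eq_zero).2 ?_
    filter_upwards [hc', hσz] with p h1 h2
    rw [← h2, Pi.zero_apply, ← hc0, ← h1]
    rfl
  rw [hyz, hz0, add_zero]
  exact hy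

/-! ### Gradients of periodic functions -/

section PeriodicGradient

variable {w : Space d → ℝ} {g : Space d → Space d}

lemma LocallyIntegrable.integrable_cell {E : Type*} [NormedAddCommGroup E] {f : Space d → E}
    (hf : LocallyIntegrable f) : Integrable f (cellMeasure d) :=
  (hf.integrableOn_isCompact (isCompact_closedBall (0 : Space d) d)).mono_set fun y hy => by
    simpa using norm_le_of_mem_unitCell hy

lemma LocallyIntegrable.comp_add_right {E : Type*} [NormedAddCommGroup E] {f : Space d → E}
    (hf : LocallyIntegrable f) (z : Space d) : LocallyIntegrable fun x => f (x + z) := by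
  have h := (locallyIntegrable_map_homeomorph (Homeomorph.addRight z) (f := f)
    (μ := (volume : Measure (Space d)))).1
  rw [(measurePreserving_add_right (volume : Measure (Space d)) z).map_eq.symm] at hf
  exact h hf

/-- Testing with a translated test function shows that the translated gradient is also a weak
gradient of the same function; weak gradients are unique almost everywhere. -/
lemma HasWeakGradient.periodic (hw : HasWeakGradient w g) (hp : Periodic w) : Periodic g := by
  intro k
  have key : ∀ j, ∀ᵐ x : Space d, g (x + latticePoint k) j = g x j := by
    intro j
    have hgj := LocallyIntegrable.apply hw.locallyIntegrable_grad j
    refine ae_eq_of_integral_contDiff_smul_eq (LocallyIntegrable.comp_add_right hgj _) hgj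
      fun φ hφ hφc => ?_
    have hφt : IsTest φ := ⟨hφ, hφc⟩
    have hφk : IsTest fun t => φ (t - latticePoint k) := by
      simpa using hφt.reflect.comp_sub_left (latticePoint k)
    have h1 := hw.integral_eq φ hφ hφc j
    have h2 := hw.integral_eq _ hφk.smooth hφk.compact j
    simp only [fderiv_comp_sub] at h2
    rw [← integral_add_right_eq_self _ (latticePoint k),
      ← integral_add_right_eq_self (fun x => g x j * _) (latticePoint k)] at h2
    simp only [add_sub_cancel_right] at h2
    have h3 : ∫ x, w (x + latticePoint k) * fderiv ℝ φ x (basisVec j) =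
        ∫ x, w x * fderiv ℝ φ x (basisVec j) := by
      refine integral_congr_ae ?_
      filter_upwards [hp k] with x hx
      rw [hx]
    rw [h3, h1, neg_inj] at h2
    simp only [smul_eq_mul, mul_comm (φ _)]
    exact h2.symm
  filter_upwards [ae_all_iff.2 key] with x hx
  ext j
  exact hx j

variable [VAddInvariantMeasure (Fin d → ℤ) Ω P]

lemma stationary_uncurry_fst_ae {E : Type*} [TopologicalSpace E] {f : Space d → E}
    (hf : AEStronglyMeasurable f volume) (hp : Periodic f) :
    Stationary P (fun x (_ : Ω) => hf.mk f x) := by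
  refine (hp.stationary (P := P)).congr ?_
  exact Measure.quasiMeasurePreserving_fst.ae hf.ae_eq_mk

/-- Mollifying with a kernel of unit mass does not change the cell mean of g. But g_j * η equals w *
∂_j η, whose mean is the mean of w times ∫ ∂_j η = 0. The periodic fields are treated as stationary
fields independent of ω. -/
lemma HasWeakGradient.integral_cell_eq_zero (hw : HasWeakGradient w g) (hp : Periodic w) :
    ∫ _ω, ∫ x, g x ∂(cellMeasure d) ∂P = 0 := by
  simp only [integral_const, probReal_univ, one_smul]
  obtain ⟨φ, -, -⟩ := exists_bump_sequence d
  set η := (φ 0).normed volume with hη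
  have hηt : IsTest η := ⟨(φ 0).contDiff_normed, (φ 0).hasCompactSupport_normed⟩
  have hη1 : ∫ x, η x = 1 := (φ 0).integral_normed
  have hgi := LocallyIntegrable.integrable_cell hw.locallyIntegrable_grad
  have hsm : ∀ {f : Space d → ℝ} (_ : LocallyIntegrable f) (_ : Periodic f) {ζ : Space d → ℝ}
      (_ : IsTest ζ), ∫ p : Space d × Ω, smear (fun x (_ : Ω) => f x) ζ p.1 p.2
        ∂((cellMeasure d).prod P) = (∫ x, f x ∂(cellMeasure d)) * ∫ x, ζ x := by
    intro f hf hfp ζ hζ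
    have hfm := hf.aestronglyMeasurable
    have hmk : hfm.mk f =ᵐ[cellMeasure d] f :=
      cellMeasure_absolutelyContinuous.ae_le hfm.ae_eq_mk.symm
    have hint : Integrable (fun p : Space d × Ω => hfm.mk f p.1) ((cellMeasure d).prod P) :=
      ((LocallyIntegrable.integrable_cell hf).congr hmk.symm).comp_fst P
    have h := integral_smear (P := P) (F := fun x (_ : Ω) => hfm.mk f x)
      (hfm.stronglyMeasurable_mk.measurable.comp measurable_fst)
      (stationary_uncurry_fst_ae hfm hfp) hint hζ
    rw [integral_fun_fst (μ := cellMeasure d) (ν := P) (f := hfm.mk f), integral_congr_ae hmk] at h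
    simp only [probReal_univ, one_smul] at h
    rw [← h]
    refine integral_congr_ae (ae_of_all _ fun p => integral_congr_ae ?_)
    filter_upwards [hfm.ae_eq_mk] with t ht
    rw [ht]
  ext j
  have hgj := LocallyIntegrable.apply hw.locallyIntegrable_grad j
  have hgp : Periodic fun x => g x j := fun k => by
    filter_upwards [hw.periodic hp k] with x hx
    rw [hx]
  have h1 := hsm hgj hgp hηt
  have h2 := hsm hw.locallyIntegrable hp (hηt.partialDeriv j)
  rw [hηt.integral_partialDeriv, mul_zero] at h2
  rw [hη1, mul_one] at h1
  have h3 : (∫ x, g x ∂(cellMeasure d)) j = ∫ x, g x j ∂(cellMeasure d) :=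
    ((EuclideanSpace.proj (𝕜 := ℝ) j).integral_comp_comm hgi).symm
  rw [h3, ← h1, PiLp.zero_apply, ← h2]
  refine integral_congr_ae (ae_of_all _ fun p => ?_)
  exact (hw.integral_partialDeriv hηt p.1 j).symm

/-- The gradient of a periodic function is a stationary gradient with zero mean. -/
lemma HasWeakGradient.isStationaryGradient (hw : HasWeakGradient w g) (hp : Periodic w)
    (h2 : MemLp g 2 (cellMeasure d)) :
    IsStationaryGradient P (fun x _ => w x) fun x _ => g x where
  measurable := hw.locallyIntegrable.aestronglyMeasurable.comp_fst
  measurable_grad := hw.locallyIntegrable_grad.aestronglyMeasurable.comp_fst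
  hasWeakGradient := ae_of_all _ fun _ => hw
  stationary := (hw.periodic hp).stationary
  memLp := h2.comp_fst P
  mean_eq_zero := hw.integral_cell_eq_zero hp


end PeriodicGradient

end

/-! ### Perturbation of coercive equations in a Hilbert space -/

section

section HilbertSpace

variable {H : Type*} [NormedAddCommGroup H] [InnerProductSpace ℝ H] [CompleteSpace H]
  {V : Submodule ℝ H} [CompleteSpace V] {T : H →L[ℝ] H} {α : ℝ}

/-- Lax-Milgram on a complete subspace. -/
lemma exists_mem_forall_inner_eq (hα : 0 < α) (hT : ∀ f ∈ V, α * ‖f‖ ^ 2 ≤ ⟪T f, f⟫) (ψ : H) :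
    ∃ h ∈ V, ∀ f ∈ V, ⟪T h, f⟫ = ⟪ψ, f⟫ := by
  set B : V →L[ℝ] V →L[ℝ] ℝ := LinearMap.mkContinuous₂
    (LinearMap.mk₂ ℝ (fun v w : V => (⟪T v, (w : H)⟫ : ℝ))
      (fun v v' w => by simp [inner_add_left]) (fun c v w => by simp [real_inner_smul_left])
      (fun v w w' => by simp [inner_add_right]) fun c v w => by simp [real_inner_smul_right])
    ‖T‖ (fun v w => (norm_inner_le_norm _ _).trans (by
      gcongr
      · exact T.le_opNorm _
      · rfl)) with hB
  have hBapp : ∀ v w : V, B v w = ⟪T v, (w : H)⟫ := fun v w => rfl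
  have hcoer : IsCoercive B := ⟨α, hα, fun u => by
    rw [hBapp, mul_assoc, ← pow_two]
    exact hT u u.2⟩
  -- The projection of ψ onto V represents the functional f ↦ ⟪ψ, f⟫ on V.
  set h := hcoer.continuousLinearEquivOfBilin.symm (V.orthogonalProjectionOnto ψ) with hh
  refine ⟨h, h.2, fun f hf => ?_⟩
  have h1 := hcoer.continuousLinearEquivOfBilin_apply h ⟨f, hf⟩
  rw [hh, ContinuousLinearEquiv.apply_symm_apply, ← hh, hBapp] at h1
  rw [← h1]
  simp

/-- The dual problem tests a sequence of the subspace against an arbitrary vector. -/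
lemma exists_mem_forall_inner_eq_adjoint (hα : 0 < α)
    (hT : ∀ f ∈ V, α * ‖f‖ ^ 2 ≤ ⟪T f, f⟫) (ψ : H) :
    ∃ h ∈ V, ∀ f ∈ V, ⟪f, ψ⟫ = ⟪T f, h⟫ := by
  obtain ⟨h, hV, hh⟩ := exists_mem_forall_inner_eq (T := ContinuousLinearMap.adjoint T) hα
    (fun f hf => by
      rw [ContinuousLinearMap.adjoint_inner_left, real_inner_comm]; exact hT f hf) ψ
  refine ⟨h, hV, fun f hf => ?_⟩
  rw [real_inner_comm, ← hh f hf, ContinuousLinearMap.adjoint_inner_left, real_inner_comm]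

/-- First order expansion of the solutions of perturbed coercive equations. -/
lemma perturbation_expansion (hα : 0 < α) (hT : ∀ f ∈ V, α * ‖f‖ ^ 2 ≤ ⟪T f, f⟫)
    {S : ℕ → H →L[ℝ] H} (hS : ∀ n, ∀ f ∈ V, α * ‖f‖ ^ 2 ≤ ⟪T f + S n f, f⟫)
    {m : ℕ → ℝ} (hm : ∀ n, 0 ≤ m n) {z F : ℕ → H} {F₀ v : H} {c : ℝ}
    (hz : ∀ n, z n ∈ V) (hzF : ∀ n, ∀ h ∈ V, ⟪T (z n) + S n (z n), h⟫ = -⟪F n, h⟫)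
    (hF : ∀ n, ‖F n‖ ≤ c * m n)
    (hF₀ : ∀ h, Tendsto (fun n => ⟪(m n)⁻¹ • F n, h⟫) atTop (𝓝 ⟪F₀, h⟫))
    (hSlim : ∀ h, ∃ ε : ℕ → ℝ, Tendsto ε atTop (𝓝 0) ∧ ∀ n f, |⟪S n f, h⟫| ≤ ε n * ‖f‖)
    (hv : v ∈ V) (hvF : ∀ h ∈ V, ⟪T v, h⟫ = -⟪F₀, h⟫) (ψ : H) :
    ((fun n => ⟪z n - m n • v, ψ⟫) =o[atTop] m) ∧
      (fun n => ⟪T (z n) + S n (z n) + F n - m n • (T v + F₀), ψ⟫) =o[atTop] m := by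
  set y : ℕ → H := fun n => (m n)⁻¹ • z n with hy
  have hyV : ∀ n, y n ∈ V := fun n => V.smul_mem _ (hz n)
  -- Energy estimate: test the equation with z n itself and use coercivity of T + S n.
  have hzb : ∀ n, α * ‖z n‖ ≤ c * m n := by
    intro n
    by_cases h0 : ‖z n‖ = 0
    · rw [h0, mul_zero]
      exact (norm_nonneg _).trans (hF n)
    · have h1 := hS n _ (hz n)
      rw [hzF n _ (hz n)] at h1
      have h2 : -⟪F n, z n⟫ ≤ ‖F n‖ * ‖z n‖ :=
        (neg_le_abs _).trans (abs_real_inner_le_norm _ _)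
      have h3 : 0 < ‖z n‖ := lt_of_le_of_ne (norm_nonneg _) (Ne.symm h0)
      refine le_trans ?_ (hF n)
      have h4 := h1.trans h2
      rw [pow_two, ← mul_assoc] at h4
      exact le_of_mul_le_mul_right h4 h3
  -- When m n = 0 the energy estimate forces z n = 0, so the convention 0⁻¹ = 0 is harmless.
  have hzm : ∀ n, z n = m n • y n := by
    intro n
    by_cases h0 : m n = 0
    · have := hzb n
      rw [h0, mul_zero] at this
      have h2 : ‖z n‖ = 0 := le_antisymm (nonpos_of_mul_nonpos_right this hα) (norm_nonneg _)
      rw [norm_eq_zero.1 h2, h0, zero_smul]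
    · rw [hy, smul_inv_smul₀ h0]
  have hFm : ∀ n, F n = m n • ((m n)⁻¹ • F n) := by
    intro n
    by_cases h0 : m n = 0
    · have := hF n
      rw [h0, mul_zero] at this
      rw [norm_le_zero_iff.1 this, smul_zero, smul_zero]
    · rw [smul_inv_smul₀ h0]
  have hc : 0 ≤ |c| / α := by positivity
  have hyb : ∀ n, ‖y n‖ ≤ |c| / α := by
    intro n
    rcases (hm n).eq_or_lt with h0 | h0
    · rw [hy]
      simpa [← h0] using hc
    · rw [hy, norm_smul, norm_inv, Real.norm_of_nonneg h0.le, le_div_iff₀ hα,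
        mul_assoc, inv_mul_le_iff₀ h0, mul_comm _ α, mul_comm (m n)]
      exact (hzb n).trans (by gcongr; exact le_abs_self c)
  -- The bound on ⟪S n f, h⟫ is uniform on bounded sets of f, which is what the varying, bounded
  -- sequence y n needs.
  have hSy : ∀ h, Tendsto (fun n => ⟪S n (y n), h⟫) atTop (𝓝 0) := by
    intro h
    obtain ⟨ε, hε, hb⟩ := hSlim h
    refine squeeze_zero_norm (a := fun n => |ε n| * (|c| / α)) (fun n => ?_) ?_
    · refine (hb n _).trans ?_
      exact mul_le_mul (le_abs_self _) (hyb n) (norm_nonneg _) (abs_nonneg _)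
    · simpa using hε.abs.mul_const (|c| / α)
  -- Subtract the limit equation from the equation of z n divided by m n.
  have hTy : ∀ h ∈ V, Tendsto (fun n => ⟪T (y n - v), h⟫) atTop (𝓝 0) := by
    intro h hh
    have h1 : ∀ n, ⟪T (y n - v), h⟫ = -⟪(m n)⁻¹ • F n, h⟫ - ⟪S n (y n), h⟫ + ⟪F₀, h⟫ := by
      intro n
      have h2 := congrArg (fun t => (m n)⁻¹ * t) (hzF n h hh)
      simp only [inner_add_left, mul_add] at h2
      rw [map_sub, inner_sub_left, hvF h hh, hy]
      simp only [map_smul, real_inner_smul_left]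
      linarith
    simp only [h1]
    simpa using ((hF₀ h).neg.sub (hSy h)).add_const ⟪F₀, h⟫
  -- Since y n - v lies in V, the adjoint solution h in V satisfies ⟪y n - v, ψ⟫ = ⟪T (y n - v), h⟫
  -- for arbitrary ψ.
  have hyψ : ∀ ψ, Tendsto (fun n => ⟪y n - v, ψ⟫) atTop (𝓝 0) := by
    intro ψ
    obtain ⟨h, hh, hψ⟩ := exists_mem_forall_inner_eq_adjoint hα hT ψ
    exact (hTy h hh).congr fun n => (hψ _ (V.sub_mem (hyV n) hv)).symm
  have hlo : ∀ {a : ℕ → ℝ}, Tendsto a atTop (𝓝 0) → (fun n => m n * a n) =o[atTop] m := by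
    intro a ha
    simpa using (isBigO_refl m atTop).mul_isLittleO ((isLittleO_one_iff ℝ).2 ha)
  refine ⟨(hlo (hyψ ψ)).congr_left fun n => ?_, ?_⟩
  · rw [← real_inner_smul_left, smul_sub, ← hzm]
  · have h1 : Tendsto (fun n => ⟪T (y n - v), ψ⟫ + ⟪S n (y n), ψ⟫ +
        (⟪(m n)⁻¹ • F n, ψ⟫ - ⟪F₀, ψ⟫)) atTop (𝓝 0) := by
      -- Weak convergence against all vectors, not only those of V, is needed here: the test vector
      -- is the adjoint image of ψ.
      have h2 := hyψ (ContinuousLinearMap.adjoint T ψ)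
      simp only [ContinuousLinearMap.adjoint_inner_right] at h2
      simpa using (h2.add (hSy ψ)).add ((hF₀ ψ).sub_const ⟪F₀, ψ⟫)
    refine (hlo h1).congr_left fun n => ?_
    rw [← inner_sub_left, ← inner_add_left, ← inner_add_left, ← real_inner_smul_left]
    congr 1
    have e1 : m n • S n (y n) = S n (z n) :=
      (map_smul (S n) (m n) (y n)).symm.trans (congrArg (S n) (hzm n).symm)
    have e2 : m n • T (y n) = T (z n) :=
      (map_smul T (m n) (y n)).symm.trans (congrArg T (hzm n).symm)
    rw [smul_add, smul_add, smul_sub, ← hFm, map_sub, smul_sub, smul_add, e1, e2]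
    abel

end HilbertSpace

end

/-! ### Multiplication by tensor fields -/

section

variable {d : ℕ}

section Tensors

variable {X : Type*} [MeasurableSpace X] {μ : Measure X}

lemma app_add_smul (M N : Tensor d) (s : ℝ) (ξ : Space d) :
    app (M + s • N) ξ = app M ξ + s • app N ξ := by
  simp [app]

lemma continuous_app (M : Tensor d) : Continuous (app M) :=
  (Matrix.toEuclideanLin M).continuous_of_finiteDimensional

lemma aestronglyMeasurable_app {K : X → Tensor d}
    (hK : ∀ j i, AEStronglyMeasurable (fun x => K x j i) μ) {f : X → Space d}
    (hf : AEStronglyMeasurable f μ) : AEStronglyMeasurable (fun x => app (K x) (f x)) μ := by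
  have h : AEMeasurable (fun x j => ∑ i, K x j i * f x i) μ := by
    refine aemeasurable_pi_iff.2 fun j => Finset.aemeasurable_fun_sum _ fun i _ => ?_
    exact (hK j i).aemeasurable.mul
      ((EuclideanSpace.proj (𝕜 := ℝ) i).continuous.comp_aestronglyMeasurable hf).aemeasurable
  exact (PiLp.continuous_toLp 2 _).comp_aestronglyMeasurable h.aestronglyMeasurable

lemma memLp_app {K : X → Tensor d} (hK : ∀ j i, AEStronglyMeasurable (fun x => K x j i) μ)
    {B : ℝ} (hB : ∀ᵐ x ∂μ, ∀ ξ, ‖app (K x) ξ‖ ≤ B * ‖ξ‖) {f : X → Space d} (hf : MemLp f 2 μ) :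
    MemLp (fun x => app (K x) (f x)) 2 μ :=
  hf.of_le_mul (aestronglyMeasurable_app hK hf.1) (hB.mono fun _ h => h _)

/-- Multiplication by a bounded tensor field is a bounded operator. -/
lemma exists_mulOperator {K : X → Tensor d}
    (hK : ∀ j i, AEStronglyMeasurable (fun x => K x j i) μ)
    {B : ℝ} (hB : ∀ᵐ x ∂μ, ∀ ξ, ‖app (K x) ξ‖ ≤ B * ‖ξ‖) :
    ∃ T : Lp (Space d) 2 μ →L[ℝ] Lp (Space d) 2 μ,
      ∀ f, T f =ᵐ[μ] fun x => app (K x) (f x) := by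
  refine ⟨LinearMap.mkContinuous
    { toFun := fun f => (memLp_app hK hB (Lp.memLp f)).toLp _
      map_add' := fun f g => ?_
      map_smul' := fun c f => ?_ } B fun f => ?_, fun f => (memLp_app hK hB (Lp.memLp f)).coeFn_toLp⟩
  · rw [← MemLp.toLp_add, MemLp.toLp_eq_toLp_iff]
    filter_upwards [Lp.coeFn_add f g] with x hx
    rw [hx]
    exact map_add (Matrix.toEuclideanLin (K x)) _ _
  · rw [RingHom.id_apply, ← MemLp.toLp_const_smul, MemLp.toLp_eq_toLp_iff]
    filter_upwards [Lp.coeFn_smul c f] with x hx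
    rw [hx]
    exact map_smul (Matrix.toEuclideanLin (K x)) _ _
  · refine Lp.norm_le_mul_norm_of_ae_le_mul ?_
    filter_upwards [hB, (memLp_app hK hB (Lp.memLp f)).coeFn_toLp] with x h1 h2
    change ‖(memLp_app hK hB (Lp.memLp f)).toLp _ x‖ ≤ _
    rw [h2]
    exact h1 _

/-- Uniformly elliptic and bounded families of tensors: the exceptional set can be chosen
independently of the vector. -/
lemma ae_forall_of_forall_ae {A C : Space d → Tensor d} {M α β : ℝ}
    (h_coer : ∀ ξ : Space d, ∀ᵐ x : Space d, ∀ s ∈ Set.Icc (-M) M,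
      α * ‖ξ‖ ^ 2 ≤ ⟪app (A x) ξ, ξ⟫ ∧ α * ‖ξ‖ ^ 2 ≤ ⟪app (A x + s • C x) ξ, ξ⟫)
    (h_bdd : ∀ ξ : Space d, ∀ᵐ x : Space d, ∀ s ∈ Set.Icc (-M) M,
      ‖app (A x) ξ‖ ≤ β * ‖ξ‖ ∧ ‖app (A x + s • C x) ξ‖ ≤ β * ‖ξ‖) :
    ∀ᵐ x : Space d, ∀ s ∈ Set.Icc (-M) M, ∀ ξ : Space d,
      α * ‖ξ‖ ^ 2 ≤ ⟪app (A x) ξ, ξ⟫ ∧ α * ‖ξ‖ ^ 2 ≤ ⟪app (A x + s • C x) ξ, ξ⟫ ∧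
      ‖app (A x) ξ‖ ≤ β * ‖ξ‖ ∧ ‖app (A x + s • C x) ξ‖ ≤ β * ‖ξ‖ := by
  -- Countably many vectors give a common null set, and the inequalities are closed conditions in
  -- the vector.
  obtain ⟨D, hDc, hDd⟩ := TopologicalSpace.exists_countable_dense (Space d)
  filter_upwards [(ae_ball_iff hDc).2 fun ξ _ => h_coer ξ,
    (ae_ball_iff hDc).2 fun ξ _ => h_bdd ξ] with x h1 h2 s hs ξ
  have e1 := continuous_app (A x)
  have e2 := continuous_app (A x + s • C x)
  have c1 : Continuous fun ξ : Space d => α * ‖ξ‖ ^ 2 := by fun_prop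
  have c2 : Continuous fun ξ : Space d => β * ‖ξ‖ := by fun_prop
  have hcl : IsClosed {ξ : Space d | α * ‖ξ‖ ^ 2 ≤ ⟪app (A x) ξ, ξ⟫ ∧
      α * ‖ξ‖ ^ 2 ≤ ⟪app (A x + s • C x) ξ, ξ⟫ ∧
      ‖app (A x) ξ‖ ≤ β * ‖ξ‖ ∧ ‖app (A x + s • C x) ξ‖ ≤ β * ‖ξ‖} :=
    (isClosed_le c1 (e1.inner continuous_id)).inter ((isClosed_le c1 (e2.inner continuous_id)).inter
      ((isClosed_le e1.norm c2).inter (isClosed_le e2.norm c2)))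
  have := hcl.closure_subset_iff.2 (fun η (hη : η ∈ D) =>
    ⟨(h1 η hη s hs).1, (h1 η hη s hs).2, (h2 η hη s hs).1, (h2 η hη s hs).2⟩)
  exact this (hDd ξ)

/-- M C is the difference of the two bounded tensors A + M C and A. -/
lemma norm_app_le_of_bounded {A C : Tensor d} {M β : ℝ} (hM : 0 < M) {ξ : Space d}
    (h1 : ‖app A ξ‖ ≤ β * ‖ξ‖) (h2 : ‖app (A + M • C) ξ‖ ≤ β * ‖ξ‖) :
    ‖app C ξ‖ ≤ 2 * β / M * ‖ξ‖ := by
  rw [app_add_smul] at h2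
  have h3 : ‖M • app C ξ‖ ≤ 2 * β * ‖ξ‖ := by
    calc ‖M • app C ξ‖ = ‖(app A ξ + M • app C ξ) - app A ξ‖ := by rw [add_sub_cancel_left]
      _ ≤ β * ‖ξ‖ + β * ‖ξ‖ := (norm_sub_le _ _).trans (add_le_add h2 h1)
      _ = _ := by ring
  rw [norm_smul, Real.norm_of_nonneg hM.le] at h3
  rw [div_mul_eq_mul_div, le_div_iff₀ hM, mul_comm]
  exact h3

end Tensors

/-! ### The norm of L^∞(Q; L²(Ω)) -/

section MixedNorm

variable {Ω : Type*} [MeasurableSpace Ω] {P : Measure Ω} [IsProbabilityMeasure P]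

/-- The weight depends on x only, so it leaves the expectation and the essential supremum in x
applies. This is what makes b times a deterministic square integrable field of size `mixedNorm P b`.
-/
lemma lintegral_sq_mul_le_mixedNorm {f : Space d → Ω → ℝ}
    (hf : AEStronglyMeasurable (Function.uncurry f) ((cellMeasure d).prod P))
    {G : Space d → ℝ≥0∞} (hG : AEMeasurable G (cellMeasure d)) :
    ∫⁻ p : Space d × Ω, ‖f p.1 p.2‖ₑ ^ 2 * G p.1 ∂((cellMeasure d).prod P) ≤
      mixedNorm P f ^ 2 * ∫⁻ x, G x ∂(cellMeasure d) := by
  have hm : AEMeasurable (fun p : Space d × Ω => ‖f p.1 p.2‖ₑ ^ 2 * G p.1)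
      ((cellMeasure d).prod P) := (hf.enorm.pow_const 2).mul hG.comp_fst
  rw [lintegral_prod _ hm, ← lintegral_const_mul'' _ hG]
  refine lintegral_mono_ae ?_
  filter_upwards [hf.prodMk_left, ENNReal.ae_le_essSup fun x => eLpNorm (f x) 2 P]
    with x h1 h2
  rw [lintegral_mul_const'' (f := fun ω => ‖f x ω‖ₑ ^ 2) _ (h1.enorm.pow_const 2)]
  gcongr
  rw [← eLpNorm_two_sq]
  exact pow_le_pow_left₀ zero_le h2 2

lemma memLp_smul_of_mixedNorm {f : Space d → Ω → ℝ}
    (hf : AEStronglyMeasurable (Function.uncurry f) ((cellMeasure d).prod P))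
    (hfin : mixedNorm P f < ∞) {E : Type*} [NormedAddCommGroup E] [NormedSpace ℝ E]
    {G : Space d → E} (hG : MemLp G 2 (cellMeasure d)) :
    MemLp (fun p : Space d × Ω => f p.1 p.2 • G p.1) 2 ((cellMeasure d).prod P) := by
  have hm : AEStronglyMeasurable (fun p : Space d × Ω => f p.1 p.2 • G p.1)
      ((cellMeasure d).prod P) := hf.smul hG.1.comp_fst
  refine (memLp_two_iff hm).2 ?_
  simp only [enorm_smul, mul_pow]
  refine (lintegral_sq_mul_le_mixedNorm hf (hG.1.enorm.pow_const 2)).trans_lt ?_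
  exact ENNReal.mul_lt_top (ENNReal.pow_lt_top hfin) ((memLp_two_iff hG.1).1 hG)

lemma eLpNorm_smul_le_mixedNorm {f : Space d → Ω → ℝ}
    (hf : AEStronglyMeasurable (Function.uncurry f) ((cellMeasure d).prod P))
    {E : Type*} [NormedAddCommGroup E] [NormedSpace ℝ E]
    {G : Space d → E} (hG : MemLp G 2 (cellMeasure d)) :
    eLpNorm (fun p : Space d × Ω => f p.1 p.2 • G p.1) 2 ((cellMeasure d).prod P) ≤
      mixedNorm P f * eLpNorm G 2 (cellMeasure d) := by
  rw [← ENNReal.pow_le_pow_left_iff two_ne_zero, mul_pow, eLpNorm_two_sq, eLpNorm_two_sq]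
  simp only [enorm_smul, mul_pow]
  exact lintegral_sq_mul_le_mixedNorm hf (hG.1.enorm.pow_const 2)

lemma mixedNorm_le_of_ae_le {f : Space d → Ω → ℝ} {M : ℝ}
    (h : ∀ᵐ p : Space d × Ω ∂((cellMeasure d).prod P), |f p.1 p.2| ≤ M) :
    mixedNorm P f ≤ ENNReal.ofReal M := by
  refine essSup_le_of_ae_le _ ?_
  filter_upwards [Measure.ae_ae_of_ae_prod h] with x hx
  refine (eLpNorm_le_of_ae_bound (C := M) hx).trans ?_
  simp

/-- Bounded functions that converge to zero in the mixed norm converge to zero in `L²` with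
respect to every finite weight. -/
lemma tendsto_lintegral_sq_mul {f : ℕ → Space d → Ω → ℝ} {M : ℝ}
    (hf : ∀ n, AEStronglyMeasurable (Function.uncurry (f n)) ((cellMeasure d).prod P))
    (hM : ∀ n, ∀ᵐ p : Space d × Ω ∂((cellMeasure d).prod P), |f n p.1 p.2| ≤ M)
    (hlim : Tendsto (fun n => mixedNorm P (f n)) atTop (𝓝 0)) {G : Space d × Ω → ℝ≥0∞}
    (hG : AEMeasurable G ((cellMeasure d).prod P))
    (hGfin : ∫⁻ p, G p ∂((cellMeasure d).prod P) ≠ ∞) :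
    Tendsto (fun n => ∫⁻ p : Space d × Ω, ‖f n p.1 p.2‖ₑ ^ 2 * G p ∂((cellMeasure d).prod P))
      atTop (𝓝 0) := by
  set μ := (cellMeasure d).prod P with hμ
  have hL2 : Tendsto (fun n => eLpNorm (Function.uncurry (f n) - 0) 2 μ) atTop (𝓝 0) := by
    refine tendsto_of_tendsto_of_tendsto_of_le_of_le tendsto_const_nhds hlim (fun _ => zero_le)
      fun n => ?_
    have h := eLpNorm_smul_le_mixedNorm (hf n) (memLp_const (1 : ℝ))
    simp only [smul_eq_mul, mul_one] at h
    rw [sub_zero]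
    refine h.trans (le_of_eq ?_)
    rw [eLpNorm_const _ two_ne_zero (NeZero.ne _)]
    simp
  have hmeas : TendstoInMeasure μ (fun n => Function.uncurry (f n)) atTop 0 :=
    tendstoInMeasure_of_tendsto_eLpNorm two_ne_zero hf aestronglyMeasurable_zero hL2
  -- Every subsequence has a further one converging almost everywhere, and M² G dominates.
  refine tendsto_of_subseq_tendsto fun ns hns => ?_
  obtain ⟨ms, -, hms⟩ := (hmeas.comp hns).exists_seq_tendsto_ae
  refine ⟨ms, ?_⟩
  have hdct := tendsto_lintegral_of_dominated_convergence' (μ := μ)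
    (F := fun n p => ‖f (ns (ms n)) p.1 p.2‖ₑ ^ 2 * G p) (f := fun _ => 0)
    (fun p => ENNReal.ofReal M ^ 2 * G p) (fun n => ((hf _).enorm.pow_const 2).mul hG)
    (fun n => by
      filter_upwards [hM (ns (ms n))] with p hp
      gcongr
      rw [← ofReal_norm]
      exact ENNReal.ofReal_le_ofReal hp)
    (by rw [lintegral_const_mul' _ _ (by simp)]; exact ENNReal.mul_ne_top (by simp) hGfin)
    (by
      filter_upwards [hms, ae_lt_top' hG hGfin] with p hp hpG
      have h1 : Tendsto (fun n => ‖f (ns (ms n)) p.1 p.2‖ₑ ^ 2) atTop (𝓝 0) := by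
        have := ((ENNReal.continuous_pow 2).tendsto _).comp hp.enorm
        simpa [Function.comp_def, Function.uncurry] using this
      simpa using ENNReal.Tendsto.mul_const h1 (Or.inr hpG.ne))
  simpa using hdct

/-- The pairing of a deterministic field in L²(Q) with a field in L²(Q × Ω) belongs to L¹(Q; L²(Ω)),
so it is an admissible test function for weak-* convergence. -/
lemma TendstoWeakStar.tendsto_inner {f : ℕ → Space d → Ω → ℝ} {f₀ : Space d → Ω → ℝ}
    (hf : TendstoWeakStar P f f₀) {G : Space d → Space d} (hG : MemLp G 2 (cellMeasure d))
    {h : Space d × Ω → Space d} (hh : MemLp h 2 ((cellMeasure d).prod P)) :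
    Tendsto (fun n => ∫ p : Space d × Ω, ⟪f n p.1 p.2 • G p.1, h p⟫ ∂((cellMeasure d).prod P))
      atTop (𝓝 (∫ p : Space d × Ω, ⟪f₀ p.1 p.2 • G p.1, h p⟫ ∂((cellMeasure d).prod P))) := by
  simp only [real_inner_smul_left]
  refine hf (fun x ω => ⟪G x, h (x, ω)⟫) (hG.1.comp_fst.inner hh.1) ?_
  -- The product of the two norms at x is at most the sum of their squares, and both squares are
  -- integrable over Q.
  have hle : ∀ x, eLpNorm (fun ω => ⟪G x, h (x, ω)⟫) 2 P ≤
      ‖G x‖ₑ ^ 2 + ∫⁻ ω, ‖h (x, ω)‖ₑ ^ 2 ∂P := by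
    intro x
    rw [← eLpNorm_two_sq (fun ω => h (x, ω))]
    calc eLpNorm (fun ω => ⟪G x, h (x, ω)⟫) 2 P
        ≤ ‖G x‖ₑ * eLpNorm (fun ω => h (x, ω)) 2 P := by
          have := eLpNorm_le_mul_eLpNorm_of_ae_le_mul (f := fun ω => (⟪G x, h (x, ω)⟫ : ℝ))
            (g := fun ω => h (x, ω)) (c := ‖G x‖) (μ := P)
            (ae_of_all _ fun ω => norm_inner_le_norm _ _) 2
          rwa [ofReal_norm] at this
      _ ≤ _ := by
          rcases le_total ‖G x‖ₑ (eLpNorm (fun ω => h (x, ω)) 2 P) with h1 | h1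
          · rw [pow_two (eLpNorm _ _ _)]
            exact (mul_le_mul_left h1 _).trans le_add_self
          · rw [pow_two ‖G x‖ₑ]
            exact (mul_le_mul_right h1 _).trans le_self_add
  refine (lintegral_mono hle).trans_lt ?_
  rw [lintegral_add_left' (hG.1.enorm.pow_const 2)]
  refine ENNReal.add_lt_top.2 ⟨(memLp_two_iff hG.1).1 hG, ?_⟩
  rw [← lintegral_prod (fun p => ‖h p‖ₑ ^ 2) (hh.1.enorm.pow_const 2)]
  exact (memLp_two_iff hh.1).1 hh

end MixedNorm

end

/-! ### Elliptic operators on the field space -/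

section

variable {d : ℕ} {A C : Space d → Tensor d} {M α β : ℝ}

/-- The hypotheses on the periodic tensors. -/
structure IsEllipticPair (A C : Space d → Tensor d) (M α β : ℝ) : Prop where
  measurable : ∀ j i, AEStronglyMeasurable (fun x => A x j i) volume
  measurable' : ∀ j i, AEStronglyMeasurable (fun x => C x j i) volume
  periodic : Periodic A
  periodic' : Periodic C
  pos : 0 < M
  pos' : 0 < α
  bound : ∀ᵐ x : Space d, ∀ s ∈ Set.Icc (-M) M, ∀ ξ : Space d,
    α * ‖ξ‖ ^ 2 ≤ ⟪app (A x) ξ, ξ⟫ ∧ α * ‖ξ‖ ^ 2 ≤ ⟪app (A x + s • C x) ξ, ξ⟫ ∧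
    ‖app (A x) ξ‖ ≤ β * ‖ξ‖ ∧ ‖app (A x + s • C x) ξ‖ ≤ β * ‖ξ‖

lemma IsEllipticPair.ae_norm_app_le (h : IsEllipticPair A C M α β) :
    ∀ᵐ x : Space d, ∀ ξ, ‖app (A x) ξ‖ ≤ β * ‖ξ‖ := by
  filter_upwards [h.bound] with x hx ξ
  exact (hx 0 ⟨by linarith [h.pos], h.pos.le⟩ ξ).2.2.1

lemma IsEllipticPair.ae_norm_app_le' (h : IsEllipticPair A C M α β) :
    ∀ᵐ x : Space d, ∀ ξ, ‖app (C x) ξ‖ ≤ 2 * β / M * ‖ξ‖ := by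
  filter_upwards [h.bound] with x hx ξ
  have := hx M ⟨by linarith [h.pos], le_rfl⟩ ξ
  exact norm_app_le_of_bounded h.pos this.2.2.1 this.2.2.2

lemma ae_cell_of_ae {p : Space d → Prop} (h : ∀ᵐ x : Space d, p x) : ∀ᵐ x ∂(cellMeasure d), p x :=
  cellMeasure_absolutelyContinuous.ae_le h

variable {Ω : Type*} [MeasurableSpace Ω] {P : Measure Ω} [IsProbabilityMeasure P]

lemma ae_cell_prod_of_ae {p : Space d → Prop} (h : ∀ᵐ x : Space d, p x) :
    ∀ᵐ q : Space d × Ω ∂((cellMeasure d).prod P), p q.1 :=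
  Measure.quasiMeasurePreserving_fst.ae (ae_cell_of_ae h)

lemma IsEllipticPair.memLp_app_cell (h : IsEllipticPair A C M α β) {G : Space d → Space d}
    (hG : MemLp G 2 (cellMeasure d)) : MemLp (fun x => app (A x) (G x)) 2 (cellMeasure d) :=
  memLp_app (fun j i => (h.measurable j i).mono_ac cellMeasure_absolutelyContinuous)
    (ae_cell_of_ae h.ae_norm_app_le) hG

lemma IsEllipticPair.memLp_app_cell' (h : IsEllipticPair A C M α β) {G : Space d → Space d}
    (hG : MemLp G 2 (cellMeasure d)) : MemLp (fun x => app (C x) (G x)) 2 (cellMeasure d) :=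
  memLp_app (fun j i => (h.measurable' j i).mono_ac cellMeasure_absolutelyContinuous)
    (ae_cell_of_ae h.ae_norm_app_le') hG

variable (P) in
lemma IsEllipticPair.exists_operator (h : IsEllipticPair A C M α β) :
    ∃ T : FieldSpace d P →L[ℝ] FieldSpace d P,
      ∀ f, T f =ᵐ[(cellMeasure d).prod P] fun p => app (A p.1) (f p) :=
  exists_mulOperator
    (fun j i => ((h.measurable j i).mono_ac cellMeasure_absolutelyContinuous).comp_fst)
    (ae_cell_prod_of_ae h.ae_norm_app_le)

variable (P) in
lemma IsEllipticPair.exists_operator' (h : IsEllipticPair A C M α β) :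
    ∃ T : FieldSpace d P →L[ℝ] FieldSpace d P,
      ∀ f, T f =ᵐ[(cellMeasure d).prod P] fun p => app (C p.1) (f p) :=
  exists_mulOperator
    (fun j i => ((h.measurable' j i).mono_ac cellMeasure_absolutelyContinuous).comp_fst)
    (ae_cell_prod_of_ae h.ae_norm_app_le')

lemma app_smul_matrix (s : ℝ) (N : Tensor d) (ξ : Space d) : app (s • N) ξ = s • app N ξ := by
  simp [app]

lemma IsEllipticPair.exists_operator_smul (h : IsEllipticPair A C M α β) {b : Space d → Ω → ℝ}
    (hb : AEStronglyMeasurable (Function.uncurry b) ((cellMeasure d).prod P))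
    (hM : ∀ᵐ p : Space d × Ω ∂((cellMeasure d).prod P), |b p.1 p.2| ≤ M) :
    ∃ S : FieldSpace d P →L[ℝ] FieldSpace d P,
      ∀ f, S f =ᵐ[(cellMeasure d).prod P] fun p => b p.1 p.2 • app (C p.1) (f p) := by
  obtain ⟨S, hS⟩ := exists_mulOperator (μ := (cellMeasure d).prod P)
    (K := fun p => b p.1 p.2 • C p.1) (B := M * (2 * β / M))
    (fun j i => hb.mul ((h.measurable' j i).mono_ac cellMeasure_absolutelyContinuous).comp_fst)
    (by
      filter_upwards [hM, ae_cell_prod_of_ae h.ae_norm_app_le'] with p h1 h2 ξ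
      rw [app_smul_matrix, norm_smul, mul_assoc]
      exact mul_le_mul h1 (h2 ξ) (norm_nonneg _) h.pos.le)
  refine ⟨S, fun f => (hS f).trans (ae_of_all _ fun p => ?_)⟩
  exact app_smul_matrix _ _ _

lemma le_inner_of_ae_le {T : FieldSpace d P →L[ℝ] FieldSpace d P} {f : FieldSpace d P}
    (h : ∀ᵐ p ∂((cellMeasure d).prod P), α * ‖f p‖ ^ 2 ≤ ⟪T f p, f p⟫) :
    α * ‖f‖ ^ 2 ≤ ⟪T f, f⟫ := by
  rw [← real_inner_self_eq_norm_sq, L2.inner_def, L2.inner_def, ← integral_const_mul]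
  refine integral_mono_ae ((L2.integrable_inner (𝕜 := ℝ) f f).const_mul α)
    (L2.integrable_inner (𝕜 := ℝ) (T f) f) ?_
  filter_upwards [h] with p hp
  simpa only [real_inner_self_eq_norm_sq] using hp

lemma IsEllipticPair.coercive (h : IsEllipticPair A C M α β)
    {T : FieldSpace d P →L[ℝ] FieldSpace d P}
    (hT : ∀ f, T f =ᵐ[(cellMeasure d).prod P] fun p => app (A p.1) (f p)) (f : FieldSpace d P) :
    α * ‖f‖ ^ 2 ≤ ⟪T f, f⟫ := by
  refine le_inner_of_ae_le ?_
  filter_upwards [hT f, ae_cell_prod_of_ae h.bound] with p h1 h2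
  rw [h1]
  exact (h2 0 ⟨by linarith [h.pos], h.pos.le⟩ _).1

lemma IsEllipticPair.coercive_add (h : IsEllipticPair A C M α β)
    {T S : FieldSpace d P →L[ℝ] FieldSpace d P}
    (hT : ∀ f, T f =ᵐ[(cellMeasure d).prod P] fun p => app (A p.1) (f p)) {b : Space d → Ω → ℝ}
    (hM : ∀ᵐ p : Space d × Ω ∂((cellMeasure d).prod P), |b p.1 p.2| ≤ M)
    (hS : ∀ f, S f =ᵐ[(cellMeasure d).prod P] fun p => b p.1 p.2 • app (C p.1) (f p))
    (f : FieldSpace d P) : α * ‖f‖ ^ 2 ≤ ⟪T f + S f, f⟫ := by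
  refine le_inner_of_ae_le (T := T + S) ?_
  filter_upwards [hT f, hS f, Lp.coeFn_add (T f) (S f), hM, ae_cell_prod_of_ae h.bound]
    with p h1 h2 h3 h4 h5
  rw [add_apply, h3, Pi.add_apply, h1, h2, ← app_add_smul]
  exact (h5 _ (abs_le.1 h4) _).2.1

/-- Multiplication by `b n` tends to zero weakly, uniformly on bounded sets. -/
lemma exists_tendsto_bound_inner (h : IsEllipticPair A C M α β) {b : ℕ → Space d → Ω → ℝ}
    (hb : ∀ n, AEStronglyMeasurable (Function.uncurry (b n)) ((cellMeasure d).prod P))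
    (hM : ∀ n, ∀ᵐ p : Space d × Ω ∂((cellMeasure d).prod P), |b n p.1 p.2| ≤ M)
    (hlim : Tendsto (fun n => mixedNorm P (b n)) atTop (𝓝 0))
    {S : ℕ → FieldSpace d P →L[ℝ] FieldSpace d P}
    (hS : ∀ n f, S n f =ᵐ[(cellMeasure d).prod P] fun p => b n p.1 p.2 • app (C p.1) (f p))
    (g : FieldSpace d P) :
    ∃ ε : ℕ → ℝ, Tendsto ε atTop (𝓝 0) ∧ ∀ n f, |⟪S n f, g⟫| ≤ ε n * ‖f‖ := by
  obtain ⟨R, hR⟩ := h.exists_operator' P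
  -- The scalar b n is moved onto the fixed field g, where b n g tends to zero strongly; the
  -- remaining operator R, multiplication by C, is independent of n.
  have hbg : ∀ n, MemLp (fun p : Space d × Ω => b n p.1 p.2 • g p) 2 ((cellMeasure d).prod P) := by
    intro n
    refine (Lp.memLp g).of_le_mul (c := M) ((hb n).smul (Lp.aestronglyMeasurable g)) ?_
    filter_upwards [hM n] with p hp
    rw [norm_smul]
    exact mul_le_mul_of_nonneg_right hp (norm_nonneg _)
  refine ⟨fun n => ‖R‖ * ‖(hbg n).toLp _‖, ?_, fun n f => ?_⟩
  · have h1 := tendsto_lintegral_sq_mul hb hM hlim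
      ((Lp.aestronglyMeasurable g).enorm.pow_const 2)
      ((memLp_two_iff (Lp.aestronglyMeasurable g)).1 (Lp.memLp g)).ne
    have h2 : Tendsto (fun n => ‖(hbg n).toLp _‖ ^ 2) atTop (𝓝 0) := by
      have h3 := (ENNReal.tendsto_toReal ENNReal.zero_ne_top).comp h1
      rw [ENNReal.toReal_zero] at h3
      refine h3.congr fun n => ?_
      rw [Lp.norm_toLp, ← ENNReal.toReal_pow, eLpNorm_two_sq]
      simp only [enorm_smul, mul_pow, Function.comp]
    have h4 := h2.sqrt
    simp only [Real.sqrt_sq (norm_nonneg _), Real.sqrt_zero] at h4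
    simpa using h4.const_mul ‖R‖
  · have h1 : ⟪S n f, g⟫ = ⟪R f, (hbg n).toLp _⟫ := by
      rw [L2.inner_def, L2.inner_def]
      refine integral_congr_ae ?_
      filter_upwards [hS n f, hR f, (hbg n).coeFn_toLp] with p h1 h2 h3
      rw [h1, h2, h3, real_inner_smul_left, real_inner_smul_right]
    rw [h1]
    refine (abs_real_inner_le_norm _ _).trans ?_
    rw [mul_right_comm]
    exact mul_le_mul_of_nonneg_right (R.le_opNorm f) (norm_nonneg _)

section Equations

variable [AddAction (Fin d → ℤ) Ω] [MeasurableConstVAdd (Fin d → ℤ) Ω]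
  [VAddInvariantMeasure (Fin d → ℤ) Ω P]

lemma inner_eq_zero_of_ae_isDivFree {σ : Space d → Ω → Space d}
    (hm : AEStronglyMeasurable (Function.uncurry σ) ((volume : Measure (Space d)).prod P))
    (hs : Stationary P σ) (h2 : MemLp (Function.uncurry σ) 2 ((cellMeasure d).prod P))
    (hdiv : ∀ᵐ ω ∂P, IsDivFree fun x => σ x ω) {f h : FieldSpace d P}
    (hf : f =ᵐ[(cellMeasure d).prod P] Function.uncurry σ) (hh : h ∈ gradientSpace P) :
    ⟪f, h⟫ = 0 := by
  obtain ⟨τ, hτ, hστ⟩ := exists_isStationaryL2 hm hs h2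
  have h1 : f = hτ.memLp.toLp _ := by
    refine Lp.ext ?_
    filter_upwards [hf, (cell_prod_absolutelyContinuous P).ae_le hστ, hτ.memLp.coeFn_toLp]
      with p h3 h4 h5
    rw [h3, h4, h5]
  rw [h1]
  refine inner_gradientSpace_eq_zero hτ ?_ hh
  filter_upwards [hdiv, ae_ae_swap (p := fun x ω => σ x ω = τ x ω) hστ] with ω h3 h4
  exact h3.congr h4

lemma ae_isDivFree_of_forall_inner {σ : Space d → Ω → Space d}
    (hm : AEStronglyMeasurable (Function.uncurry σ) ((volume : Measure (Space d)).prod P))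
    (hs : Stationary P σ) (h2 : MemLp (Function.uncurry σ) 2 ((cellMeasure d).prod P))
    {f : FieldSpace d P} (hf : f =ᵐ[(cellMeasure d).prod P] Function.uncurry σ)
    (h : ∀ h ∈ gradientSpace P, ⟪f, h⟫ = 0) : ∀ᵐ ω ∂P, IsDivFree fun x => σ x ω := by
  obtain ⟨τ, hτ, hστ⟩ := exists_isStationaryL2 hm hs h2
  have h1 : f = hτ.memLp.toLp _ := by
    refine Lp.ext ?_
    filter_upwards [hf, (cell_prod_absolutelyContinuous P).ae_le hστ, hτ.memLp.coeFn_toLp]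
      with p h3 h4 h5
    rw [h3, h4, h5]
  rw [h1] at h
  filter_upwards [ae_isDivFree_of_inner_eq_zero hτ h,
    ae_ae_swap (p := fun x ω => σ x ω = τ x ω) hστ] with ω h3 h4
  exact h3.congr (EventuallyEq.symm h4)

end Equations

end

/-! ### Equations for the correctors and their expansion -/

section

variable {d : ℕ} {A C : Space d → Tensor d} {M α β : ℝ}
  {Ω : Type*} [MeasurableSpace Ω] {P : Measure Ω} [IsProbabilityMeasure P]
  [AddAction (Fin d → ℤ) Ω]

lemma memLp_add_basisVec {X : Type*} [MeasurableSpace X] {μ : Measure X} [IsFiniteMeasure μ]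
    {g : X → Space d} (hg : MemLp g 2 μ) (i : Fin d) : MemLp (fun x => g x + basisVec i) 2 μ :=
  hg.add (memLp_const _)

lemma IsEllipticPair.memLp_source (h : IsEllipticPair A C M α β) {b₀ : Space d → Ω → ℝ}
    (hb₀ : IsStationaryField P b₀) {G : Space d → Space d} (hG : MemLp G 2 (cellMeasure d)) :
    MemLp (fun p : Space d × Ω => b₀ p.1 p.2 • app (C p.1) (G p.1)) 2
      ((cellMeasure d).prod P) :=
  memLp_smul_of_mixedNorm (hb₀.measurable.mono_ac (cell_prod_absolutelyContinuous P))
    hb₀.mixedNorm_lt_top (h.memLp_app_cell' hG)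

lemma IsEllipticPair.memLp_app_prod (h : IsEllipticPair A C M α β) {g : Space d → Ω → Space d}
    (hg : MemLp (Function.uncurry g) 2 ((cellMeasure d).prod P)) :
    MemLp (fun p : Space d × Ω => app (A p.1) (g p.1 p.2)) 2 ((cellMeasure d).prod P) :=
  memLp_app (fun j i => ((h.measurable j i).mono_ac cellMeasure_absolutelyContinuous).comp_fst)
    (ae_cell_prod_of_ae h.ae_norm_app_le) hg

section FirstOrder

variable {b₀ : Space d → Ω → ℝ} {w₀ : Space d → ℝ} {gw₀ : Space d → Space d} {i : Fin d}

/-- The flux of the first order problem is a stationary square integrable field. -/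
lemma firstOrderFlux (h : IsEllipticPair A C M α β) (hb₀ : IsStationaryField P b₀)
    (hw₀ : IsPeriodicCorrector A i w₀ gw₀) {g : Space d → Ω → Space d}
    (hgm : AEStronglyMeasurable (Function.uncurry g) ((volume : Measure (Space d)).prod P))
    (hgs : Stationary P g) (hg2 : MemLp (Function.uncurry g) 2 ((cellMeasure d).prod P)) :
    let σ := fun x ω => app (A x) (g x ω) + b₀ x ω • app (C x) (gw₀ x + basisVec i)
    AEStronglyMeasurable (Function.uncurry σ) ((volume : Measure (Space d)).prod P) ∧
      Stationary P σ ∧ MemLp (Function.uncurry σ) 2 ((cellMeasure d).prod P) := by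
  have hgw := hw₀.hasWeakGradient.locallyIntegrable_grad.aestronglyMeasurable
  refine ⟨?_, fun k => ?_, ?_⟩
  · refine AEStronglyMeasurable.add
      (aestronglyMeasurable_app (fun j i => (h.measurable j i).comp_fst) hgm)
      (AEStronglyMeasurable.smul hb₀.measurable ?_)
    exact (aestronglyMeasurable_app h.measurable'
      (hgw.add aestronglyMeasurable_const)).comp_fst
  · filter_upwards [h.periodic.stationary (P := P) k, h.periodic'.stationary (P := P) k, hgs k,
      hb₀.stationary k, (hw₀.hasWeakGradient.periodic hw₀.periodic).stationary (P := P) k]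
      with p h1 h2 h3 h4 h5
    rw [h1, h2, h3, h4, h5]
  · have h1 := h.memLp_app_prod hg2
    have h2 := h.memLp_source hb₀ (memLp_add_basisVec hw₀.memLp i)
    have h3 : MemLp (fun p : Space d × Ω => app (A p.1) (g p.1 p.2) +
        b₀ p.1 p.2 • app (C p.1) (gw₀ p.1 + basisVec i)) 2 ((cellMeasure d).prod P) := h1.add h2
    exact h3

variable [MeasurableConstVAdd (Fin d → ℤ) Ω] [VAddInvariantMeasure (Fin d → ℤ) Ω P]

/-- Lax–Milgram in V yields a gradient whose total flux is orthogonal to V, that is, divergence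
free. The potential and its expectation come with membership in V. Ergodicity plays no role in
existence. -/
lemma exists_isFirstOrderCorrector (h : IsEllipticPair A C M α β) (hb₀ : IsStationaryField P b₀)
    (hw₀ : IsPeriodicCorrector A i w₀ gw₀) :
    ∃ (v : Space d → Ω → ℝ) (gv : Space d → Ω → Space d),
      IsFirstOrderCorrector P A C b₀ gw₀ i v gv ∧ (∀ᵐ x : Space d, Integrable (v x) P) ∧
      HasWeakGradient (fun x => ∫ ω, v x ω ∂P) (fun x => ∫ ω, gv x ω ∂P) := by
  obtain ⟨T, hT⟩ := h.exists_operator P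
  have hF := h.memLp_source hb₀ (memLp_add_basisVec hw₀.memLp i)
  obtain ⟨f, hfV, hf⟩ := exists_mem_forall_inner_eq (V := gradientSpace P) h.pos'
    (fun f _ => h.coercive hT f) (-hF.toLp _)
  obtain ⟨v, gv, hv, hgv, hgvf, hvi, hvE⟩ := exists_potential hfV
  obtain ⟨h1, h2, h3⟩ := firstOrderFlux h hb₀ hw₀ hgv.measurable.aestronglyMeasurable
    hgv.stationary hgv.memLp
  refine ⟨v, gv, ⟨hv, ae_isDivFree_of_forall_inner h1 h2 h3 (f := T f + hF.toLp _) ?_ ?_⟩,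
    hvi, hvE⟩
  · filter_upwards [Lp.coeFn_add (T f) (hF.toLp _), hT f, hgvf, hF.coeFn_toLp] with p h4 h5 h6 h7
    rw [h4, Pi.add_apply, h5, ← h6, h7]
    rfl
  · intro g hg
    rw [inner_add_left, hf g hg, inner_neg_left, neg_add_cancel]

lemma IsFirstOrderCorrector.inner_eq (h : IsEllipticPair A C M α β) (hb₀ : IsStationaryField P b₀)
    (hw₀ : IsPeriodicCorrector A i w₀ gw₀) {v : Space d → Ω → ℝ} {gv : Space d → Ω → Space d}
    (hv : IsFirstOrderCorrector P A C b₀ gw₀ i v gv)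
    {T : FieldSpace d P →L[ℝ] FieldSpace d P}
    (hT : ∀ f, T f =ᵐ[(cellMeasure d).prod P] fun p => app (A p.1) (f p))
    {g : FieldSpace d P} (hg : g ∈ gradientSpace P) :
    ⟪T (hv.isStationaryGradient.memLp.toLp _), g⟫ =
      -⟪(h.memLp_source hb₀ (memLp_add_basisVec hw₀.memLp i)).toLp _, g⟫ := by
  have hv1 := hv.isStationaryGradient
  obtain ⟨h1, h2, h3⟩ := firstOrderFlux h hb₀ hw₀ hv1.measurable_grad hv1.stationary hv1.memLp
  have hF := h.memLp_source hb₀ (memLp_add_basisVec hw₀.memLp i)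
  have h4 := inner_eq_zero_of_ae_isDivFree h1 h2 h3 hv.equation
    (f := T (hv1.memLp.toLp _) + hF.toLp _) (by
      filter_upwards [Lp.coeFn_add (T (hv1.memLp.toLp _)) (hF.toLp _), hT (hv1.memLp.toLp _),
        hv1.memLp.coeFn_toLp, hF.coeFn_toLp] with p h4 h5 h6 h7
      rw [h4, Pi.add_apply, h5, h6, h7]
      rfl) hg
  rw [inner_add_left] at h4
  linarith

end FirstOrder

section Correctors

variable {i : Fin d} [MeasurableConstVAdd (Fin d → ℤ) Ω] [VAddInvariantMeasure (Fin d → ℤ) Ω P]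

lemma IsCorrector.inner_eq_zero (h : IsEllipticPair A C M α β) {b : Space d → Ω → ℝ}
    (hbm : AEStronglyMeasurable (Function.uncurry b) ((volume : Measure (Space d)).prod P))
    (hbs : Stationary P b)
    (hM : ∀ᵐ p : Space d × Ω ∂((cellMeasure d).prod P), |b p.1 p.2| ≤ M)
    {w : Space d → Ω → ℝ} {gw : Space d → Ω → Space d}
    (hw : IsCorrector P (perturbed A C b) i w gw) {f g : FieldSpace d P}
    (hf : f =ᵐ[(cellMeasure d).prod P]
      fun p => app (perturbed A C b p.1 p.2) (gw p.1 p.2 + basisVec i))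
    (hg : g ∈ gradientSpace P) : ⟪f, g⟫ = 0 := by
  have hw1 := hw.isStationaryGradient
  have hm : ∀ j l, AEStronglyMeasurable (fun p : Space d × Ω => perturbed A C b p.1 p.2 j l)
      ((volume : Measure (Space d)).prod P) := fun j l =>
    AEStronglyMeasurable.add (h.measurable j l).comp_fst (hbm.mul (h.measurable' j l).comp_fst)
  refine inner_eq_zero_of_ae_isDivFree
    (σ := fun x ω => app (perturbed A C b x ω) (gw x ω + basisVec i)) ?_ (fun k => ?_) ?_
    hw.equation hf hg
  · exact aestronglyMeasurable_app hm (hw1.measurable_grad.add aestronglyMeasurable_const)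
  · filter_upwards [h.periodic.stationary (P := P) k, h.periodic'.stationary (P := P) k,
      hw1.stationary k, hbs k] with p h1 h2 h3 h4
    simp only [perturbed]
    rw [h1, h2, h3, h4]
  · refine memLp_app (B := β) (fun j l => (hm j l).mono_ac (cell_prod_absolutelyContinuous P)) ?_
      (memLp_add_basisVec hw1.memLp i)
    filter_upwards [hM, ae_cell_prod_of_ae h.bound] with p h1 h2 ξ
    exact (h2 _ (abs_le.1 h1) ξ).2.2.2

lemma IsPeriodicCorrector.inner_eq_zero (h : IsEllipticPair A C M α β) {w : Space d → ℝ}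
    {gw : Space d → Space d} (hw : IsPeriodicCorrector A i w gw) {f g : FieldSpace d P}
    (hf : f =ᵐ[(cellMeasure d).prod P] fun p => app (A p.1) (gw p.1 + basisVec i))
    (hg : g ∈ gradientSpace P) : ⟪f, g⟫ = 0 := by
  refine inner_eq_zero_of_ae_isDivFree (σ := fun x _ => app (A x) (gw x + basisVec i))
    ?_ (fun k => ?_) ?_ (ae_of_all _ fun _ => hw.equation) hf hg
  · exact hw.equation.locallyIntegrable.aestronglyMeasurable.comp_fst
  · filter_upwards [h.periodic.stationary (P := P) k,
      (hw.hasWeakGradient.periodic hw.periodic).stationary (P := P) k] with p h1 h2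
    rw [h1, h2]
  · exact (h.memLp_app_cell (memLp_add_basisVec hw.memLp i)).comp_fst P

end Correctors

/-- First order expansion of the correctors and of their fluxes. -/
lemma corrector_expansion [MeasurableConstVAdd (Fin d → ℤ) Ω] [ErgodicVAdd (Fin d → ℤ) Ω P]
    (h : IsEllipticPair A C M α β) {b : ℕ → Space d → Ω → ℝ}
    (hbm : ∀ n, AEStronglyMeasurable (Function.uncurry (b n)) ((volume : Measure (Space d)).prod P))
    (hbs : ∀ n, Stationary P (b n))
    (hM : ∀ n, ∀ᵐ p : Space d × Ω ∂((cellMeasure d).prod P), |b n p.1 p.2| ≤ M)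
    (hlim : Tendsto (fun n => mixedNorm P (b n)) atTop (𝓝 0))
    {m : ℕ → ℝ} (hm : ∀ n, m n = (mixedNorm P (b n)).toReal)
    {b₀ : Space d → Ω → ℝ} (hb₀ : IsStationaryField P b₀)
    (hstar : TendstoWeakStar P (fun n x ω => b n x ω / m n) b₀) {i : Fin d}
    {w : ℕ → Space d → Ω → ℝ} {gw : ℕ → Space d → Ω → Space d}
    (hw : ∀ n, IsCorrector P (perturbed A C (b n)) i (w n) (gw n))
    {w₀ : Space d → ℝ} {gw₀ : Space d → Space d} (hw₀ : IsPeriodicCorrector A i w₀ gw₀)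
    {v : Space d → Ω → ℝ} {gv : Space d → Ω → Space d}
    (hv : IsFirstOrderCorrector P A C b₀ gw₀ i v gv) {ψ : Space d × Ω → Space d}
    (hψ : MemLp ψ 2 ((cellMeasure d).prod P)) :
    ((fun n => ∫ p : Space d × Ω, ⟪gw n p.1 p.2 - gw₀ p.1 - m n • gv p.1 p.2, ψ p⟫
      ∂((cellMeasure d).prod P)) =o[atTop] m) ∧
    (fun n => ∫ p : Space d × Ω,
      ⟪app (perturbed A C (b n) p.1 p.2) (gw n p.1 p.2 + basisVec i) -
        app (A p.1) (gw₀ p.1 + basisVec i) -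
        m n • (app (A p.1) (gv p.1 p.2) + b₀ p.1 p.2 • app (C p.1) (gw₀ p.1 + basisVec i)), ψ p⟫
      ∂((cellMeasure d).prod P)) =o[atTop] m := by
  set μ := (cellMeasure d).prod P with hμ
  have hbc : ∀ n, AEStronglyMeasurable (Function.uncurry (b n)) μ := fun n =>
    (hbm n).mono_ac (cell_prod_absolutelyContinuous P)
  have hfin : ∀ n, mixedNorm P (b n) ≠ ∞ := fun n =>
    ((mixedNorm_le_of_ae_le (hM n)).trans_lt ENNReal.ofReal_lt_top).ne
  have hGe := memLp_add_basisVec hw₀.memLp i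
  have hCG := h.memLp_app_cell' hGe
  have hF₀ := h.memLp_source hb₀ hGe
  have hgw₀ := hw₀.hasWeakGradient.isStationaryGradient (P := P) hw₀.periodic hw₀.memLp
  have he : MemLp (fun _ : Space d × Ω => (basisVec i : Space d)) 2 μ := memLp_const _
  obtain ⟨T, hT⟩ := h.exists_operator P
  choose S hS using fun n => h.exists_operator_smul (hbc n) (hM n)
  set W : ℕ → FieldSpace d P := fun n => (hw n).isStationaryGradient.memLp.toLp _ with hW
  set G : FieldSpace d P := hgw₀.memLp.toLp _ with hG
  set E : FieldSpace d P := he.toLp _ with hE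
  have hWc : ∀ n, W n =ᵐ[μ] Function.uncurry (gw n) := fun n => MemLp.coeFn_toLp _
  have hGc : G =ᵐ[μ] fun p => gw₀ p.1 := MemLp.coeFn_toLp _
  have hEc : E =ᵐ[μ] fun _ => basisVec i := MemLp.coeFn_toLp _
  have hGE : ∀ᵐ p ∂μ, (G + E) p = gw₀ p.1 + basisVec i := by
    filter_upwards [Lp.coeFn_add G E, hGc, hEc] with p h1 h2 h3
    rw [h1, Pi.add_apply, h2, h3]
  have hWE : ∀ n, ∀ᵐ p ∂μ, (W n + E) p = gw n p.1 p.2 + basisVec i := fun n => by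
    filter_upwards [Lp.coeFn_add (W n) E, hWc n, hEc] with p h1 h2 h3
    rw [h1, Pi.add_apply, h2, h3]
    rfl
  have hflux : ∀ n, T (W n + E) + S n (W n + E) =ᵐ[μ]
      fun p => app (perturbed A C (b n) p.1 p.2) (gw n p.1 p.2 + basisVec i) := fun n => by
    filter_upwards [Lp.coeFn_add (T (W n + E)) (S n (W n + E)), hT (W n + E), hS n (W n + E),
      hWE n] with p h1 h2 h3 h4
    rw [h1, Pi.add_apply, h2, h3, h4, perturbed, app_add_smul]
  have hflux₀ : T (G + E) =ᵐ[μ] fun p => app (A p.1) (gw₀ p.1 + basisVec i) := by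
    filter_upwards [hT (G + E), hGE] with p h1 h2
    rw [h1, h2]
  have hSG : ∀ n, S n (G + E) =ᵐ[μ] fun p => b n p.1 p.2 • app (C p.1) (gw₀ p.1 + basisVec i) :=
    fun n => by
      filter_upwards [hS n (G + E), hGE] with p h1 h2
      rw [h1, h2]
  have hvV := hv.isStationaryGradient.mem_gradientSpace
  set U : FieldSpace d P := hv.isStationaryGradient.memLp.toLp _ with hU
  have hUc : U =ᵐ[μ] Function.uncurry gv := MemLp.coeFn_toLp _
  -- Ergodicity enters through this membership: both gradients are stationary with zero mean.
  have hWG : ∀ n, W n - G ∈ gradientSpace P := fun n =>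
    (gradientSpace P).sub_mem (hw n).isStationaryGradient.mem_gradientSpace hgw₀.mem_gradientSpace
  have hdec : ∀ n, T (W n - G) + S n (W n - G) =
      (T (W n + E) + S n (W n + E)) - T (G + E) - S n (G + E) := fun n => by
    simp only [map_add, map_sub]
    abel
  have heq : ∀ n, ∀ g ∈ gradientSpace P, ⟪T (W n - G) + S n (W n - G), g⟫ = -⟪S n (G + E), g⟫ := by
    intro n g hg
    have h1 := (hw n).inner_eq_zero h (hbm n) (hbs n) (hM n) (hflux n) hg
    have h2 := hw₀.inner_eq_zero h hflux₀ hg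
    rw [hdec, inner_sub_left, inner_sub_left, h1, h2]
    ring
  -- The source is of order m n because ∇w⁰ + e_i is deterministic, so the mixed norm of b n can be
  -- factored out.
  have hFle : ∀ n, ‖S n (G + E)‖ ≤
      (eLpNorm (fun x => app (C x) (gw₀ x + basisVec i)) 2 (cellMeasure d)).toReal * m n := by
    intro n
    have h1 := eLpNorm_smul_le_mixedNorm (hbc n) hCG
    have h2 := ENNReal.mul_ne_top (hfin n) hCG.2.ne
    rw [Lp.norm_def, eLpNorm_congr_ae (hSG n), hm, mul_comm, ← ENNReal.toReal_mul]
    exact ENNReal.toReal_mono h2 h1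
  have hFlim : ∀ g : FieldSpace d P,
      Tendsto (fun n => ⟪(m n)⁻¹ • S n (G + E), g⟫) atTop (𝓝 ⟪hF₀.toLp _, g⟫) := by
    intro g
    have h1 := hstar.tendsto_inner hCG (Lp.memLp g)
    have h2 : ⟪hF₀.toLp _, g⟫ = ∫ p : Space d × Ω,
        ⟪b₀ p.1 p.2 • app (C p.1) (gw₀ p.1 + basisVec i), g p⟫ ∂μ := by
      rw [L2.inner_def]
      refine integral_congr_ae ?_
      filter_upwards [hF₀.coeFn_toLp] with p hp
      rw [hp]
    rw [h2]
    refine h1.congr fun n => ?_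
    rw [L2.inner_def]
    refine integral_congr_ae ?_
    filter_upwards [Lp.coeFn_smul (m n)⁻¹ (S n (G + E)), hSG n] with p h3 h4
    rw [h3, Pi.smul_apply, h4, smul_smul, div_eq_inv_mul]
  have hexp := perturbation_expansion (V := gradientSpace P) h.pos' (fun f _ => h.coercive hT f)
    (fun n f _ => h.coercive_add hT (hM n) (hS n) f)
    (fun n => (hm n).symm ▸ ENNReal.toReal_nonneg) hWG heq hFle hFlim
    (fun g => exists_tendsto_bound_inner h hbc hM hlim hS g) hvV
    (fun g hg => hv.inner_eq h hb₀ hw₀ hT hg) (hψ.toLp _)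
  refine ⟨hexp.1.congr_left fun n => ?_, hexp.2.congr_left fun n => ?_⟩
  · rw [L2.inner_def]
    refine integral_congr_ae ?_
    filter_upwards [Lp.coeFn_sub (W n - G) (m n • U), Lp.coeFn_sub (W n) G,
      Lp.coeFn_smul (m n) U, hWc n, hGc, hUc, hψ.coeFn_toLp] with p h1 h2 h3 h4 h5 h6 h7
    rw [h1, Pi.sub_apply, h2, Pi.sub_apply, h3, Pi.smul_apply, h4, h5, h6, h7]
    rfl
  · have h0 : T (W n - G) + S n (W n - G) + S n (G + E) - m n • (T U + hF₀.toLp _) =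
        ((T (W n + E) + S n (W n + E)) - T (G + E)) - m n • (T U + hF₀.toLp _) := by
      simp only [map_add, map_sub]
      abel
    rw [h0, L2.inner_def]
    refine integral_congr_ae ?_
    filter_upwards [Lp.coeFn_sub ((T (W n + E) + S n (W n + E)) - T (G + E))
        (m n • (T U + hF₀.toLp _)),
      Lp.coeFn_sub (T (W n + E) + S n (W n + E)) (T (G + E)),
      Lp.coeFn_smul (m n) (T U + hF₀.toLp _), Lp.coeFn_add (T U) (hF₀.toLp _), hflux n, hflux₀,
      hT U, hUc, hF₀.coeFn_toLp, hψ.coeFn_toLp] with p h1 h2 h3 h4 h5 h6 h7 h8 h9 h10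
    rw [h1, Pi.sub_apply, h2, Pi.sub_apply, h3, Pi.smul_apply, h4, Pi.add_apply, h5, h6, h7, h8,
      h9, h10]
    rfl

end

/-! ### Expansion of the homogenized tensor -/

section

section Components

variable {d : ℕ} {X : Type*} [MeasurableSpace X] {μ : Measure X}

lemma inner_basisVec (ξ : Space d) (j : Fin d) : ⟪ξ, (basisVec j : Space d)⟫ = ξ j := by
  simp [EuclideanSpace.inner_single_right]

lemma integral_inner_basisVec {σ : X → Space d} (hσ : Integrable σ μ) (j : Fin d) :
    ∫ x, ⟪σ x, (basisVec j : Space d)⟫ ∂μ = (∫ x, σ x ∂μ) j := by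
  simp only [inner_basisVec]
  exact (EuclideanSpace.proj (𝕜 := ℝ) j).integral_comp_comm hσ

end Components

variable {d : ℕ} {A C : Space d → Tensor d} {M α β : ℝ}
  {Ω : Type*} [MeasurableSpace Ω] {P : Measure Ω} [IsProbabilityMeasure P]
  [AddAction (Fin d → ℤ) Ω]

lemma IsEllipticPair.memLp_flux (h : IsEllipticPair A C M α β) {b : Space d → Ω → ℝ}
    (hb : AEStronglyMeasurable (Function.uncurry b) ((cellMeasure d).prod P))
    (hM : ∀ᵐ p : Space d × Ω ∂((cellMeasure d).prod P), |b p.1 p.2| ≤ M)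
    {f : Space d × Ω → Space d} (hf : MemLp f 2 ((cellMeasure d).prod P)) :
    MemLp (fun p => app (perturbed A C b p.1 p.2) (f p)) 2 ((cellMeasure d).prod P) := by
  refine memLp_app (B := β) (fun j l => ?_) ?_ hf
  · exact AEStronglyMeasurable.add
      ((h.measurable j l).mono_ac cellMeasure_absolutelyContinuous).comp_fst
      (hb.mul ((h.measurable' j l).mono_ac cellMeasure_absolutelyContinuous).comp_fst)
  · filter_upwards [hM, ae_cell_prod_of_ae h.bound] with p h1 h2 ξ
    exact (h2 _ (abs_le.1 h1) ξ).2.2.2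

lemma homogenized_apply {A : Space d → Ω → Tensor d} {g : Fin d → Space d → Ω → Space d}
    {i : Fin d} (h : Integrable (fun p : Space d × Ω => app (A p.1 p.2) (g i p.1 p.2 + basisVec i))
      ((cellMeasure d).prod P)) (j : Fin d) :
    homogenized P A g j i = (∫ p : Space d × Ω, app (A p.1 p.2) (g i p.1 p.2 + basisVec i)
      ∂((cellMeasure d).prod P)) j := by
  rw [integral_prod_symm _ h]
  rfl

variable (P) in
lemma periodicHomogenized_apply {g : Fin d → Space d → Space d} (i j : Fin d) :
    periodicHomogenized A g j i = (∫ p : Space d × Ω, app (A p.1) (g i p.1 + basisVec i)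
      ∂((cellMeasure d).prod P)) j := by
  rw [integral_fun_fst (μ := cellMeasure d) (ν := P) (f := fun x => app (A x) (g i x + basisVec i))]
  simp only [probReal_univ, one_smul]
  rfl

/-- A, C and G are deterministic, so the expectation acts on b₀ and on the gradient alone; this
exhibits the tensor as the mean of the first-order flux. -/
lemma firstOrderTensor_apply (h : IsEllipticPair A C M α β) {b₀ : Space d → Ω → ℝ}
    (hb₀ : IsStationaryField P b₀) {G : Fin d → Space d → Space d}
    {g : Fin d → Space d → Ω → Space d} {i : Fin d} (hG : MemLp (G i) 2 (cellMeasure d))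
    (hg : MemLp (Function.uncurry (g i)) 2 ((cellMeasure d).prod P)) (j : Fin d) :
    firstOrderTensor P A C b₀ G g j i = (∫ p : Space d × Ω,
      (app (A p.1) (g i p.1 p.2) + b₀ p.1 p.2 • app (C p.1) (G i p.1 + basisVec i))
      ∂((cellMeasure d).prod P)) j := by
  have i1 := (h.memLp_app_prod hg).integrable one_le_two
  have i2 := (h.memLp_source hb₀ (memLp_add_basisVec hG i)).integrable one_le_two
  have e1 : ∫ p : Space d × Ω, app (A p.1) (g i p.1 p.2) ∂((cellMeasure d).prod P) =
      ∫ x, app (A x) (∫ ω, g i x ω ∂P) ∂(cellMeasure d) := by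
    rw [integral_prod _ i1]
    refine integral_congr_ae ?_
    filter_upwards [(hg.integrable one_le_two).prod_right_ae] with x hx
    exact (LinearMap.toContinuousLinearMap (Matrix.toEuclideanLin (A x))).integral_comp_comm hx
  have e2 : ∫ p : Space d × Ω, b₀ p.1 p.2 • app (C p.1) (G i p.1 + basisVec i)
      ∂((cellMeasure d).prod P) =
      ∫ x, (∫ ω, b₀ x ω ∂P) • app (C x) (G i x + basisVec i) ∂(cellMeasure d) := by
    rw [integral_prod _ i2]
    refine integral_congr_ae (ae_of_all _ fun x => ?_)
    exact integral_smul_const (fun ω => b₀ x ω) (app (C x) (G i x + basisVec i))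
  rw [integral_add i1 i2, e1, e2, add_comm]
  rfl

/-- First order expansion of the homogenized tensor. -/
lemma homogenized_expansion [MeasurableConstVAdd (Fin d → ℤ) Ω] [ErgodicVAdd (Fin d → ℤ) Ω P]
    (h : IsEllipticPair A C M α β) {b : ℕ → Space d → Ω → ℝ}
    (hbm : ∀ n, AEStronglyMeasurable (Function.uncurry (b n)) ((volume : Measure (Space d)).prod P))
    (hbs : ∀ n, Stationary P (b n))
    (hM : ∀ n, ∀ᵐ p : Space d × Ω ∂((cellMeasure d).prod P), |b n p.1 p.2| ≤ M)
    (hlim : Tendsto (fun n => mixedNorm P (b n)) atTop (𝓝 0))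
    {m : ℕ → ℝ} (hm : ∀ n, m n = (mixedNorm P (b n)).toReal)
    {b₀ : Space d → Ω → ℝ} (hb₀ : IsStationaryField P b₀)
    (hstar : TendstoWeakStar P (fun n x ω => b n x ω / m n) b₀) {i : Fin d}
    {w : ℕ → Fin d → Space d → Ω → ℝ} {gw : ℕ → Fin d → Space d → Ω → Space d}
    (hw : ∀ n, IsCorrector P (perturbed A C (b n)) i (w n i) (gw n i))
    {w₀ : Fin d → Space d → ℝ} {gw₀ : Fin d → Space d → Space d}
    (hw₀ : IsPeriodicCorrector A i (w₀ i) (gw₀ i))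
    {v : Fin d → Space d → Ω → ℝ} {gv : Fin d → Space d → Ω → Space d}
    (hv : IsFirstOrderCorrector P A C b₀ (gw₀ i) i (v i) (gv i)) (j : Fin d) :
    (fun n => homogenized P (perturbed A C (b n)) (gw n) j i - periodicHomogenized A gw₀ j i -
      m n * firstOrderTensor P A C b₀ gw₀ gv j i) =o[atTop] m := by
  -- Testing with the constant field e_j extracts the j-th component of the mean flux.
  have hexp := (corrector_expansion h hbm hbs hM hlim hm hb₀ hstar hw hw₀ hv
    (memLp_const (basisVec j : Space d))).2
  refine hexp.congr_left fun n => ?_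
  have i1 : Integrable (fun p : Space d × Ω =>
      app (perturbed A C (b n) p.1 p.2) (gw n i p.1 p.2 + basisVec i)) ((cellMeasure d).prod P) :=
    (h.memLp_flux ((hbm n).mono_ac (cell_prod_absolutelyContinuous P)) (hM n)
      (memLp_add_basisVec (hw n).isStationaryGradient.memLp i)).integrable one_le_two
  have i2 : Integrable (fun p : Space d × Ω => app (A p.1) (gw₀ i p.1 + basisVec i))
      ((cellMeasure d).prod P) :=
    ((h.memLp_app_cell (memLp_add_basisVec hw₀.memLp i)).integrable one_le_two).comp_fst P
  have i3 : Integrable (fun p : Space d × Ω =>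
      app (A p.1) (gv i p.1 p.2) + b₀ p.1 p.2 • app (C p.1) (gw₀ i p.1 + basisVec i))
      ((cellMeasure d).prod P) :=
    ((h.memLp_app_prod hv.isStationaryGradient.memLp).integrable one_le_two).add
      ((h.memLp_source hb₀ (memLp_add_basisVec hw₀.memLp i)).integrable one_le_two)
  rw [homogenized_apply i1, periodicHomogenized_apply P,
    firstOrderTensor_apply h hb₀ hw₀.memLp hv.isStationaryGradient.memLp]
  have i12 : Integrable (fun p : Space d × Ω =>
      app (perturbed A C (b n) p.1 p.2) (gw n i p.1 p.2 + basisVec i) -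
        app (A p.1) (gw₀ i p.1 + basisVec i)) ((cellMeasure d).prod P) := i1.sub i2
  have i3m : Integrable (fun p : Space d × Ω => m n • (app (A p.1) (gv i p.1 p.2) +
      b₀ p.1 p.2 • app (C p.1) (gw₀ i p.1 + basisVec i))) ((cellMeasure d).prod P) :=
    i3.smul (m n)
  have i123 : Integrable (fun p : Space d × Ω =>
      app (perturbed A C (b n) p.1 p.2) (gw n i p.1 p.2 + basisVec i) -
        app (A p.1) (gw₀ i p.1 + basisVec i) - m n • (app (A p.1) (gv i p.1 p.2) +
      b₀ p.1 p.2 • app (C p.1) (gw₀ i p.1 + basisVec i))) ((cellMeasure d).prod P) := i12.sub i3m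
  rw [integral_inner_basisVec i123, integral_sub i12 i3m, integral_sub i1 i2,
    integral_smul]
  rfl

end

/-! ### Weak compactness and the unit ball of L^∞(Q; L²(Ω)) -/

section

section WeakCompactness

variable {H : Type*} [NormedAddCommGroup H] [InnerProductSpace ℝ H] [CompleteSpace H]

lemma exists_weakly_convergent_subseq_of_separable [TopologicalSpace.SeparableSpace H] {x : ℕ → H}
    {R : ℝ} (hx : ∀ n, ‖x n‖ ≤ R) :
    ∃ θ : ℕ → ℕ, StrictMono θ ∧ ∃ x₀ : H,
      ∀ y, Tendsto (fun n => ⟪x (θ n), y⟫) atTop (𝓝 ⟪x₀, y⟫) := by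
  set φ : ℕ → WeakDual ℝ H := fun n =>
    StrongDual.toWeakDual (InnerProductSpace.toDual ℝ H (x n)) with hφ
  have hmem : ∀ n, φ n ∈ WeakDual.toStrongDual ⁻¹' Metric.closedBall (0 : StrongDual ℝ H) R := by
    intro n
    rw [Set.mem_preimage, mem_closedBall_zero_iff]
    change ‖InnerProductSpace.toDual ℝ H (x n)‖ ≤ R
    rw [LinearIsometryEquiv.norm_map]
    exact hx n
  obtain ⟨a, -, θ, hθ, hlim⟩ := WeakDual.isSeqCompact_closedBall ℝ H 0 R hmem
  refine ⟨θ, hθ, (InnerProductSpace.toDual ℝ H).symm (WeakDual.toStrongDual a), fun y => ?_⟩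
  rw [InnerProductSpace.toDual_symm_apply]
  exact ((WeakDual.eval_continuous y).tendsto a).comp hlim

/-- Bounded sequences of a Hilbert space have weakly convergent subsequences. -/
lemma exists_weakly_convergent_subseq {x : ℕ → H} {R : ℝ} (hx : ∀ n, ‖x n‖ ≤ R) :
    ∃ θ : ℕ → ℕ, StrictMono θ ∧ ∃ x₀ : H,
      ∀ y, Tendsto (fun n => ⟪x (θ n), y⟫) atTop (𝓝 ⟪x₀, y⟫) := by
  -- L²(Q × Ω) need not be separable. The closed span of the sequence is, and projecting the test
  -- vectors onto it changes no inner product.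
  set K := (Submodule.span ℝ (Set.range x)).topologicalClosure with hK
  have hxK : ∀ n, x n ∈ K := fun n =>
    Submodule.le_topologicalClosure _ (Submodule.subset_span ⟨n, rfl⟩)
  have : TopologicalSpace.SeparableSpace K :=
    ((Set.countable_range x).isSeparable.span (R := ℝ)).closure.separableSpace
  have : CompleteSpace K := Submodule.topologicalClosure.completeSpace _
  obtain ⟨θ, hθ, x₀, h⟩ := exists_weakly_convergent_subseq_of_separable (H := K)
    (x := fun n => ⟨x n, hxK n⟩) (R := R) hx
  refine ⟨θ, hθ, x₀, fun y => ?_⟩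
  have h1 := h (K.orthogonalProjectionOnto y)
  simpa only [Submodule.inner_orthogonalProjectionOnto_eq_of_mem_left] using h1

end WeakCompactness

variable {d : ℕ} {Ω : Type*} [MeasurableSpace Ω] {P : Measure Ω} [IsProbabilityMeasure P]

lemma mixedNorm_le_one_iff {f : Space d → Ω → ℝ} :
    mixedNorm P f ≤ 1 ↔ ∀ᵐ x ∂(cellMeasure d), eLpNorm (f x) 2 P ≤ 1 :=
  ⟨fun h => (ENNReal.ae_le_essSup fun x => eLpNorm (f x) 2 P).mono fun _ hx => hx.trans h,
    fun h => essSup_le_of_ae_le _ h⟩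

/-- The norm of the quotient is one unless m = 0. In that case division by zero gives the zero
field, so only the inequality holds in general. -/
lemma mixedNorm_div_le_one {f : Space d → Ω → ℝ} {m : ℝ} (hm : m = (mixedNorm P f).toReal)
    (hf : mixedNorm P f ≠ ∞) : mixedNorm P (fun x ω => f x ω / m) ≤ 1 := by
  refine mixedNorm_le_one_iff.2 ?_
  filter_upwards [ENNReal.ae_le_essSup fun x => eLpNorm (f x) 2 P] with x hx
  have h1 : (fun ω => f x ω / m) = m⁻¹ • f x := by
    ext ω
    rw [Pi.smul_apply, smul_eq_mul, div_eq_inv_mul]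
  change eLpNorm (f x) 2 P ≤ mixedNorm P f at hx
  have hm0 : 0 ≤ m := hm ▸ ENNReal.toReal_nonneg
  rw [← ENNReal.ofReal_toReal hf, ← hm] at hx
  rw [h1, eLpNorm_const_smul, Real.enorm_of_nonneg (inv_nonneg.2 hm0)]
  refine (mul_le_mul_right hx _).trans ?_
  rw [← ENNReal.ofReal_mul (inv_nonneg.2 hm0), ← ENNReal.ofReal_one]
  exact ENNReal.ofReal_le_ofReal (inv_mul_le_one)

lemma memLp_of_mixedNorm_le_one {f : Space d → Ω → ℝ}
    (hf : AEStronglyMeasurable (Function.uncurry f) ((cellMeasure d).prod P))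
    (h : mixedNorm P f ≤ 1) : MemLp (Function.uncurry f) 2 ((cellMeasure d).prod P) ∧
      eLpNorm (Function.uncurry f) 2 ((cellMeasure d).prod P) ≤ 1 := by
  have h1 : eLpNorm (Function.uncurry f) 2 ((cellMeasure d).prod P) ≤ 1 := by
    rw [← ENNReal.pow_le_pow_left_iff two_ne_zero, eLpNorm_two_sq]
    have h2 := lintegral_sq_mul_le_mixedNorm hf (G := fun _ => 1) aemeasurable_const
    simp only [mul_one, lintegral_one, measure_univ] at h2
    exact h2.trans (pow_le_pow_left₀ zero_le h 2)
  exact ⟨⟨hf, h1.trans_lt ENNReal.one_lt_top⟩, h1⟩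

/-- A weak `L²` limit of fields with mixed norm at most one has mixed norm at most one. -/
lemma mixedNorm_le_one_of_tendsto {f : ℕ → Space d → Ω → ℝ} {f₀ : Space d → Ω → ℝ}
    (hf : ∀ n, AEStronglyMeasurable (Function.uncurry (f n)) ((cellMeasure d).prod P))
    (hf1 : ∀ n, mixedNorm P (f n) ≤ 1)
    (hf₀ : MemLp (Function.uncurry f₀) 2 ((cellMeasure d).prod P))
    (hlim : ∀ g : Space d × Ω → ℝ, MemLp g 2 ((cellMeasure d).prod P) →
      Tendsto (fun n => ∫ p : Space d × Ω, f n p.1 p.2 * g p ∂((cellMeasure d).prod P)) atTop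
        (𝓝 (∫ p : Space d × Ω, f₀ p.1 p.2 * g p ∂((cellMeasure d).prod P)))) :
    mixedNorm P f₀ ≤ 1 := by
  set μ := (cellMeasure d).prod P with hμ
  have hm := hf₀.1.enorm.pow_const 2
  have key : ∀ s : Set (Space d), MeasurableSet s → cellMeasure d s < ∞ →
      ∫⁻ x in s, (∫⁻ ω, ‖f₀ x ω‖ₑ ^ 2 ∂P) ∂(cellMeasure d) ≤ ∫⁻ _ in s, 1 ∂(cellMeasure d) := by
    intro s hs _
    have hs' : MeasurableSet (Prod.fst ⁻¹' s : Set (Space d × Ω)) := measurable_fst hs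
    -- Testing with f₀ restricted to s × Ω gives in the limit I ≤ √(|s| I), hence I ≤ |s|. As s is
    -- arbitrary, the bound holds at almost every x.
    set g : Space d × Ω → ℝ := (Prod.fst ⁻¹' s).indicator (Function.uncurry f₀) with hg
    have hgL : MemLp g 2 μ := hf₀.indicator hs'
    set I := ∫⁻ p, ‖g p‖ₑ ^ 2 ∂μ with hI
    have hIfin : I ≠ ∞ := ((memLp_two_iff hgL.1).1 hgL).ne
    have hIeq : I = ∫⁻ x in s, (∫⁻ ω, ‖f₀ x ω‖ₑ ^ 2 ∂P) ∂(cellMeasure d) := by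
      have h1 : ∀ p, ‖g p‖ₑ ^ 2 =
          (Prod.fst ⁻¹' s).indicator (fun p => ‖Function.uncurry f₀ p‖ₑ ^ 2) p := by
        intro p
        by_cases hp : p ∈ (Prod.fst ⁻¹' s : Set (Space d × Ω)) <;> simp [hg, hp]
      have h2 : (Prod.fst ⁻¹' s : Set (Space d × Ω)) = s ×ˢ Set.univ := by ext; simp
      rw [hI, lintegral_congr h1, lintegral_indicator hs', h2, hμ, ← Measure.prod_restrict,
        Measure.restrict_univ, lintegral_prod]
      · rfl
      · have := hm.mono_measure (ν := ((cellMeasure d).restrict s).prod P) (by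
          rw [← Measure.restrict_univ (μ := P), Measure.prod_restrict]
          exact Measure.restrict_le_self)
        exact this
    have hbound : ∀ n, |∫ p : Space d × Ω, f n p.1 p.2 * g p ∂μ| ≤
        Real.sqrt ((cellMeasure d s * I).toReal) := by
      intro n
      refine Real.abs_le_sqrt ?_
      have h1 : (‖∫ p : Space d × Ω, f n p.1 p.2 * g p ∂μ‖ₑ) ^ 2 ≤ cellMeasure d s * I := by
        have h2 : ‖∫ p : Space d × Ω, f n p.1 p.2 * g p ∂μ‖ₑ ≤
            ∫⁻ p, (‖f n p.1 p.2‖ₑ * s.indicator 1 p.1) * ‖g p‖ₑ ∂μ := by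
          refine (enorm_integral_le_lintegral_enorm _).trans (lintegral_mono fun p => ?_)
          by_cases hp : p.1 ∈ s <;> simp [hg, hp]
        have hind : AEMeasurable (fun x : Space d => s.indicator (1 : Space d → ℝ≥0∞) x)
            (cellMeasure d) := (measurable_one.indicator hs).aemeasurable
        refine (pow_le_pow_left₀ zero_le h2 2).trans ?_
        refine (lintegral_mul_sq_le
          (f := fun p : Space d × Ω => ‖f n p.1 p.2‖ₑ * s.indicator 1 p.1)
          ((hf n).enorm.mul hind.comp_fst) hgL.1.enorm).trans ?_
        refine mul_le_mul_left ?_ _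
        have h3 := lintegral_sq_mul_le_mixedNorm (hf n) hind
        simp only [mul_pow]
        have h4 : ∀ x : Space d, s.indicator (1 : Space d → ℝ≥0∞) x ^ 2 =
            s.indicator (1 : Space d → ℝ≥0∞) x := by
          intro x
          by_cases hx : x ∈ s <;> simp [hx]
        simp only [h4]
        refine h3.trans ?_
        rw [lintegral_indicator_one hs]
        exact (mul_le_mul_left (pow_le_one' (hf1 n) 2) _).trans (one_mul _).le
      have h5 := ENNReal.toReal_mono (ENNReal.mul_ne_top (measure_ne_top _ _) hIfin) h1
      rw [ENNReal.toReal_pow, toReal_enorm, Real.norm_eq_abs, sq_abs] at h5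
      exact h5
    have hlimI : ∫ p : Space d × Ω, f₀ p.1 p.2 * g p ∂μ = I.toReal := by
      rw [hI, ← integral_toReal (hgL.1.enorm.pow_const 2)]
      · refine integral_congr_ae (ae_of_all _ fun p => ?_)
        by_cases hp : p.1 ∈ s
        · simp [hg, hp, Function.uncurry, pow_two]
        · simp [hg, hp]
      · exact ae_of_all _ fun p => by simp
    have h6 := le_of_tendsto (hlim g hgL).abs (Eventually.of_forall hbound)
    rw [hlimI, abs_of_nonneg ENNReal.toReal_nonneg, ENNReal.toReal_mul] at h6
    rw [← hIeq, lintegral_one, Measure.restrict_apply_univ]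
    rw [← ENNReal.toReal_le_toReal hIfin (measure_ne_top _ _)]
    by_contra! hlt
    have h7 : (cellMeasure d s).toReal * I.toReal < I.toReal ^ 2 := by
      rw [pow_two]
      exact mul_lt_mul_of_pos_right hlt (ENNReal.toReal_nonneg.trans_lt hlt)
    have h8 := Real.sqrt_lt_sqrt (by positivity) h7
    rw [Real.sqrt_sq ENNReal.toReal_nonneg] at h8
    exact absurd h6 (not_le.2 h8)
  have hle := ae_le_of_forall_setLIntegral_le_of_sigmaFinite₀
    (f := fun x => ∫⁻ ω, ‖f₀ x ω‖ₑ ^ 2 ∂P) hm.lintegral_prod_right' key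
  refine mixedNorm_le_one_iff.2 ?_
  filter_upwards [hle] with x hx
  rw [← ENNReal.pow_le_pow_left_iff two_ne_zero, eLpNorm_two_sq, one_pow]
  exact hx

end

/-! ### Weak-* compactness with stationary limits -/

section

variable {d : ℕ} {Ω : Type*} [MeasurableSpace Ω] {P : Measure Ω} [IsProbabilityMeasure P]

lemma lintegral_mul_le_of_mixedNorm_le_one {f ψ : Space d → Ω → ℝ}
    (hf : AEStronglyMeasurable (Function.uncurry f) ((cellMeasure d).prod P))
    (hf1 : mixedNorm P f ≤ 1)
    (hψ : AEStronglyMeasurable (Function.uncurry ψ) ((cellMeasure d).prod P)) :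
    ∫⁻ p : Space d × Ω, ‖f p.1 p.2‖ₑ * ‖ψ p.1 p.2‖ₑ ∂((cellMeasure d).prod P) ≤
      ∫⁻ x, eLpNorm (ψ x) 2 P ∂(cellMeasure d) := by
  rw [lintegral_prod (fun p : Space d × Ω => ‖f p.1 p.2‖ₑ * ‖ψ p.1 p.2‖ₑ) (hf.enorm.mul hψ.enorm)]
  refine lintegral_mono_ae ?_
  filter_upwards [hf.prodMk_left, hψ.prodMk_left, mixedNorm_le_one_iff.1 hf1] with x h1 h2 h3
  rw [← ENNReal.pow_le_pow_left_iff two_ne_zero]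
  refine (lintegral_mul_sq_le (f := fun ω => ‖f x ω‖ₑ) (g := fun ω => ‖ψ x ω‖ₑ)
    h1.enorm h2.enorm).trans ?_
  rw [← eLpNorm_two_sq, ← eLpNorm_two_sq]
  exact (mul_le_mul_left (pow_le_one' h3 2) _).trans (one_mul _).le

lemma integrable_mul_of_mixedNorm_le_one {f ψ : Space d → Ω → ℝ}
    (hf : AEStronglyMeasurable (Function.uncurry f) ((cellMeasure d).prod P))
    (hf1 : mixedNorm P f ≤ 1)
    (hψ : AEStronglyMeasurable (Function.uncurry ψ) ((cellMeasure d).prod P))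
    (hψI : ∫⁻ x, eLpNorm (ψ x) 2 P ∂(cellMeasure d) < ∞) :
    Integrable (fun p : Space d × Ω => f p.1 p.2 * ψ p.1 p.2) ((cellMeasure d).prod P) := by
  refine ⟨hf.mul hψ, ?_⟩
  refine lt_of_le_of_lt ?_ ((lintegral_mul_le_of_mixedNorm_le_one hf hf1 hψ).trans_lt hψI)
  exact lintegral_mono fun p => by rw [enorm_mul]

/-- Approximation of `L¹(Q; L²(Ω))` by `L²(Q × Ω)`. -/
lemma exists_memLp_approx {ψ : Space d → Ω → ℝ}
    (hψ : AEStronglyMeasurable (Function.uncurry ψ) ((cellMeasure d).prod P))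
    (hψI : ∫⁻ x, eLpNorm (ψ x) 2 P ∂(cellMeasure d) < ∞) {ε : ℝ≥0∞} (hε : 0 < ε) :
    ∃ g : Space d → Ω → ℝ, MemLp (Function.uncurry g) 2 ((cellMeasure d).prod P) ∧
      ∫⁻ x, eLpNorm (fun ω => ψ x ω - g x ω) 2 P ∂(cellMeasure d) < ε := by
  have hNm : AEMeasurable (fun x => eLpNorm (ψ x) 2 P) (cellMeasure d) := by
    have h1 : AEMeasurable (fun x => ∫⁻ ω, ‖ψ x ω‖ₑ ^ 2 ∂P) (cellMeasure d) :=
      (hψ.enorm.pow_const 2).lintegral_prod_right'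
    refine (h1.pow_const (1 / 2 : ℝ)).congr (ae_of_all _ fun x => ?_)
    simp only
    rw [← eLpNorm_two_sq, ← ENNReal.rpow_natCast, ← ENNReal.rpow_mul]
    norm_num
  set N := hNm.mk _ with hN
  have hNN : ∀ᵐ x ∂(cellMeasure d), eLpNorm (ψ x) 2 P = N x := hNm.ae_eq_mk
  -- Truncation keeps ψ where its L²(Ω) norm is at most K, which makes it square integrable; the
  -- discarded part tends to zero by dominated convergence.
  set s : ℕ → Set (Space d) := fun K => {x | N x ≤ K} with hs
  have hsm : ∀ K, MeasurableSet (s K) := fun K => hNm.measurable_mk measurableSet_Iic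
  set g : ℕ → Space d → Ω → ℝ := fun K x ω => (s K).indicator (fun x => ψ x ω) x with hg
  have hgu : ∀ K, Function.uncurry (g K) =
      (Prod.fst ⁻¹' s K : Set (Space d × Ω)).indicator (Function.uncurry ψ) := by
    intro K
    ext p
    by_cases hp : p.1 ∈ s K <;> simp [hg, hp, Function.uncurry]
  have hgm : ∀ K, AEStronglyMeasurable (Function.uncurry (g K)) ((cellMeasure d).prod P) := by
    intro K
    rw [hgu]
    exact hψ.indicator (measurable_fst (hsm K))
  have hlim : Tendsto (fun K => ∫⁻ x, (s K)ᶜ.indicator N x ∂(cellMeasure d)) atTop (𝓝 0) := by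
    have hfin : ∫⁻ x, N x ∂(cellMeasure d) ≠ ∞ := by
      rw [← lintegral_congr_ae hNN]
      exact hψI.ne
    have h1 := tendsto_lintegral_of_dominated_convergence' (μ := cellMeasure d)
      (F := fun K x => (s K)ᶜ.indicator N x) (f := fun _ => 0) N
      (fun K => (hNm.measurable_mk.indicator (hsm K).compl).aemeasurable)
      (fun K => ae_of_all _ fun x => Set.indicator_le_self _ _ _) hfin (by
        filter_upwards [ae_lt_top hNm.measurable_mk hfin] with x hx
        obtain ⟨K₀, hK₀⟩ := ENNReal.exists_nat_gt hx.ne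
        refine tendsto_const_nhds.congr' ?_
        filter_upwards [eventually_ge_atTop K₀] with K hK
        have : x ∈ s K := hK₀.le.trans (by exact_mod_cast hK)
        simp [this])
    simpa using h1
  obtain ⟨K, hK⟩ := ((tendsto_order.1 hlim).2 ε hε).exists
  refine ⟨g K, (memLp_two_iff (hgm K)).2 ?_, lt_of_le_of_lt (lintegral_mono_ae ?_) hK⟩
  · rw [lintegral_prod _ ((hgm K).enorm.pow_const 2)]
    refine lt_of_le_of_lt (lintegral_mono_ae (g := fun _ => (K : ℝ≥0∞) ^ 2) ?_) (by simp)
    filter_upwards [hNN] with x hx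
    by_cases hxs : x ∈ s K
    · have h1 : ∀ ω, Function.uncurry (g K) (x, ω) = ψ x ω := fun ω => by
        simp [hg, hxs, Function.uncurry]
      simp only [h1]
      rw [← eLpNorm_two_sq, hx]
      exact pow_le_pow_left₀ zero_le hxs 2
    · have h1 : ∀ ω, Function.uncurry (g K) (x, ω) = 0 := fun ω => by
        simp [hg, hxs, Function.uncurry]
      simp [h1]
  · filter_upwards [hNN] with x hx
    by_cases hxs : x ∈ s K
    · simp [hg, hxs]
    · simp only [hg, Set.indicator_of_notMem hxs, sub_zero, Set.indicator_of_mem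
        (Set.mem_compl hxs)]
      exact hx.le

/-- On the unit ball of `L^∞(Q; L²(Ω))`, weak convergence in `L²(Q × Ω)` implies weak-`*`
convergence. -/
lemma tendstoWeakStar_of_tendsto {f : ℕ → Space d → Ω → ℝ} {f₀ : Space d → Ω → ℝ}
    (hf : ∀ n, AEStronglyMeasurable (Function.uncurry (f n)) ((cellMeasure d).prod P))
    (hf1 : ∀ n, mixedNorm P (f n) ≤ 1)
    (hf₀ : AEStronglyMeasurable (Function.uncurry f₀) ((cellMeasure d).prod P))
    (hf₀1 : mixedNorm P f₀ ≤ 1)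
    (hlim : ∀ g : Space d × Ω → ℝ, MemLp g 2 ((cellMeasure d).prod P) →
      Tendsto (fun n => ∫ p : Space d × Ω, f n p.1 p.2 * g p ∂((cellMeasure d).prod P)) atTop
        (𝓝 (∫ p : Space d × Ω, f₀ p.1 p.2 * g p ∂((cellMeasure d).prod P)))) :
    TendstoWeakStar P f f₀ := by
  intro ψ hψ hψI
  rw [Metric.tendsto_atTop]
  intro ε hε
  obtain ⟨g, hg, hgψ⟩ := exists_memLp_approx hψ hψI
    (ε := ENNReal.ofReal (ε / 3)) (ENNReal.ofReal_pos.2 (by positivity))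
  -- A field of the unit ball, paired with ψ - g, gives at most the norm of ψ - g in L¹(Q; L²(Ω)).
  -- The estimate is uniform, so it serves the sequence and the limit alike.
  have hclose : ∀ {h : Space d → Ω → ℝ},
      AEStronglyMeasurable (Function.uncurry h) ((cellMeasure d).prod P) → mixedNorm P h ≤ 1 →
      |(∫ p : Space d × Ω, h p.1 p.2 * ψ p.1 p.2 ∂((cellMeasure d).prod P)) -
        ∫ p : Space d × Ω, h p.1 p.2 * g p.1 p.2 ∂((cellMeasure d).prod P)| < ε / 3 := by
    intro h hh hh1
    have i1 := integrable_mul_of_mixedNorm_le_one hh hh1 hψ hψI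
    have i2 : Integrable (fun p : Space d × Ω => h p.1 p.2 * g p.1 p.2)
        ((cellMeasure d).prod P) := (memLp_of_mixedNorm_le_one hh hh1).1.integrable_mul hg
    rw [← integral_sub i1 i2, ← Real.norm_eq_abs, ← ENNReal.ofReal_lt_ofReal_iff (by positivity),
      ofReal_norm]
    refine lt_of_le_of_lt (enorm_integral_le_lintegral_enorm _) (lt_of_le_of_lt ?_ hgψ)
    refine le_trans (le_of_eq (lintegral_congr fun p => ?_))
      (lintegral_mul_le_of_mixedNorm_le_one hh hh1 (ψ := fun x ω => ψ x ω - g x ω) (hψ.sub hg.1))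
    rw [← enorm_mul, mul_sub]
  obtain ⟨n₀, hn₀⟩ := Metric.tendsto_atTop.1 (hlim _ hg) (ε / 3) (by positivity)
  refine ⟨n₀, fun n hn => ?_⟩
  have h1 := hclose (hf n) (hf1 n)
  have h2 := hclose hf₀ hf₀1
  have h3 := hn₀ n hn
  rw [Real.dist_eq] at h3 ⊢
  rw [abs_lt] at *
  simp only [Function.uncurry] at h3
  constructor <;> linarith [h1.1, h1.2, h2.1, h2.2, h3.1, h3.2]

/-- Sequential weak-`*` compactness, with a stationary limit. -/
lemma exists_subseq_tendstoWeakStar [AddAction (Fin d → ℤ) Ω] [MeasurableConstVAdd (Fin d → ℤ) Ω]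
    [VAddInvariantMeasure (Fin d → ℤ) Ω P] {f : ℕ → Space d → Ω → ℝ}
    (hf : ∀ n, AEStronglyMeasurable (Function.uncurry (f n)) ((cellMeasure d).prod P))
    (hf1 : ∀ n, mixedNorm P (f n) ≤ 1) :
    ∃ θ : ℕ → ℕ, StrictMono θ ∧ ∃ f₀ : Space d → Ω → ℝ, IsStationaryField P f₀ ∧
      TendstoWeakStar P (fun n => f (θ n)) f₀ := by
  have hL := fun n => memLp_of_mixedNorm_le_one (hf n) (hf1 n)
  obtain ⟨θ, hθ, x₀, hx₀⟩ := exists_weakly_convergent_subseq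
    (x := fun n => (hL n).1.toLp _) (R := 1) (fun n => by
      rw [Lp.norm_toLp]
      exact ENNReal.toReal_le_of_le_ofReal zero_le_one (by simpa using (hL n).2))
  -- The weak limit is defined on Q × Ω only; its extension cell by cell supplies the stationary
  -- field.
  obtain ⟨f₀, hf₀, hf₀x⟩ := exists_isStationaryL2_of_memLp (Lp.memLp x₀)
  have hlim : ∀ g : Space d × Ω → ℝ, MemLp g 2 ((cellMeasure d).prod P) →
      Tendsto (fun n => ∫ p : Space d × Ω, f (θ n) p.1 p.2 * g p ∂((cellMeasure d).prod P)) atTop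
        (𝓝 (∫ p : Space d × Ω, f₀ p.1 p.2 * g p ∂((cellMeasure d).prod P))) := by
    intro g hg
    have h1 := hx₀ (hg.toLp _)
    have h2 : ∀ n, ⟪(hL (θ n)).1.toLp _, hg.toLp _⟫ =
        ∫ p : Space d × Ω, f (θ n) p.1 p.2 * g p ∂((cellMeasure d).prod P) := fun n => by
      rw [inner_toLp]
      exact integral_congr_ae (ae_of_all _ fun p => mul_comm _ _)
    have h3 : ⟪x₀, hg.toLp _⟫ =
        ∫ p : Space d × Ω, f₀ p.1 p.2 * g p ∂((cellMeasure d).prod P) := by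
      rw [L2.inner_def]
      refine integral_congr_ae ?_
      filter_upwards [hf₀x, hg.coeFn_toLp] with p h4 h5
      rw [← h4, h5]
      exact mul_comm _ _
    simpa only [h2, h3] using h1
  have hone := mixedNorm_le_one_of_tendsto (fun n => hf (θ n)) (fun n => hf1 (θ n)) hf₀.memLp hlim
  exact ⟨θ, hθ, f₀, ⟨hf₀.measurable.aestronglyMeasurable, hf₀.stationary,
    hone.trans_lt ENNReal.one_lt_top⟩, tendstoWeakStar_of_tendsto (fun n => hf (θ n))
    (fun n => hf1 (θ n)) hf₀.memLp.1 hone hlim⟩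

end

end RandomHom

end

theorem theorem2 {d : ℕ} {Ω : Type*} [MeasurableSpace Ω] (P : Measure Ω) [IsProbabilityMeasure P]
    -- the measure-preserving ergodic action of `ℤ^d` on `Ω`
    [AddAction (Fin d → ℤ) Ω] [MeasurableConstVAdd (Fin d → ℤ) Ω]
    [ErgodicVAdd (Fin d → ℤ) Ω P]
    -- the periodic tensors and the random fields `b_η`, `η > 0`
    (A C : Space d → Tensor d) (b : ℝ → Space d → Ω → ℝ) (M α β : ℝ)
    (hA_meas : ∀ j i, AEStronglyMeasurable (fun x => A x j i) volume)
    (hC_meas : ∀ j i, AEStronglyMeasurable (fun x => C x j i) volume)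
    (hA_per : Periodic A) (hC_per : Periodic C)
    (hb_meas : ∀ η > 0, AEStronglyMeasurable (Function.uncurry (b η))
      ((volume : Measure (Space d)).prod P))
    (hb_stat : ∀ η > 0, Stationary P (b η))
    -- uniform bound in `L^∞(Q × Ω)` and convergence to `0` in `L^∞(Q; L²(Ω))`
    (hM : 0 < M)
    (hb_bdd : ∀ η > 0, ∀ᵐ p : Space d × Ω ∂((cellMeasure d).prod P), |b η p.1 p.2| ≤ M)
    (hb_lim : Tendsto (fun η => mixedNorm P (b η)) (𝓝[>] 0) (𝓝 0))
    -- ellipticity and boundedness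
    (hα : 0 < α) (hαβ : α ≤ β)
    (h_coer : ∀ ξ : Space d, ∀ᵐ x : Space d, ∀ s ∈ Set.Icc (-M) M,
      α * ‖ξ‖ ^ 2 ≤ ⟪app (A x) ξ, ξ⟫ ∧ α * ‖ξ‖ ^ 2 ≤ ⟪app (A x + s • C x) ξ, ξ⟫)
    (h_bdd : ∀ ξ : Space d, ∀ᵐ x : Space d, ∀ s ∈ Set.Icc (-M) M,
      ‖app (A x) ξ‖ ≤ β * ‖ξ‖ ∧ ‖app (A x + s • C x) ξ‖ ≤ β * ‖ξ‖)
    -- the correctors `w_i^η` (with gradients `gw η i`) and `w_i^0` (with gradients `gw₀ i`)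
    (w : ℝ → Fin d → Space d → Ω → ℝ) (gw : ℝ → Fin d → Space d → Ω → Space d)
    (hw : ∀ η > 0, ∀ i, IsCorrector P (perturbed A C (b η)) i (w η i) (gw η i))
    (w₀ : Fin d → Space d → ℝ) (gw₀ : Fin d → Space d → Space d)
    (hw₀ : ∀ i, IsPeriodicCorrector A i (w₀ i) (gw₀ i))
    -- `m_η`, the norm of `b_η` in `L^∞(Q; L²(Ω))`
    (m : ℝ → ℝ) (hm : ∀ η, m η = (mixedNorm P (b η)).toReal) :
    -- every sequence of parameters has a subsequence along which `b_η / m_η` converges weakly-*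
    (∀ η : ℕ → ℝ, (∀ n, 0 < η n) → Tendsto η atTop (𝓝 0) →
      ∃ θ : ℕ → ℕ, StrictMono θ ∧ ∃ b₀ : Space d → Ω → ℝ, IsStationaryField P b₀ ∧
        TendstoWeakStar P (fun n x ω => b (η (θ n)) x ω / m (η (θ n))) b₀) ∧
    -- and along every sequence with this property the two expansions hold
    (∀ η : ℕ → ℝ, (∀ n, 0 < η n) → Tendsto η atTop (𝓝 0) →
      ∀ b₀ : Space d → Ω → ℝ, IsStationaryField P b₀ →
      TendstoWeakStar P (fun n x ω => b (η n) x ω / m (η n)) b₀ →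
      -- the problem for `v_i^0` has a solution, which can be chosen with an expectation
      -- such that `∇ 𝔼(v_i^0) = 𝔼(∇ v_i^0)`
      (∀ i, ∃ (v : Space d → Ω → ℝ) (gv : Space d → Ω → Space d),
        IsFirstOrderCorrector P A C b₀ (gw₀ i) i v gv ∧
        (∀ᵐ x : Space d, Integrable (v x) P) ∧
        HasWeakGradient (fun x => ∫ ω, v x ω ∂P) (fun x => ∫ ω, gv x ω ∂P)) ∧
      -- and every solution gives the expansions
      ∀ (v : Fin d → Space d → Ω → ℝ) (gv : Fin d → Space d → Ω → Space d),
        (∀ i, IsFirstOrderCorrector P A C b₀ (gw₀ i) i (v i) (gv i)) →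
        (∀ i, ∀ ψ : Space d × Ω → Space d, MemLp ψ 2 ((cellMeasure d).prod P) →
          (fun n => ∫ p : Space d × Ω,
              ⟪gw (η n) i p.1 p.2 - gw₀ i p.1 - m (η n) • gv i p.1 p.2, ψ p⟫
              ∂((cellMeasure d).prod P))
            =o[atTop] fun n => m (η n)) ∧
        (∀ j i, (fun n => homogenized P (perturbed A C (b (η n))) (gw (η n)) j i
              - periodicHomogenized A gw₀ j i
              - m (η n) * firstOrderTensor P A C b₀ gw₀ gv j i)
            =o[atTop] fun n => m (η n))) := by

  have h : IsEllipticPair A C M α β := ⟨hA_meas, hC_meas, hA_per, hC_per, hM, hα,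
    ae_forall_of_forall_ae h_coer h_bdd⟩
  have hbc : ∀ η > 0, AEStronglyMeasurable (Function.uncurry (b η)) ((cellMeasure d).prod P) :=
    fun η hη => (hb_meas η hη).mono_ac (cell_prod_absolutelyContinuous P)
  refine ⟨fun η hη _ => ?_, fun η hη hη0 b₀ hb₀ hstar => ⟨fun i => ?_, fun v gv hv => ?_⟩⟩
  · refine exists_subseq_tendstoWeakStar (f := fun n x ω => b (η n) x ω / m (η n))
      (fun n => ?_) fun n => ?_
    · simp only [div_eq_mul_inv]
      exact (hbc _ (hη n)).mul aestronglyMeasurable_const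
    -- The bound by M makes the mixed norm finite, so its real value m is the actual norm.
    · exact mixedNorm_div_le_one (hm _)
        ((mixedNorm_le_of_ae_le (hb_bdd _ (hη n))).trans_lt ENNReal.ofReal_lt_top).ne
  · exact exists_isFirstOrderCorrector h hb₀ (hw₀ i)
  · have hlim : Tendsto (fun n => mixedNorm P (b (η n))) atTop (𝓝 0) :=
      hb_lim.comp (tendsto_nhdsWithin_iff.2 ⟨hη0, Eventually.of_forall hη⟩)
    refine ⟨fun i ψ hψ => ?_, fun j i => ?_⟩
    · exact (corrector_expansion h (fun n => hb_meas _ (hη n)) (fun n => hb_stat _ (hη n))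
        (fun n => hb_bdd _ (hη n)) hlim (fun n => hm _) hb₀ hstar (fun n => hw _ (hη n) i)
        (hw₀ i) (hv i) hψ).1
    · exact homogenized_expansion h (fun n => hb_meas _ (hη n)) (fun n => hb_stat _ (hη n))
        (fun n => hb_bdd _ (hη n)) hlim (fun n => hm _) hb₀ hstar (w := fun n => w (η n))
        (gw := fun n => gw (η n)) (fun n => hw _ (hη n) i) (hw₀ i) (hv i) j
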